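/- **Sites.** A *concrete site* $(\mathbb C,J)$ is a small category $\mathbb C$ with a terminal object $\star$, such that $\mathbb C(\star,-)$ is faithful, and an initial object $0$; together with, for each object $c$, a set $J(c)$ of covering families $\{f_i:c_i\to c\}_i$ such that: (C) for every $h:d\to c$ and every covering family of $c$ there is a covering family $\{g_j\}$ of $d$ such that each $h g_j$ factors through some $f_i$; ($\star$) every point $\star\to c$ factors through some member of each covering family of $c$; ($0$) the empty family covers $0$; (M) $\{1_c\}\in J(c)$; (L) covering families compose. Write $|c|=\mathbb C(\star,c)$. A *class $M$ of admissible monos* is a class of monos of $\mathbb C$ that contains all maps $0\to c$ and all isomorphisms, is closed under composition, and whose members have pullbacks along all maps, again in $M$, such that: the presheaf $\Delta_M$ of $M$-subobjects (isomorphism classes of members of $M$ with given codomain) is a $J$-sheaf; $M$-subobjects of $c$ are determined by, and ordered as, the subsets of $|c|$ of the points that factor through them; these subsets are closed under unions of increasing sequences; and if $c_\infty\rightarrowtail c$ is the union of an increasing sequence $(c_n\rightarrowtail c)_{n\in\mathbb N}$ of $M$-subobjects, then some covering family of $c_\infty$ consists of maps each of which factors through some $c_n\rightarrowtail c_\infty$.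 The site $\mathbb C+\mathbb V_0$ with coverage $J\cup J_V$ and class $M\cup M_V$ is obtained from $(\mathbb C,J,M)$ by adding one object $V$ with points $\{0\le1\le\dots\le\infty\}$, the maps $V\to V$ being the $\omega$-continuous functions, and the maps between $V$ and objects of $\mathbb C$ the constant functions; the only covering family of $V$ is $\{1_V\}$, and the new members of the class of monos are the maps $x\mapsto x+n$ on $V$ ($n\in\mathbb N$) and the maps from initial objects to $V$. **Sheaves and lifting.** Let $(\mathbb D,K)$ be a concrete site with a class $N$ of admissible monos. $\mathrm{Sh}(\mathbb D,K)$ is its category of sheaves of sets; a sheaf $X$ is *concrete* if each map $X(c)\to X(\star)^{|c|}$ is injective. $\mathrm{Conc}(\mathbb D,K)$ is the category of sets $|X|$ with, for each $c$, a set $R^c_X$ of functions $|c|\to|X|$ that contains the constant functions, is closed under precomposition with maps of $\mathbb D$, and is such that a function which is in $R_X$ on each member of a covering family is in $R_X^c$; morphisms are the functions $|X|\to|Y|$ that preserve these sets under composition. Both categories are cartesian closed with limits and colimits of sequences and countable coproducts of $1$. The lifting monad $L=L_N$ on sheaves is $(LX)(c)=\coprod_{c'\rightarrowtail c}X(c')$,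 the sum being over the $N$-subobjects of $c$; on $\mathrm{Conc}$ it is $|LX|=|X|\uplus\{\bot\}$, where $R^c_{LX}$ consists of the partial functions whose domain is the set of points of an $N$-subobject $c'\rightarrowtail c$ and whose restriction to it is in $R^{c'}_X$. $L$ is a strong monad with unit $\eta$ and with a natural point $\bot:1\to L$ (the element with empty domain). Let $\omega$ be the colimit of $1\xrightarrow{\bot}L1\xrightarrow{L\bot}LL1\to\cdots$, let $\overline\omega$ be the limit of $1\xleftarrow{!}L1\xleftarrow{L!}LL1\leftarrow\cdots$, and let $i:\omega\to\overline\omega$ be the comparison map. $X$ is *complete* if for every object $A$ each map $A\times\omega\to X$ extends uniquely along $A\times i$, and *well-complete* if $LX$ is complete. **Language.** $\mathrm{PCF_v}$ has the ground types $\mathsf{nat}$ and type constants $\alpha$, and the function types $\tau\to\tau'$; values $x$, $\mathsf 0$, $\mathsf{succ}\,v$, $\mathsf{rec}\,f\,x.\,t$, constants $c\in\mathrm{Val}_\alpha$, and term constants $f:\alpha\to\beta$ between ground types (including $\mathsf{nat}$); and computations $v\,w$, $\mathsf{ret}\,v$, $\mathsf{let}\,x=t\,\mathsf{in}\,t'$,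 $\mathsf{case}\,v\,\mathsf{of}\,\{\mathsf 0\Rightarrow t\mid\mathsf{succ}\,x\Rightarrow t'\}$, with the usual typing. Each $\alpha$ comes with a set $\mathrm{Val}_\alpha$, with $\mathrm{Val}_{\mathsf{nat}}=\mathbb N$, and each $f:\alpha\to\beta$ comes with a partial function $\mathrm{Val}_\alpha\rightharpoonup\mathrm{Val}_\beta$. The relation $t\Downarrow v$ is the usual big-step call-by-value evaluation of closed computations to closed values, where $f\,v\Downarrow w$ if $f(v)=w$. An *interpretation* in one of the two categories over $(\mathbb C+\mathbb V_0,J\cup J_V)$, with $L=L_{M\cup M_V}$, consists of well-complete objects $[\![\alpha]\!]$ (which, in $\mathrm{Sh}$, are concrete sheaves) with set of points $\mathrm{Val}_\alpha$, and morphisms $[\![f]\!]:[\![\alpha]\!]\to L[\![\beta]\!]$ whose action on points is the given partial function (undefined values going to $\bot$). It extends to all types by $[\![\mathsf{nat}]\!]=1+1+\cdots$ and $[\![\tau\to\tau']\!]=([\![\tau]\!]\Rightarrow L[\![\tau']\!])$, and to terms in the standard way for the strong monad $L$. A recursive function, given by a map $g:\Gamma\times F\to F$ with $F=(A\Rightarrow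 LB)$, is interpreted by extending the map $\Gamma\times\omega\to F$ of finite approximations (the iterates of $g$ from $\bot$) uniquely to $\Gamma\times\overline\omega$ and evaluating at the point $\infty$ of $\overline\omega$. **Theorem (Adequacy).** Let $(\mathbb C,J)$ be a concrete site with a class $M$ of admissible monos. Then for every interpretation of $\mathrm{PCF_v}$, both in $\mathrm{Sh}(\mathbb C+\mathbb V_0,J\cup J_V)$ and in $\mathrm{Conc}(\mathbb C+\mathbb V_0,J\cup J_V)$, with the lifting monad $L_{M\cup M_V}$: 1. for every type $\tau$, the object $[\![\tau]\!]$ is complete and well-complete (so that the interpretation of recursive functions is well defined); 2. (soundness) for every closed computation $t$ and closed value $v$ of the same type $\tau$, if $t\Downarrow v$ then $[\![t]\!]=[\![\mathsf{ret}\,v]\!]$; 3. (computational adequacy) for every ground type $\tau$ ($\mathsf{nat}$ or a type constant), closed computation $t:\tau$ and closed value $v:\tau$, if $[\![t]\!]=[\![\mathsf{ret}\,v]\!]$ then $t\Downarrow v$. -/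

import Mathlib

open CategoryTheory Limits MonoidalCategory CartesianMonoidalCategory Opposite

universe u v w v₁ u₁

noncomputable section

namespace SheafPCF

/-! ### The language -/

/-- Ground types: the natural numbers, and the type constants in `K`. -/
inductive Ground (K : Type v) : Type v
  | nat : Ground K
  | const (α : K) : Ground K

/-- Types: ground types and call-by-value function types. -/
inductive Ty (K : Type v) : Type v
  | base (g : Ground K) : Ty K
  | arr (σ τ : Ty K) : Ty K

/-- The set of values attached to a ground type: the natural numbers for `nat`, and the given
set `V α` for a type constant `α`. -/
def Ground.Val {K : Type v} (V : K → Type u) : Ground K → Type u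
  | .nat => ULift.{u} ℕ
  | .const α => V α

/-- The type constants and term constants added to the basic language: each type constant `α`
has a set `Val α` of values, and each term constant `f : src f → tgt f` between ground types is
given a partial function `run f` between the sets of values. -/
structure Signature where
  TyConst : Type v
  Val : TyConst → Type u
  Op : Type w
  src : Op → Ground TyConst
  tgt : Op → Ground TyConst
  run : ∀ f : Op, (src f).Val Val → Option ((tgt f).Val Val)

/-- Typing contexts; the most recently bound variable comes first. -/
abbrev Ctx (K : Type v) := List (Ty K)

/-- Variables of type `τ` in a context, as typed de Bruijn indices. -/
inductive Var {K : Type v} : Ctx K → Ty K → Type v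
  | zero {Γ : Ctx K} {τ : Ty K} : Var (τ :: Γ) τ
  | succ {Γ : Ctx K} {σ τ : Ty K} (x : Var Γ τ) : Var (σ :: Γ) τ

mutual
/-- Well-typed values in context. -/
inductive Value (S : Signature.{u, v, w}) : Ctx S.TyConst → Ty S.TyConst → Type (max u v w)
  | var {Γ : Ctx S.TyConst} {τ : Ty S.TyConst} (x : Var Γ τ) : Value S Γ τ
  | zero {Γ : Ctx S.TyConst} : Value S Γ (.base .nat)
  | succ {Γ : Ctx S.TyConst} (n : Value S Γ (.base .nat)) : Value S Γ (.base .nat)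
  /-- `rec f x. t`: in the body, `x` is the variable `0` and `f` is the variable `1`. -/
  | fn {Γ : Ctx S.TyConst} {σ τ : Ty S.TyConst} (t : Computation S (σ :: .arr σ τ :: Γ) τ) :
      Value S Γ (.arr σ τ)
  | const {Γ : Ctx S.TyConst} {α : S.TyConst} (c : S.Val α) : Value S Γ (.base (.const α))
  | op {Γ : Ctx S.TyConst} (f : S.Op) : Value S Γ (.arr (.base (S.src f)) (.base (S.tgt f)))
/-- Well-typed computations in context. -/
inductive Computation (S : Signature.{u, v, w}) :
    Ctx S.TyConst → Ty S.TyConst → Type (max u v w)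
  | app {Γ : Ctx S.TyConst} {σ τ : Ty S.TyConst} (f : Value S Γ (.arr σ τ)) (a : Value S Γ σ) :
      Computation S Γ τ
  | ret {Γ : Ctx S.TyConst} {τ : Ty S.TyConst} (a : Value S Γ τ) : Computation S Γ τ
  | bind {Γ : Ctx S.TyConst} {σ τ : Ty S.TyConst} (t : Computation S Γ σ)
      (t' : Computation S (σ :: Γ) τ) : Computation S Γ τ
  | case {Γ : Ctx S.TyConst} {τ : Ty S.TyConst} (n : Value S Γ (.base .nat))
      (t : Computation S Γ τ) (t' : Computation S (.base .nat :: Γ) τ) : Computation S Γ τ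
end

variable {S : Signature.{u, v, w}}

/-- Extension of a renaming under a binder. -/
def liftRen {K : Type v} {Γ Δ : Ctx K} (ρ : ∀ τ, Var Γ τ → Var Δ τ) (σ : Ty K) :
    ∀ τ, Var (σ :: Γ) τ → Var (σ :: Δ) τ
  | _, .zero => .zero
  | _, .succ x => .succ (ρ _ x)

mutual
/-- Renaming of variables in a value. -/
def Value.rename : ∀ {Γ Δ : Ctx S.TyConst} {τ : Ty S.TyConst},
    (∀ τ, Var Γ τ → Var Δ τ) → Value S Γ τ → Value S Δ τ
  | _, _, _, ρ, .var x => .var (ρ _ x)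
  | _, _, _, _, .zero => .zero
  | _, _, _, ρ, .succ n => .succ (n.rename ρ)
  | _, _, _, ρ, .fn t => .fn (t.rename (liftRen (liftRen ρ _) _))
  | _, _, _, _, .const c => .const c
  | _, _, _, _, .op f => .op f
/-- Renaming of variables in a computation. -/
def Computation.rename : ∀ {Γ Δ : Ctx S.TyConst} {τ : Ty S.TyConst},
    (∀ τ, Var Γ τ → Var Δ τ) → Computation S Γ τ → Computation S Δ τ
  | _, _, _, ρ, .app f a => .app (f.rename ρ) (a.rename ρ)
  | _, _, _, ρ, .ret a => .ret (a.rename ρ)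
  | _, _, _, ρ, .bind t t' => .bind (t.rename ρ) (t'.rename (liftRen ρ _))
  | _, _, _, ρ, .case n t t' => .case (n.rename ρ) (t.rename ρ) (t'.rename (liftRen ρ _))
end

/-- Extension of a substitution under a binder. -/
def liftSub {Γ Δ : Ctx S.TyConst} (s : ∀ τ, Var Γ τ → Value S Δ τ) (σ : Ty S.TyConst) :
    ∀ τ, Var (σ :: Γ) τ → Value S (σ :: Δ) τ
  | _, .zero => .var .zero
  | _, .succ x => (s _ x).rename (fun _ => Var.succ)

mutual
/-- Simultaneous capture-avoiding substitution in a value. -/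
def Value.subst : ∀ {Γ Δ : Ctx S.TyConst} {τ : Ty S.TyConst},
    (∀ τ, Var Γ τ → Value S Δ τ) → Value S Γ τ → Value S Δ τ
  | _, _, _, s, .var x => s _ x
  | _, _, _, _, .zero => .zero
  | _, _, _, s, .succ n => .succ (n.subst s)
  | _, _, _, s, .fn t => .fn (t.subst (liftSub (liftSub s _) _))
  | _, _, _, _, .const c => .const c
  | _, _, _, _, .op f => .op f
/-- Simultaneous capture-avoiding substitution in a computation. -/
def Computation.subst : ∀ {Γ Δ : Ctx S.TyConst} {τ : Ty S.TyConst},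
    (∀ τ, Var Γ τ → Value S Δ τ) → Computation S Γ τ → Computation S Δ τ
  | _, _, _, s, .app f a => .app (f.subst s) (a.subst s)
  | _, _, _, s, .ret a => .ret (a.subst s)
  | _, _, _, s, .bind t t' => .bind (t.subst s) (t'.subst (liftSub s _))
  | _, _, _, s, .case n t t' => .case (n.subst s) (t.subst s) (t'.subst (liftSub s _))
end

/-- Extension of a substitution by a value for the most recent variable. -/
def consSub {Γ Δ : Ctx S.TyConst} {σ : Ty S.TyConst} (a : Value S Δ σ)
    (s : ∀ τ, Var Γ τ → Value S Δ τ) : ∀ τ, Var (σ :: Γ) τ → Value S Δ τ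
  | _, .zero => a
  | _, .succ x => s _ x

/-- The substitution `t[a/x]` of a closed value for the only free variable. -/
def Computation.inst {σ τ : Ty S.TyConst} (t : Computation S [σ] τ) (a : Value S [] σ) :
    Computation S [] τ :=
  t.subst (consSub a (fun _ x => .var x))

/-- The substitution `t[f/f, a/x]` of closed values for the two free variables of the body of a
recursive function. -/
def Computation.inst₂ {σ τ : Ty S.TyConst} (t : Computation S [σ, .arr σ τ] τ)
    (f : Value S [] (.arr σ τ)) (a : Value S [] σ) : Computation S [] τ :=
  t.subst (consSub a (consSub f (fun _ x => .var x)))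

/-- The numeral `n`. -/
def Value.numeral : ℕ → Value S [] (.base .nat)
  | 0 => .zero
  | n + 1 => .succ (Value.numeral n)

/-- The closed value of ground type given by an element of the set of values of that type. -/
def Value.ofGround : ∀ g : Ground S.TyConst, g.Val S.Val → Value S [] (.base g)
  | .nat, n => .numeral n.down
  | .const _, c => .const c

/-- Big-step operational semantics, between closed computations and closed values. -/
inductive Eval : ∀ {τ : Ty S.TyConst}, Computation S [] τ → Value S [] τ → Prop
  | ret {τ : Ty S.TyConst} (a : Value S [] τ) : Eval (.ret a) a
  | app {σ τ : Ty S.TyConst} (t : Computation S [σ, .arr σ τ] τ) (a : Value S [] σ)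
      (b : Value S [] τ) (h : Eval (t.inst₂ (.fn t) a) b) : Eval (.app (.fn t) a) b
  | bind {σ τ : Ty S.TyConst} (t : Computation S [] σ) (t' : Computation S [σ] τ)
      (a : Value S [] σ) (b : Value S [] τ) (h : Eval t a) (h' : Eval (t'.inst a) b) :
      Eval (.bind t t') b
  | case_zero {τ : Ty S.TyConst} (t : Computation S [] τ) (t' : Computation S [.base .nat] τ)
      (b : Value S [] τ) (h : Eval t b) : Eval (.case .zero t t') b
  | case_succ {τ : Ty S.TyConst} (n : Value S [] (.base .nat)) (t : Computation S [] τ)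
      (t' : Computation S [.base .nat] τ) (b : Value S [] τ) (h : Eval (t'.inst n) b) :
      Eval (.case (.succ n) t t') b
  | op (f : S.Op) (a : (S.src f).Val S.Val) (b : (S.tgt f).Val S.Val) (h : S.run f a = some b) :
      Eval (.app (.op f) (.ofGround _ a)) (.ofGround _ b)

/-! ### Strong monads with a point, completeness and fixed points -/

/-- A strong monad on a category with finite products, with a natural transformation `⊥` from the
constant functor `1` to the monad which is compatible with the strength. -/
structure PointedStrongMonad (E : Type u₁) [Category.{v₁} E] [CartesianMonoidalCategory E] extends
    Monad E where
  str (X Y : E) : X ⊗ toFunctor.obj Y ⟶ toFunctor.obj (X ⊗ Y)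
  str_natural {X X' Y Y' : E} (f : X ⟶ X') (g : Y ⟶ Y') :
    (f ⊗ₘ toFunctor.map g) ≫ str X' Y' = str X Y ≫ toFunctor.map (f ⊗ₘ g)
  str_unit (Y : E) : str (𝟙_ E) Y ≫ toFunctor.map (λ_ Y).hom = (λ_ (toFunctor.obj Y)).hom
  str_assoc (X Y Z : E) :
    (α_ X Y (toFunctor.obj Z)).hom ≫ X ◁ str Y Z ≫ str X (Y ⊗ Z) =
      str (X ⊗ Y) Z ≫ toFunctor.map (α_ X Y Z).hom
  str_η (X Y : E) : X ◁ η.app Y ≫ str X Y = η.app (X ⊗ Y)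
  str_μ (X Y : E) : X ◁ μ.app Y ≫ str X Y =
    str X (toFunctor.obj Y) ≫ toFunctor.map (str X Y) ≫ μ.app (X ⊗ Y)
  bot (X : E) : 𝟙_ E ⟶ toFunctor.obj X
  bot_natural {X Y : E} (f : X ⟶ Y) : bot X ≫ toFunctor.map f = bot Y
  str_bot (X Y : E) : X ◁ bot Y ≫ str X Y = toUnit _ ≫ bot (X ⊗ Y)

section Generic

variable {E : Type u₁} [Category.{v₁} E] [CartesianMonoidalCategory E]
  (L : PointedStrongMonad E)

namespace PointedStrongMonad

/-- The iterated lifting `Lⁿ 1`. -/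
def iter : ℕ → E
  | 0 => 𝟙_ E
  | n + 1 => L.obj (iter n)

/-- The map `Lⁿ ⊥ : Lⁿ 1 ⟶ Lⁿ⁺¹ 1`. -/
def emb : ∀ n : ℕ, L.iter n ⟶ L.iter (n + 1)
  | 0 => L.bot (𝟙_ E)
  | n + 1 => L.map (emb n)

/-- The map `Lⁿ ! : Lⁿ⁺¹ 1 ⟶ Lⁿ 1`. -/
def proj : ∀ n : ℕ, L.iter (n + 1) ⟶ L.iter n
  | 0 => toUnit _
  | n + 1 => L.map (proj n)

/-- The evident maps `Lⁿ 1 ⟶ Lᵐ 1`, inclusions for `n ≤ m` and truncations for `m ≤ n`. -/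
def trunc : ∀ n m : ℕ, L.iter n ⟶ L.iter m
  | _, 0 => toUnit _
  | 0, m + 1 => L.bot (L.iter m)
  | n + 1, m + 1 => L.map (trunc n m)

lemma trunc_self : ∀ n, L.trunc n n = 𝟙 (L.iter n)
  | 0 => toUnit_unique _ _
  | n + 1 => by
    change L.map (L.trunc n n) = _
    rw [trunc_self n]; exact L.map_id _

lemma trunc_proj : ∀ n m, L.trunc n (m + 1) ≫ L.proj m = L.trunc n m
  | n, 0 => by cases n <;> exact toUnit_unique _ _
  | 0, m + 1 => L.bot_natural _
  | n + 1, m + 1 => by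
    change L.map _ ≫ L.map _ = L.map _
    rw [← L.map_comp, trunc_proj n m]

lemma emb_trunc : ∀ n m, L.emb n ≫ L.trunc (n + 1) m = L.trunc n m
  | n, 0 => by cases n <;> exact toUnit_unique _ _
  | 0, m + 1 => L.bot_natural _
  | n + 1, m + 1 => by
    change L.map _ ≫ L.map _ = L.map _
    rw [← L.map_comp, emb_trunc n m]

/-- The points `1 ⟶ Lⁿ 1` given by iterating the unit. -/
def top : ∀ n : ℕ, 𝟙_ E ⟶ L.iter n
  | 0 => 𝟙 _
  | n + 1 => top n ≫ L.η.app (L.iter n)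

lemma top_proj : ∀ n, L.top (n + 1) ≫ L.proj n = L.top n
  | 0 => toUnit_unique _ _
  | n + 1 => by
    have h : (L.top (n + 1) ≫ L.η.app (L.iter (n + 1))) ≫ L.map (L.proj n) =
        L.top n ≫ L.η.app (L.iter n) := by
      refine (Category.assoc _ _ _).trans ?_
      rw [← L.unit_naturality]
      refine (Category.assoc _ _ _).symm.trans ?_
      rw [top_proj n]
    exact h

/-- `ω`, the colimit of `1 ⟶ L 1 ⟶ L L 1 ⟶ ⋯`. -/
def omega [HasColimitsOfShape ℕ E] : E := colimit (Functor.ofSequence L.emb)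

/-- `ω̄`, the limit of `1 ⟵ L 1 ⟵ L L 1 ⟵ ⋯`. -/
def omegaBar [HasLimitsOfShape ℕᵒᵖ E] : E := limit (Functor.ofOpSequence L.proj)

/-- The coprojections `Lⁿ 1 ⟶ ω`. -/
def omegaι [HasColimitsOfShape ℕ E] (n : ℕ) : L.iter n ⟶ L.omega :=
  colimit.ι (Functor.ofSequence L.emb) n

/-- The projections `ω̄ ⟶ Lⁿ 1`. -/
def omegaBarπ [HasLimitsOfShape ℕᵒᵖ E] (n : ℕ) : L.omegaBar ⟶ L.iter n :=
  limit.π (Functor.ofOpSequence L.proj) (op n)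

/-- The map `Γ ⟶ ω̄` determined by a compatible sequence of maps `Γ ⟶ Lⁿ 1`. -/
def toOmegaBar [HasLimitsOfShape ℕᵒᵖ E] {Γ : E} (f : ∀ n, Γ ⟶ L.iter n) (hf : ∀ n, f (n + 1) ≫ L.proj n = f n) :
    Γ ⟶ L.omegaBar :=
  limit.lift (Functor.ofOpSequence L.proj)
    { pt := Γ
      π := NatTrans.ofOpSequence (F := (Functor.const ℕᵒᵖ).obj Γ) (fun n => f n) (fun n => by
        rw [Functor.ofOpSequence_map_homOfLE_succ]
        exact (Category.id_comp _).trans (hf n).symm) }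

/-- The map `ω ⟶ X` determined by a compatible sequence of maps `Lⁿ 1 ⟶ X`. -/
def fromOmega [HasColimitsOfShape ℕ E] {X : E} (f : ∀ n, L.iter n ⟶ X) (hf : ∀ n, L.emb n ≫ f (n + 1) = f n) :
    L.omega ⟶ X :=
  colimit.desc (Functor.ofSequence L.emb)
    { pt := X
      ι := NatTrans.ofSequence (G := (Functor.const ℕ).obj X) (fun n => f n) (fun n => by
        rw [Functor.ofSequence_map_homOfLE_succ]
        exact (hf n).trans (Category.comp_id _).symm) }

lemma toOmegaBar_π [HasLimitsOfShape ℕᵒᵖ E] {Γ : E} (f : ∀ n, Γ ⟶ L.iter n)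
    (hf : ∀ n, f (n + 1) ≫ L.proj n = f n) (n : ℕ) : L.toOmegaBar f hf ≫ L.omegaBarπ n = f n :=
  limit.lift_π _ _

lemma omegaι_fromOmega [HasColimitsOfShape ℕ E] {X : E} (f : ∀ n, L.iter n ⟶ X)
    (hf : ∀ n, L.emb n ≫ f (n + 1) = f n) (n : ℕ) : L.omegaι n ≫ L.fromOmega f hf = f n :=
  colimit.ι_desc _ _

lemma omegaBar_hom_ext [HasLimitsOfShape ℕᵒᵖ E] {Γ : E} {f g : Γ ⟶ L.omegaBar}
    (h : ∀ n : ℕ, f ≫ L.omegaBarπ n = g ≫ L.omegaBarπ n) : f = g :=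
  limit.hom_ext fun n => h n.unop

section Approx

variable [MonoidalClosed E]

/-- The `L`-algebra structure on the exponential `A ⇒ L B`. -/
def algebra (A B : E) : L.obj ((ihom A).obj (L.obj B)) ⟶ (ihom A).obj (L.obj B) :=
  MonoidalClosed.curry
    (L.str A ((ihom A).obj (L.obj B)) ≫ L.map ((ihom.ev A).app (L.obj B)) ≫ L.μ.app B)

/-- The least element of `A ⇒ L B`, in any context. -/
def botExp (Γ A B : E) : Γ ⟶ (ihom A).obj (L.obj B) :=
  toUnit Γ ≫ L.bot _ ≫ L.algebra A B

variable {Γ A B : E}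

/-- The approximations of the fixed point of `g`: on points, `approx g n (ρ, k) = g(ρ, -)ᵏ ⊥`
for `k ≤ n`. -/
def approx (g : Γ ⊗ (ihom A).obj (L.obj B) ⟶ (ihom A).obj (L.obj B)) :
    ∀ n : ℕ, Γ ⊗ L.iter n ⟶ (ihom A).obj (L.obj B)
  | 0 => L.botExp _ A B
  | n + 1 => L.str Γ (L.iter n) ≫ L.map (lift (fst _ _) (approx g n) ≫ g) ≫ L.algebra A B

lemma approx_emb (g : Γ ⊗ (ihom A).obj (L.obj B) ⟶ (ihom A).obj (L.obj B)) :
    ∀ n : ℕ, (Γ ◁ L.emb n) ≫ L.approx g (n + 1) = L.approx g n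
  | 0 => by
    change (Γ ◁ L.bot (𝟙_ E)) ≫ L.str Γ (𝟙_ E) ≫ L.map _ ≫ L.algebra A B =
      toUnit _ ≫ L.bot _ ≫ L.algebra A B
    rw [← Category.assoc, L.str_bot, Category.assoc]
    congr 1
    refine (Category.assoc _ _ _).symm.trans ?_
    exact congrArg (· ≫ L.algebra A B) (L.bot_natural (X := Γ ⊗ 𝟙_ E) _)
  | n + 1 => by
    have h := L.str_natural (𝟙 Γ) (L.emb n)
    rw [id_tensorHom, id_tensorHom] at h
    change (Γ ◁ L.map (L.emb n)) ≫ L.str Γ (L.iter (n + 1)) ≫ L.map _ ≫ L.algebra A B = _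
    rw [← Category.assoc, h, Category.assoc, ← Category.assoc (L.map _) (L.map _),
      ← L.map_comp]
    change _ = L.str Γ (L.iter n) ≫ L.map _ ≫ L.algebra A B
    congr 3
    rw [← Category.assoc, comp_lift, whiskerLeft_fst, approx_emb g n]

end Approx

variable [HasColimitsOfShape ℕ E] [HasLimitsOfShape ℕᵒᵖ E]

/-- The comparison map `i : ω ⟶ ω̄`. -/
def comparison : L.omega ⟶ L.omegaBar :=
  L.fromOmega (fun n => L.toOmegaBar (fun m => L.trunc n m) (fun m => L.trunc_proj n m))
    (fun n => L.omegaBar_hom_ext fun m => by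
      rw [Category.assoc, L.toOmegaBar_π, L.toOmegaBar_π, L.emb_trunc])

/-- The point `∞ : 1 ⟶ ω̄`. -/
def infty : 𝟙_ E ⟶ L.omegaBar := L.toOmegaBar L.top L.top_proj

/-- `X` is `L`-complete: for every object `A`, every map `A × ω ⟶ X` extends uniquely along
`A × i : A × ω ⟶ A × ω̄`. -/
def Complete (X : E) : Prop :=
  ∀ (A : E) (f : A ⊗ L.omega ⟶ X), ∃! g : A ⊗ L.omegaBar ⟶ X, (A ◁ L.comparison) ≫ g = f

/-- `X` is well-complete: `L X` is `L`-complete. -/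
def WellComplete (X : E) : Prop := L.Complete (L.obj X)

variable [MonoidalClosed E] {Γ A B : E}

/-- The approximations glued to a map `Γ × ω ⟶ (A ⇒ L B)`. -/
def approxOmega (g : Γ ⊗ (ihom A).obj (L.obj B) ⟶ (ihom A).obj (L.obj B)) :
    Γ ⊗ L.omega ⟶ (ihom A).obj (L.obj B) :=
  MonoidalClosed.uncurry (L.fromOmega (fun n => MonoidalClosed.curry (L.approx g n))
    (fun n => by rw [← MonoidalClosed.curry_natural_left, L.approx_emb]))

open Classical in
/-- The fixed point `Γ ⟶ (A ⇒ L B)` of `g`: the value at `∞` of the unique extension of the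
approximations to `Γ × ω̄`. It is only meaningful if `A ⇒ L B` is complete, and is given the
junk value `⊥` otherwise. -/
def fix (g : Γ ⊗ (ihom A).obj (L.obj B) ⟶ (ihom A).obj (L.obj B)) :
    Γ ⟶ (ihom A).obj (L.obj B) :=
  if h : L.Complete ((ihom A).obj (L.obj B)) then
    lift (𝟙 Γ) (toUnit Γ ≫ L.infty) ≫ (h Γ (L.approxOmega g)).choose
  else L.botExp Γ A B

end PointedStrongMonad

/-! ### Denotational semantics -/

variable [HasCoproduct (fun _ : ℕ => 𝟙_ E)]

/-- The object `∑₀^∞ 1 = 1 + 1 + ⋯`. -/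
abbrev natObj (E : Type u₁) [Category.{v₁} E] [CartesianMonoidalCategory E]
    [HasCoproduct (fun _ : ℕ => 𝟙_ E)] : E := ∐ fun _ : ℕ => 𝟙_ E

/-- The point `n` of `1 + 1 + ⋯`. -/
abbrev natPt (E : Type u₁) [Category.{v₁} E] [CartesianMonoidalCategory E]
    [HasCoproduct (fun _ : ℕ => 𝟙_ E)] (n : ℕ) : 𝟙_ E ⟶ natObj E :=
  Sigma.ι (fun _ : ℕ => 𝟙_ E) n

/-- The object interpreting a ground type, given objects for the type constants. -/
def groundObj {K : Type v} (X : K → E) : Ground K → E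
  | .nat => natObj E
  | .const α => X α

/-- The point of `groundObj X g` given by an element of the set of values of `g`. -/
def groundPt {K : Type v} {V : K → Type u} {X : K → E} (pt : ∀ α, V α ≃ (𝟙_ E ⟶ X α)) :
    ∀ g : Ground K, g.Val V → (𝟙_ E ⟶ groundObj X g)
  | .nat, n => natPt E n.down
  | .const α, c => pt α c

/-- Interpretation of the type constants and the term constants of a signature: each type
constant `α` is interpreted by an object whose set of points is `Val α`, and each term constant
`f` by a morphism into the lifting whose action on points is the partial function `run f`. -/
structure SigInterp (S : Signature.{u, v, w}) where
  obj : S.TyConst → E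
  pt : ∀ α, S.Val α ≃ (𝟙_ E ⟶ obj α)
  op : ∀ f : S.Op, groundObj obj (S.src f) ⟶ L.obj (groundObj obj (S.tgt f))
  op_some : ∀ (f : S.Op) (a : (S.src f).Val S.Val) (b : (S.tgt f).Val S.Val),
    S.run f a = some b →
      groundPt pt (S.src f) a ≫ op f = groundPt pt (S.tgt f) b ≫ L.η.app _
  op_none : ∀ (f : S.Op) (a : (S.src f).Val S.Val), S.run f a = none →
    groundPt pt (S.src f) a ≫ op f = L.bot _

namespace SigInterp

variable {L} [MonoidalClosed E] (I : SigInterp L S)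

/-- Interpretation of types; `⟦σ → τ⟧ = (⟦σ⟧ ⇒ L ⟦τ⟧)`. -/
def ty : Ty S.TyConst → E
  | .base g => groundObj I.obj g
  | .arr σ τ => (ihom (ty σ)).obj (L.obj (ty τ))

/-- Interpretation of contexts as products. -/
def ctx : Ctx S.TyConst → E
  | [] => 𝟙_ E
  | τ :: Γ => I.ty τ ⊗ ctx Γ

/-- Interpretation of variables as projections. -/
def var : ∀ {Γ : Ctx S.TyConst} {τ : Ty S.TyConst}, Var Γ τ → (I.ctx Γ ⟶ I.ty τ)
  | _, _, .zero => fst _ _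
  | _, _, .succ x => snd _ _ ≫ var x

/-- Case analysis on `1 + 1 + ⋯` in context: `f` at `0`, and `g` at a successor. -/
def natCase {Γ X : E} (f : Γ ⟶ X) (g : natObj E ⊗ Γ ⟶ X) : Γ ⊗ natObj E ⟶ X :=
  MonoidalClosed.uncurry (Sigma.desc fun n : ℕ => MonoidalClosed.curry (A := Γ) (Y := 𝟙_ E)
    (match n with
      | 0 => fst _ _ ≫ f
      | n + 1 => lift (snd _ _ ≫ natPt E n) (fst _ _) ≫ g))

variable [HasColimitsOfShape ℕ E] [HasLimitsOfShape ℕᵒᵖ E]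

mutual
/-- Interpretation of values. -/
def value : ∀ {Γ : Ctx S.TyConst} {τ : Ty S.TyConst}, Value S Γ τ → (I.ctx Γ ⟶ I.ty τ)
  | _, _, .var x => I.var x
  | _, _, .zero => toUnit _ ≫ natPt E 0
  | _, _, .succ n => value n ≫ Sigma.desc fun k : ℕ => natPt E (k + 1)
  | _, _, .fn t => L.fix (MonoidalClosed.curry
      ((_ ◁ lift (snd _ _) (fst _ _)) ≫ comp t))
  | _, _, .const (α := α) c => toUnit _ ≫ I.pt α c
  | _, _, .op f => MonoidalClosed.curry (fst _ _ ≫ I.op f)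
/-- Interpretation of computations, as maps into the lifting. -/
def comp : ∀ {Γ : Ctx S.TyConst} {τ : Ty S.TyConst}, Computation S Γ τ →
    (I.ctx Γ ⟶ L.obj (I.ty τ))
  | _, _, .app (σ := σ) (τ := τ) f a =>
      lift (value a) (value f) ≫ (ihom.ev (I.ty σ)).app (L.obj (I.ty τ))
  | _, _, .ret a => value a ≫ L.η.app _
  | _, _, .bind t t' => lift (𝟙 _) (comp t) ≫ L.str _ _ ≫
      L.map (lift (snd _ _) (fst _ _) ≫ comp t') ≫ L.μ.app _
  | _, _, .case n t t' => lift (𝟙 _) (value n) ≫ natCase (comp t) (comp t')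
end

/-- The interpretation is a sound and computationally adequate model: all types are complete and
well-complete (so that the interpretation of recursive functions makes sense), evaluation is
respected by the interpretation, and at ground types the interpretation determines evaluation. -/
structure SoundAdequate : Prop where
  complete : ∀ τ : Ty S.TyConst, L.Complete (I.ty τ) ∧ L.WellComplete (I.ty τ)
  sound : ∀ (τ : Ty S.TyConst) (t : Computation S [] τ) (a : Value S [] τ),
    Eval t a → I.comp t = I.comp (.ret a)
  adequate : ∀ (g : Ground S.TyConst) (t : Computation S [] (.base g))
    (a : Value S [] (.base g)), I.comp t = I.comp (.ret a) → Eval t a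

end SigInterp

end Generic

/-! ### Concrete sites and admissible monos -/

section Sites

/-- A concrete site: a small category with a terminal object `star` such that a morphism is
determined by its action on the points `star ⟶ c`, an initial object `zero`, and a coverage
satisfying five axioms. Mathlib's `Coverage` contains the first axiom: covering families are
stable under pullback, in the sense that for `h : d ⟶ c` and a covering family of `c`, there is a
covering family of `d` whose members composed with `h` factor through members of the family of
`c`. A covering family is a set of morphisms with codomain `c`, that is, a presieve on `c`. -/
structure ConcreteSite (C : Type u) [SmallCategory C] where
  star : C
  isTerminal : IsTerminal star
  zero : C
  isInitial : IsInitial zero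
  faithful {c d : C} (f g : c ⟶ d) (h : ∀ p : star ⟶ c, p ≫ f = p ≫ g) : f = g
  cov : Coverage C
  cov_points {c : C} (R : Presieve c) (hR : R ∈ cov c) (p : star ⟶ c) :
    ∃ (d : C) (f : d ⟶ c), R f ∧ ∃ q : star ⟶ d, q ≫ f = p
  cov_zero : (⊥ : Presieve zero) ∈ cov zero
  cov_id (c : C) : Presieve.singleton (𝟙 c) ∈ cov c
  cov_bind {c : C} (R : Presieve c) (hR : R ∈ cov c)
    (T : ∀ ⦃d : C⦄ ⦃f : d ⟶ c⦄, R f → Presieve d)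
    (hT : ∀ ⦃d : C⦄ ⦃f : d ⟶ c⦄ (hf : R f), T hf ∈ cov d) : Presieve.bind R T ∈ cov c

/-- The morphism `f` factors through `m`. -/
def FactorsVia {C : Type u} [SmallCategory C] {c d e : C} (f : e ⟶ c) (m : d ⟶ c) : Prop :=
  ∃ g : e ⟶ d, g ≫ m = f

/-- A class of monos which contains the isomorphisms and is closed under composition, such that
pullbacks of its members along arbitrary maps exist and are again members. -/
structure StableMonos (C : Type u) [SmallCategory C] where
  mem : MorphismProperty C
  mono {c d : C} (m : d ⟶ c) (hm : mem m) : Mono m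
  iso {c d : C} (m : d ⟶ c) (hm : IsIso m) : mem m
  comp {c d e : C} (m : d ⟶ c) (m' : e ⟶ d) (hm : mem m) (hm' : mem m') : mem (m' ≫ m)
  pullback {c d e : C} (m : d ⟶ c) (f : e ⟶ c) (hm : mem m) :
    ∃ (e' : C) (f' : e' ⟶ d) (m' : e' ⟶ e), IsPullback f' m' m f ∧ mem m'

namespace StableMonos

variable {C : Type u} [SmallCategory C] (M : StableMonos C)

/-- A sieve is classified by `M` if it consists of the morphisms that factor through some fixed
member of `M`. Such sieves are the same as `M`-subobjects, i.e. isomorphism classes of members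
of `M` with a given codomain. -/
def Classified {c : C} (T : Sieve c) : Prop :=
  ∃ (d : C) (m : d ⟶ c), M.mem m ∧ ∀ ⦃e : C⦄ (f : e ⟶ c), T f ↔ FactorsVia f m

lemma Classified.pullback {M : StableMonos C} {c d : C} {T : Sieve c} (hT : M.Classified T)
    (f : d ⟶ c) : M.Classified (T.pullback f) := by
  obtain ⟨e, m, hm, h⟩ := hT
  obtain ⟨e', f', m', hp, hm'⟩ := M.pullback m f hm
  refine ⟨e', m', hm', fun a k => ?_⟩
  rw [Sieve.pullback_apply, h]
  constructor
  · rintro ⟨g, hg⟩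
    exact ⟨hp.lift g k hg, hp.lift_snd _ _ _⟩
  · rintro ⟨g, rfl⟩
    exact ⟨g ≫ f', by rw [Category.assoc, hp.w, Category.assoc]⟩

/-- The presheaf `Δ` of `M`-subobjects, with action by pullback. -/
def subPresheaf : Cᵒᵖ ⥤ Type u where
  obj c := { T : Sieve c.unop // M.Classified T }
  map f := ↾fun T => ⟨T.1.pullback f.unop, T.2.pullback f.unop⟩

end StableMonos

/-- A class of admissible monos on a concrete site: a class of monos which contains the maps
`0 ⟶ c` and the isomorphisms, is closed under composition and pullback, whose presheaf of
subobjects is a sheaf, and such that: subobjects are determined by, and ordered as, their sets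
of points; the sets of points of subobjects are closed under unions of increasing sequences; and
if `m∞ : c∞ ⟶ c` is the union of the increasing sequence of subobjects `m n : c n ⟶ c`, then
`c∞` has a covering family all of whose members factor through some `c n ⟶ c∞`. -/
structure AdmissibleMonos {C : Type u} [SmallCategory C] (S : ConcreteSite C) extends
    StableMonos C where
  zero (c : C) : mem (S.isInitial.to c)
  reflect {c d d' : C} (m : d ⟶ c) (m' : d' ⟶ c) (hm : mem m) (hm' : mem m')
    (h : ∀ p : S.star ⟶ c, FactorsVia p m → FactorsVia p m') : FactorsVia m m'
  sup {c : C} (d : ℕ → C) (m : ∀ n, d n ⟶ c) (hm : ∀ n, mem (m n))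
    (h : ∀ n, FactorsVia (m n) (m (n + 1))) :
    ∃ (d' : C) (m' : d' ⟶ c), mem m' ∧
      ∀ p : S.star ⟶ c, FactorsVia p m' ↔ ∃ n, FactorsVia p (m n)
  chain_cover {c : C} (d : ℕ → C) (m : ∀ n, d n ⟶ c) (hm : ∀ n, mem (m n))
    (h : ∀ n, FactorsVia (m n) (m (n + 1))) {d' : C} (m' : d' ⟶ c) (hm' : mem m')
    (h' : ∀ p : S.star ⟶ c, FactorsVia p m' ↔ ∃ n, FactorsVia p (m n)) :
    ∃ R ∈ S.cov d', ∀ ⦃e : C⦄ (f : e ⟶ d'), R f → ∃ n, FactorsVia (f ≫ m') (m n)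
  sheaf {c : C} (R : Presieve c) (hR : R ∈ S.cov c) :
    Presieve.IsSheafFor toStableMonos.subPresheaf R

section Local

variable {C : Type u} [SmallCategory C] {S : ConcreteSite C}

/-- A member of `M` through which all points factor is split. -/
lemma AdmissibleMonos.factors (A : AdmissibleMonos S) {c d e : C} (m : d ⟶ c) (hm : A.mem m)
    (f : e ⟶ c) (h : ∀ p : S.star ⟶ e, FactorsVia (p ≫ f) m) : FactorsVia f m := by
  obtain ⟨e', f', m', hp, hm'⟩ := A.pullback m f hm
  obtain ⟨g, hg⟩ := A.reflect (𝟙 e) m' (A.iso _ inferInstance) hm' (fun p _ => by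
    obtain ⟨q, hq⟩ := h p
    exact ⟨hp.lift q p hq, hp.lift_snd _ _ _⟩)
  exact ⟨g ≫ f', by rw [Category.assoc, hp.w, ← Category.assoc, hg, Category.id_comp]⟩

/-- Membership in an admissible class can be checked locally. -/
lemma AdmissibleMonos.local_mem (A : AdmissibleMonos S) {c : C} (U : Set (S.star ⟶ c))
    (R : Presieve c) (hR : R ∈ S.cov c)
    (h : ∀ ⦃d : C⦄ (f : d ⟶ c), R f → ∃ (e : C) (m : e ⟶ d), A.mem m ∧
      ∀ p : S.star ⟶ d, p ≫ f ∈ U ↔ FactorsVia p m) :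
    ∃ (e : C) (m : e ⟶ c), A.mem m ∧ ∀ p : S.star ⟶ c, p ∈ U ↔ FactorsVia p m := by
  choose e m hm hp using h
  -- arrows all of whose points lie in `U`
  let T : Sieve c :=
    { arrows := fun _ f => ∀ p, p ≫ f ∈ U
      downward_closed := fun hf g p => by rw [← Category.assoc]; exact hf _ }
  have hT : ∀ ⦃d : C⦄ (f : d ⟶ c) (hf : R f), A.Classified (T.pullback f) := by
    intro d f hf
    refine ⟨_, m f hf, hm f hf, fun a k => ⟨fun hk => A.factors _ (hm f hf) _ fun p => ?_, ?_⟩⟩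
    · exact (hp f hf _).1 (by rw [Category.assoc]; exact hk p)
    · rintro ⟨g, rfl⟩ p
      rw [← Category.assoc]
      exact (hp f hf _).2 ⟨p ≫ g, by rw [Category.assoc]⟩
  let x : Presieve.FamilyOfElements A.subPresheaf R := fun d f hf => ⟨T.pullback f, hT f hf⟩
  have hx : x.Compatible := by
    intro d d' a g g' f f' hf hf' hgf
    apply Subtype.ext
    change (T.pullback f).pullback g = (T.pullback f').pullback g'
    rw [← Sieve.pullback_comp, ← Sieve.pullback_comp, hgf]
  obtain ⟨y, hy, -⟩ := A.sheaf R hR x hx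
  obtain ⟨e', m', hm', h'⟩ := y.2
  refine ⟨e', m', hm', fun p => ?_⟩
  obtain ⟨d, f, hf, q, rfl⟩ := S.cov_points R hR p
  have hyf : (y.1.pullback f) = T.pullback f := congrArg Subtype.val (hy f hf)
  rw [← h', ← Sieve.pullback_apply, hyf, Sieve.pullback_apply]
  constructor
  · intro hU r
    rwa [S.isTerminal.hom_ext r (𝟙 _), Category.id_comp]
  · intro hU
    have := hU (𝟙 _)
    rwa [Category.id_comp] at this

/-- The presheaf of subobjects is a sheaf if membership can be checked locally. -/
lemma StableMonos.isSheafFor_of_local (M : StableMonos C)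
    (reflect : ∀ {c d d' : C} (m : d ⟶ c) (m' : d' ⟶ c), M.mem m → M.mem m' →
      (∀ p : S.star ⟶ c, FactorsVia p m → FactorsVia p m') → FactorsVia m m')
    {c : C} (R : Presieve c) (hR : R ∈ S.cov c)
    (h : ∀ U : Set (S.star ⟶ c), (∀ ⦃d : C⦄ (f : d ⟶ c), R f →
        ∃ (e : C) (m : e ⟶ d), M.mem m ∧ ∀ p : S.star ⟶ d, p ≫ f ∈ U ↔ FactorsVia p m) →
      ∃ (e : C) (m : e ⟶ c), M.mem m ∧ ∀ p : S.star ⟶ c, p ∈ U ↔ FactorsVia p m) :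
    Presieve.IsSheafFor M.subPresheaf R := by
  have key : ∀ {d : C} (T T' : Sieve d), M.Classified T → M.Classified T' →
      (∀ p : S.star ⟶ d, T p → T' p) → T ≤ T' := by
    rintro d T T' ⟨e, m, hm, hT⟩ ⟨e', m', hm', hT'⟩ hp a f hf
    obtain ⟨g, rfl⟩ := (hT f).1 hf
    obtain ⟨k, rfl⟩ := reflect m m' hm hm' (fun p h => (hT' p).1 (hp p ((hT p).2 h)))
    exact (hT' _).2 ⟨g ≫ k, Category.assoc _ _ _⟩
  have key' : ∀ {d : C} (T T' : Sieve d), M.Classified T → M.Classified T' →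
      (∀ p : S.star ⟶ d, T p ↔ T' p) → T = T' := fun T T' h h' hp =>
    le_antisymm (key T T' h h' fun p => (hp p).1) (key T' T h' h fun p => (hp p).2)
  intro x hx
  have hx' : ∀ {d d' : C} {f : d ⟶ c} {f' : d' ⟶ c} (hf : R f) (hf' : R f') (q : S.star ⟶ d)
      (q' : S.star ⟶ d'), q ≫ f = q' ≫ f' → ((x f hf).1 q ↔ (x f' hf').1 q') := by
    intro d d' f f' hf hf' q q' hq
    have h1 : (x f hf).1.pullback q = (x f' hf').1.pullback q' :=
      congrArg Subtype.val (hx q q' hf hf' hq)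
    have h2 : (x f hf).1.pullback q (𝟙 _) ↔ (x f' hf').1.pullback q' (𝟙 _) := by rw [h1]
    rwa [Sieve.pullback_apply, Sieve.pullback_apply, Category.id_comp, Category.id_comp] at h2
  let U : Set (S.star ⟶ c) :=
    { p | ∃ (d : C) (f : d ⟶ c) (hf : R f) (q : S.star ⟶ d), q ≫ f = p ∧ (x f hf).1 q }
  have hU : ∀ {d : C} {f : d ⟶ c} (hf : R f) (q : S.star ⟶ d), q ≫ f ∈ U ↔ (x f hf).1 q := by
    intro d f hf q
    constructor
    · rintro ⟨d', f', hf', q', hq, h'⟩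
      exact (hx' hf' hf q' q hq).1 h'
    · exact fun h' => ⟨d, f, hf, q, rfl, h'⟩
  obtain ⟨e, m, hm, hmU⟩ := h U (fun d f hf => by
    obtain ⟨e, m, hm, h'⟩ := (x f hf).2
    exact ⟨e, m, hm, fun p => (hU hf p).trans (h' p)⟩)
  let T : Sieve c :=
    { arrows := fun _ f => FactorsVia f m
      downward_closed := by
        rintro _ _ f ⟨g, rfl⟩ k
        exact ⟨k ≫ g, Category.assoc _ _ _⟩ }
  have hT : M.Classified T := ⟨e, m, hm, fun _ _ => Iff.rfl⟩
  refine ⟨⟨T, hT⟩, fun d f hf => Subtype.ext ?_, fun y hy => Subtype.ext ?_⟩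
  · refine key' _ _ (hT.pullback f) (x f hf).2 fun q => ?_
    exact (hmU _).symm.trans (hU hf q)
  · refine key' _ _ y.2 hT fun p => ?_
    obtain ⟨d, f, hf, q, rfl⟩ := S.cov_points R hR p
    have h1 : y.1.pullback f = (x f hf).1 := congrArg Subtype.val (hy f hf)
    rw [← Sieve.pullback_apply, h1]
    exact (hU hf q).symm.trans (hmU _)

end Local

/-! ### Adjoining the vertical natural numbers -/

/-- The objects of `C + V₀`: those of `C`, and one more object `V`. The terminal and initial
objects of `V₀ = {V, ⋆, 0}` are identified with those of `C`. -/
inductive WithV {C : Type u} [SmallCategory C] (S : ConcreteSite C) : Type u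
  | base (c : C) : WithV S
  | V : WithV S

namespace WithV

variable {C : Type u} [SmallCategory C]

/-- The points of the objects of `C + V₀`; the points of `V` are `0 ≤ 1 ≤ ⋯ ≤ ∞`. -/
@[reducible] def Pt (S : ConcreteSite C) : WithV S → Type u
  | .base c => S.star ⟶ c
  | .V => ULift.{u} ℕ∞

/-- The morphisms of `C + V₀`, as functions between points: those of `C`, the `ω`-continuous
functions `V ⟶ V`, and the constant functions between `V` and the objects of `C`. -/
def IsMor (S : ConcreteSite C) : ∀ a b : WithV S, (Pt S a → Pt S b) → Prop
  | .base c, .base d, φ => ∃ f : c ⟶ d, ∀ p : S.star ⟶ c, φ p = p ≫ f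
  | .V, .V, φ => OmegaCompletePartialOrder.ωScottContinuous fun n : ℕ∞ => (φ ⟨n⟩).down
  | .base _, .V, φ => ∃ y, ∀ p, φ p = y
  | .V, .base _, φ => ∃ y, ∀ p, φ p = y

lemma IsMor.const {S : ConcreteSite C} :
    ∀ {a b : WithV S} {φ : Pt S a → Pt S b} (y : Pt S b), (∀ p, φ p = y) → IsMor S a b φ
  | .base c, .base d, φ, y, h => ⟨S.isTerminal.from c ≫ y, fun p => by
      rw [h, ← Category.assoc, S.isTerminal.hom_ext (p ≫ _) (𝟙 _)]
      exact (Category.id_comp _).symm⟩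
  | .V, .V, φ, y, h => by
      have : (fun n : ℕ∞ => (φ ⟨n⟩).down) = fun _ => y.down := funext fun n => by rw [h]
      change OmegaCompletePartialOrder.ωScottContinuous fun n : ℕ∞ => (φ ⟨n⟩).down
      rw [this]
      exact OmegaCompletePartialOrder.ωScottContinuous.const
  | .base _, .V, φ, y, h => ⟨y, h⟩
  | .V, .base _, φ, y, h => ⟨y, h⟩

lemma IsMor.id {S : ConcreteSite C} : ∀ a : WithV S, IsMor S a a fun p => p
  | .base c => ⟨𝟙 c, fun p => (Category.comp_id p).symm⟩
  | .V => OmegaCompletePartialOrder.ωScottContinuous.id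

lemma IsMor.comp {S : ConcreteSite C} : ∀ {a b c : WithV S} {φ : Pt S a → Pt S b}
    {ψ : Pt S b → Pt S c}, IsMor S a b φ → IsMor S b c ψ → IsMor S a c fun p => ψ (φ p)
  | .base _, .base _, .base _, φ, ψ, ⟨f, hf⟩, ⟨g, hg⟩ => ⟨f ≫ g, fun p => by
      change ψ (φ p) = _
      rw [hg, hf, Category.assoc]⟩
  | .V, .V, .V, φ, ψ, hφ, hψ =>
      OmegaCompletePartialOrder.ωScottContinuous.comp (g := fun n : ℕ∞ => (ψ ⟨n⟩).down)
        (f := fun n : ℕ∞ => (φ ⟨n⟩).down) hψ hφ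
  | .base _, .V, _, φ, ψ, ⟨y, hy⟩, _ => .const (ψ y) fun p => congrArg ψ (hy p)
  | .V, .base _, _, φ, ψ, ⟨y, hy⟩, _ => .const (ψ y) fun p => congrArg ψ (hy p)
  | .base _, .base _, .V, φ, ψ, _, ⟨y, hy⟩ => .const y fun _ => hy _
  | .V, .V, .base _, φ, ψ, _, ⟨y, hy⟩ => .const y fun _ => hy _

variable (S : ConcreteSite C)

instance : SmallCategory (WithV S) where
  Hom a b := { φ : Pt S a → Pt S b // IsMor S a b φ }
  id a := ⟨fun p => p, .id a⟩
  comp f g := ⟨fun p => g.1 (f.1 p), f.2.comp g.2⟩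

variable {S}

lemma hom_ext' {a b : WithV S} {f g : a ⟶ b} (h : ∀ p, f.1 p = g.1 p) : f = g :=
  Subtype.ext (funext h)

@[simp] lemma comp_val {a b c : WithV S} (f : a ⟶ b) (g : b ⟶ c) (p : Pt S a) :
    (f ≫ g).1 p = g.1 (f.1 p) := rfl

@[simp] lemma id_val {a : WithV S} (p : Pt S a) : (𝟙 a : a ⟶ a).1 p = p := rfl

/-- Constant morphisms. -/
def constHom (a : WithV S) {b : WithV S} (y : Pt S b) : a ⟶ b := ⟨fun _ => y, .const y fun _ => rfl⟩

variable (S) in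
/-- The inclusion of `C` in `C + V₀`. -/
abbrev incl : C ⥤ WithV S where
  obj c := .base c
  map f := ⟨fun p => p ≫ f, f, fun _ => rfl⟩
  map_id c := hom_ext' fun p => Category.comp_id p
  map_comp f g := hom_ext' fun p => (Category.assoc _ _ _).symm

lemma incl_map_val {c d : C} (f : c ⟶ d) (p : S.star ⟶ c) :
    ((incl S).map f).1 p = p ≫ f := rfl

instance : (incl S).Full where
  map_surjective := by
    rintro c d ⟨φ, f, hf⟩
    exact ⟨f, hom_ext' fun p => (hf p).symm⟩

instance : (incl S).Faithful where
  map_injective {c d f g} h := S.faithful f g fun p =>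
    congrFun (congrArg Subtype.val h) p

lemma no_pt (p : S.star ⟶ S.zero) : False := by
  obtain ⟨_, _, h, _⟩ := S.cov_points _ S.cov_zero p
  exact h

variable (S) in
/-- The terminal object of `C + V₀`. -/
abbrev star' : WithV S := (incl S).obj S.star

variable (S) in
/-- The initial object of `C + V₀`. -/
abbrev zero' : WithV S := (incl S).obj S.zero

variable (S) in
/-- The point of `⋆`. -/
def pt₀ : Pt S (star' S) := 𝟙 S.star

lemma pt_unique (p : Pt S (star' S)) : p = pt₀ S := S.isTerminal.hom_ext _ _

variable (S) in
def isTerminal : IsTerminal (star' S) :=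
  IsTerminal.ofUniqueHom (fun a => constHom a (pt₀ S))
    (fun _ _ => hom_ext' fun _ => (pt_unique _).trans (pt_unique _).symm)

lemma isMor_zero : ∀ (b : WithV S) (φ : Pt S (zero' S) → Pt S b), IsMor S (zero' S) b φ
  | .base c, _ => ⟨S.isInitial.to c, fun p => (no_pt p).elim⟩
  | .V, _ => ⟨⟨0⟩, fun p => (no_pt p).elim⟩

variable (S) in
def isInitial : IsInitial (zero' S) :=
  IsInitial.ofUniqueHom
    (fun b => ⟨fun p => (no_pt p).elim, isMor_zero b _⟩)
    (fun _ _ => hom_ext' fun p => (no_pt p).elim)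

/-- The covering families of `C + V₀`: those of `C`, and the identity of `V`. -/
def Covers : ∀ a : WithV S, Set (Presieve a)
  | .base c => { R | ∃ R₀ ∈ S.cov c, R = R₀.map (incl S) }
  | .V => { R | R = Presieve.singleton (𝟙 (V : WithV S)) }

variable (S) in
lemma covers_id : ∀ a : WithV S, Presieve.singleton (𝟙 a) ∈ Covers a
  | .base c => ⟨_, S.cov_id c, by
      rw [Presieve.map_singleton]; exact congrArg _ ((incl S).map_id c).symm⟩
  | .V => rfl

lemma covers_points : ∀ {a : WithV S} (R : Presieve a), R ∈ Covers a → ∀ p : Pt S a,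
    ∃ (d : WithV S) (f : d ⟶ a), R f ∧ ∃ q : Pt S d, f.1 q = p
  | .base c, _, ⟨R₀, hR₀, rfl⟩, p => by
    obtain ⟨d, f, hf, q, hq⟩ := S.cov_points R₀ hR₀ p
    exact ⟨_, _, Presieve.map_map hf, q, hq⟩
  | .V, _, rfl, p => ⟨_, _, Presieve.singleton_self _, p, rfl⟩

variable (S) in
/-- The coverage of `C + V₀`. -/
def coverage : Coverage (WithV S) where
  coverings := Covers
  pullback := by
    intro a b f R hR
    by_cases hc : ∃ y, ∀ p, f.1 p = y
    · by_cases hb : Nonempty (Pt S b)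
      · obtain ⟨y, hy⟩ := hc
        obtain ⟨d, g, hg, q, hq⟩ := covers_points R hR y
        refine ⟨_, covers_id S b, ?_⟩
        rintro _ _ ⟨⟩
        exact ⟨d, constHom _ q, g, hg, hom_ext' fun p => hq.trans (hy p).symm⟩
      · match b, f, hb with
        | .V, _, hb => exact (hb ⟨⟨0⟩⟩).elim
        | .base d, f, hb =>
          match a, f, R, hR with
          | .base c, f, _, ⟨R₀, hR₀, rfl⟩ =>
            obtain ⟨f₀, rfl⟩ := (incl S).map_surjective f
            obtain ⟨T, hT, h⟩ := S.cov.pullback f₀ R₀ hR₀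
            refine ⟨_, ⟨T, hT, rfl⟩, ?_⟩
            rintro _ _ ⟨ht⟩
            obtain ⟨e, k, g, hg, hk⟩ := h ht
            exact ⟨_, (incl S).map k, (incl S).map g, Presieve.map_map hg, by
              exact ((incl S).map_comp _ _).symm.trans (hk ▸ (incl S).map_comp _ _)⟩
          | .V, f, _, rfl =>
            refine ⟨_, covers_id S _, ?_⟩
            rintro _ _ ⟨⟩
            exact ⟨_, f, _, Presieve.singleton_self _, rfl⟩
    · match a, b, f, R, hR, hc with
      | .base c, .base d, f, _, ⟨R₀, hR₀, rfl⟩, _ =>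
        obtain ⟨f₀, rfl⟩ := (incl S).map_surjective f
        obtain ⟨T, hT, h⟩ := S.cov.pullback f₀ R₀ hR₀
        refine ⟨_, ⟨T, hT, rfl⟩, ?_⟩
        rintro _ _ ⟨ht⟩
        obtain ⟨e, k, g, hg, hk⟩ := h ht
        exact ⟨_, (incl S).map k, (incl S).map g, Presieve.map_map hg, by
          exact ((incl S).map_comp _ _).symm.trans (hk ▸ (incl S).map_comp _ _)⟩
      | .base _, .V, f, _, _, hc => exact (hc f.2).elim
      | .V, .base _, f, _, _, hc => exact (hc f.2).elim
      | .V, .V, f, _, rfl, _ =>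
        refine ⟨_, covers_id S _, ?_⟩
        rintro _ _ ⟨⟩
        exact ⟨_, f, _, Presieve.singleton_self _, rfl⟩

lemma covers_bind : ∀ {a : WithV S} (R : Presieve a), R ∈ Covers a →
    ∀ (T : ∀ ⦃d : WithV S⦄ ⦃f : d ⟶ a⦄, R f → Presieve d),
    (∀ ⦃d : WithV S⦄ ⦃f : d ⟶ a⦄ (hf : R f), T hf ∈ Covers d) → Presieve.bind R T ∈ Covers a
  | .base c, _, ⟨R₀, hR₀, rfl⟩, T, hT => by
    have h : ∀ ⦃d : C⦄ ⦃f : d ⟶ c⦄ (hf : R₀ f), ∃ R ∈ S.cov d,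
        T (Presieve.map_map (F := incl S) hf) = R.map (incl S) := fun d f hf =>
        hT (Presieve.map_map (F := incl S) hf)
    choose T₀ hT₀ hT' using h
    refine ⟨_, S.cov_bind R₀ hR₀ T₀ hT₀, ?_⟩
    apply le_antisymm
    · rintro e k ⟨d, g, f, hf, hg, rfl⟩
      obtain ⟨hf'⟩ := hf
      rw [hT' hf'] at hg
      obtain ⟨hg'⟩ := hg
      rw [← Functor.map_comp]
      exact Presieve.map_map ⟨_, _, _, hf', hg', rfl⟩
    · rintro _ _ ⟨⟨d, g, f, hf, hg, rfl⟩⟩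
      rw [Functor.map_comp]
      refine ⟨_, _, _, Presieve.map_map hf, ?_, rfl⟩
      rw [hT' hf]
      exact Presieve.map_map hg
  | .V, _, rfl, T, hT => by
    have h := hT (Presieve.singleton_self _)
    change T _ = _ at h
    change Presieve.bind _ T = _
    apply le_antisymm
    · rintro e k ⟨d, g, f, hf, hg, rfl⟩
      obtain ⟨⟩ := hf
      rw [h] at hg
      obtain ⟨⟩ := hg
      exact Presieve.singleton_self _
    · rintro _ _ ⟨⟩
      refine ⟨_, 𝟙 _, 𝟙 _, Presieve.singleton_self _, ?_, rfl⟩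
      rw [h]
      exact Presieve.singleton_self _

/-- A point as a morphism from the terminal object. -/
def ofPt {a : WithV S} (y : Pt S a) : star' S ⟶ a := constHom _ y

lemma ofPt_val {a : WithV S} (p : star' S ⟶ a) : ofPt (p.1 (pt₀ S)) = p :=
  hom_ext' fun q => congrArg p.1 (pt_unique q).symm

variable (S) in
/-- The concrete site `C + V₀`. -/
def site : ConcreteSite (WithV S) where
  star := star' S
  isTerminal := isTerminal S
  zero := zero' S
  isInitial := isInitial S
  faithful f g h := hom_ext' fun p =>
    congrFun (congrArg Subtype.val (h (ofPt p))) (pt₀ S)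
  cov := coverage S
  cov_points R hR p := by
    obtain ⟨d, f, hf, q, hq⟩ := covers_points R hR (p.1 (pt₀ S))
    refine ⟨d, f, hf, ofPt q, ?_⟩
    rw [← ofPt_val p, ← hq]
    rfl
  cov_zero := ⟨⊥, S.cov_zero, by
    apply le_antisymm bot_le
    rintro _ _ ⟨h⟩
    exact h.elim⟩
  cov_id := covers_id S
  cov_bind := covers_bind

end WithV

/-! ### The admissible monos of `C + V₀` -/

section VOrder

lemma ωcont_add (n : ℕ) : OmegaCompletePartialOrder.ωScottContinuous fun x : ℕ∞ => x + n := by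
  rw [OmegaCompletePartialOrder.ωScottContinuous_iff_monotone_map_ωSup]
  exact ⟨fun x y h => add_le_add_left h _, fun c => ENat.iSup_add _⟩

lemma ωcont_sub (n : ℕ) : OmegaCompletePartialOrder.ωScottContinuous fun x : ℕ∞ => x - n := by
  have h : GaloisConnection (fun x : ℕ∞ => x - n) (fun x : ℕ∞ => x + n) :=
    fun x y => tsub_le_iff_right
  rw [OmegaCompletePartialOrder.ωScottContinuous_iff_monotone_map_ωSup]
  exact ⟨h.monotone_l, fun c => h.l_iSup⟩

/-- The subsets `∅` and `{k | n ≤ k}` of `{0 ≤ 1 ≤ ⋯ ≤ ∞}`, for finite `n`. -/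
def VOpen (U : Set ℕ∞) : Prop := U = ∅ ∨ ∃ n : ℕ, U = { x | (n : ℕ∞) ≤ x }

lemma VOpen.of_upper {U : Set ℕ∞} (h : IsUpperSet U)
    (hU : ∀ x ∈ U, ∃ n : ℕ, (n : ℕ∞) ≤ x ∧ (n : ℕ∞) ∈ U) : VOpen U := by
  classical
  by_cases hne : ∃ n : ℕ, (n : ℕ∞) ∈ U
  · refine Or.inr ⟨Nat.find hne, Set.ext fun x => ⟨fun hx => ?_, fun hx => ?_⟩⟩
    · obtain ⟨n, hn, hn'⟩ := hU x hx
      exact le_trans (by exact_mod_cast Nat.find_min' hne hn') hn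
    · exact h hx (Nat.find_spec hne)
  · refine Or.inl (Set.eq_empty_iff_forall_notMem.2 fun x hx => hne ?_)
    obtain ⟨n, -, hn⟩ := hU x hx
    exact ⟨n, hn⟩

lemma VOpen.upper {U : Set ℕ∞} (h : VOpen U) : IsUpperSet U := by
  rcases h with rfl | ⟨n, rfl⟩
  · exact fun _ _ _ h => h
  · exact fun _ _ h h' => le_trans h' h

lemma VOpen.finite {U : Set ℕ∞} (h : VOpen U) (x : ℕ∞) (hx : x ∈ U) :
    ∃ n : ℕ, (n : ℕ∞) ≤ x ∧ (n : ℕ∞) ∈ U := by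
  rcases h with rfl | ⟨n, rfl⟩
  · exact hx.elim
  · exact ⟨n, hx, le_refl (n : ℕ∞)⟩

lemma VOpen.iUnion {ι : Type*} {U : ι → Set ℕ∞} (h : ∀ i, VOpen (U i)) : VOpen (⋃ i, U i) := by
  refine .of_upper (isUpperSet_iUnion fun i => (h i).upper) fun x hx => ?_
  obtain ⟨i, hi⟩ := Set.mem_iUnion.1 hx
  obtain ⟨n, hn, hn'⟩ := (h i).finite x hi
  exact ⟨n, hn, Set.mem_iUnion.2 ⟨i, hn'⟩⟩

lemma VOpen.preimage {U : Set ℕ∞} (h : VOpen U) {f : ℕ∞ → ℕ∞}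
    (hf : OmegaCompletePartialOrder.ωScottContinuous f) : VOpen (f ⁻¹' U) := by
  refine .of_upper (fun x y hxy hx => h.upper (hf.monotone hxy) hx) fun x hx => ?_
  by_cases hx' : x = ⊤
  · subst hx'
    obtain ⟨n, hn, hn'⟩ := h.finite _ hx
    let c : OmegaCompletePartialOrder.Chain ℕ∞ := ⟨fun k => (k : ℕ∞), Nat.mono_cast⟩
    have hc : OmegaCompletePartialOrder.ωSup c = ⊤ := ENat.iSup_natCast
    have h1 : f ⊤ = ⨆ k : ℕ, f k := by
      rw [← hc]; exact hf.map_ωSup c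
    by_contra hcon
    push Not at hcon
    have h2 : ∀ k : ℕ, f k < n := fun k => by
      by_contra hk
      exact hcon k le_top (h.upper (not_lt.1 hk) hn')
    match n, hn, h2 with
    | 0, _, h2 => exact absurd (h2 0) (by simp)
    | m + 1, hn, h2 =>
      have h3 : f ⊤ ≤ (m : ℕ∞) := by
        rw [h1]
        refine iSup_le fun k => ?_
        have := h2 k
        push_cast at this
        exact Order.le_of_lt_add_one this
      have h4 := hn.trans h3
      have h5 : m + 1 ≤ m := by exact_mod_cast h4
      omega
  · lift x to ℕ using hx'
    exact ⟨x, le_rfl, hx⟩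

end VOrder

namespace WithV

variable {C : Type u} [SmallCategory C] {S : ConcreteSite C} (A : AdmissibleMonos S)

/-- The union of `A` and the admissible monos of `V₀`: on the objects of `C`, the members of `A`;
on `V`, the maps `x ↦ x + n` and the maps `0 ⟶ V` (where `0` is any initial object, that is, any
object without points). -/
def Mem : MorphismProperty (WithV S)
  | .base c, .base d, f => ∃ m : c ⟶ d, A.mem m ∧ f = (incl S).map m
  | .base c, .V, _ => IsEmpty (S.star ⟶ c)
  | .V, .base _, _ => False
  | .V, .V, f => ∃ n : ℕ, ∀ x : ℕ∞, (f.1 ⟨x⟩).down = x + n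

/-- The image of a morphism, as a set of points. -/
def im {a b : WithV S} (m : a ⟶ b) : Set (Pt S b) := Set.range m.1

/-- Sets of points which are the image of a member of the class. -/
def Open {b : WithV S} (U : Set (Pt S b)) : Prop :=
  ∃ (a : WithV S) (m : a ⟶ b), Mem A m ∧ U = im m

lemma im_shift (f : (V : WithV S) ⟶ V) (n : ℕ) (hf : ∀ x : ℕ∞, (f.1 ⟨x⟩).down = x + n) :
    im f = { y | (n : ℕ∞) ≤ y.down } := by
  ext y
  constructor
  · rintro ⟨x, rfl⟩
    change _ ≤ (f.1 ⟨x.down⟩).down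
    rw [hf]
    exact le_add_self
  · intro hy
    exact ⟨⟨y.down - n⟩, ULift.ext _ _ ((hf _).trans (tsub_add_cancel_of_le hy))⟩

lemma open_V {U : Set (Pt S (V : WithV S))} :
    Open A U ↔ VOpen { x : ℕ∞ | (⟨x⟩ : ULift ℕ∞) ∈ U } := by
  constructor
  · rintro ⟨a, m, hm, rfl⟩
    match a, m, hm with
    | .base c, m, hm =>
      refine Or.inl (Set.eq_empty_iff_forall_notMem.2 ?_)
      rintro x ⟨p, -⟩
      exact IsEmpty.false (self := hm) p
    | .V, m, ⟨n, hn⟩ =>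
      refine Or.inr ⟨n, ?_⟩
      rw [im_shift m n hn]
      rfl
  · rintro (h | ⟨n, h⟩)
    · refine ⟨_, (isInitial S).to _, ⟨fun p => no_pt p⟩, Set.ext fun x => ⟨fun hx => ?_, ?_⟩⟩
      · have : x.down ∈ { x : ℕ∞ | (⟨x⟩ : ULift ℕ∞) ∈ U } := hx
        rw [h] at this
        exact this.elim
      · rintro ⟨p, -⟩
        exact (no_pt p).elim
    · refine ⟨V, ⟨fun x => ⟨x.down + n⟩, ωcont_add n⟩, ⟨n, fun _ => rfl⟩, ?_⟩
      rw [im_shift _ n (fun _ => rfl)]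
      ext x
      exact Set.ext_iff.1 h x.down

lemma open_base {c : C} {U : Set (Pt S (base c : WithV S))} :
    Open A U ↔ ∃ (d : C) (m : d ⟶ c), A.mem m ∧ ∀ p : S.star ⟶ c, p ∈ U ↔ FactorsVia p m := by
  constructor
  · rintro ⟨a, m, hm, rfl⟩
    match a, m, hm with
    | .base d, _, ⟨m, hm, rfl⟩ => exact ⟨d, m, hm, fun p => Iff.rfl⟩
    | .V, m, hm => exact hm.elim
  · rintro ⟨d, m, hm, h⟩
    exact ⟨base d, (incl S).map m, ⟨m, hm, rfl⟩, Set.ext h⟩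

lemma open_univ : ∀ b : WithV S, Open A (Set.univ : Set (Pt S b))
  | .base c => (open_base A).2 ⟨c, 𝟙 c, A.iso _ inferInstance, fun p =>
      ⟨fun _ => ⟨p, Category.comp_id p⟩, fun _ => trivial⟩⟩
  | .V => (open_V A).2 (Or.inr ⟨0, Set.ext fun x => ⟨fun _ => show ((0 : ℕ) : ℕ∞) ≤ x by simp, fun _ => trivial⟩⟩)

lemma mem_zero : ∀ b : WithV S, Mem A ((isInitial S).to b)
  | .base c => ⟨S.isInitial.to c, A.zero c, (isInitial S).hom_ext _ _⟩
  | .V => ⟨fun p => no_pt p⟩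

lemma open_empty (b : WithV S) : Open A (∅ : Set (Pt S b)) :=
  ⟨_, _, mem_zero A b, Set.ext fun _ => ⟨fun h => h.elim, fun ⟨p, _⟩ => (no_pt p).elim⟩⟩

lemma open_preimage_const {a b : WithV S} (f : a ⟶ b) (y : Pt S b) (hy : ∀ p, f.1 p = y)
    (U : Set (Pt S b)) : Open A (f.1 ⁻¹' U) := by
  by_cases h : y ∈ U
  · have : f.1 ⁻¹' U = Set.univ := Set.eq_univ_of_forall fun p => by
      rw [Set.mem_preimage, hy]; exact h
    rw [this]
    exact open_univ A a
  · have : f.1 ⁻¹' U = ∅ := Set.eq_empty_iff_forall_notMem.2 fun p hp => h (by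
      rw [Set.mem_preimage, hy] at hp; exact hp)
    rw [this]
    exact open_empty A a

lemma open_preimage : ∀ {a b : WithV S} (f : a ⟶ b) {U : Set (Pt S b)}, Open A U →
    Open A (f.1 ⁻¹' U)
  | .base c, .base d, f, U, hU => by
    obtain ⟨f, rfl⟩ := (incl S).map_surjective f
    obtain ⟨e, m, hm, h⟩ := (open_base A).1 hU
    obtain ⟨e', f', m', hp, hm'⟩ := A.pullback m f hm
    refine (open_base A).2 ⟨e', m', hm', fun p => (h _).trans ⟨?_, ?_⟩⟩
    · rintro ⟨g, hg⟩
      exact ⟨hp.lift g p hg, hp.lift_snd _ _ _⟩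
    · rintro ⟨g, rfl⟩
      exact ⟨g ≫ f', by rw [Category.assoc, hp.w, ← Category.assoc]⟩
  | .V, .V, f, U, hU => (open_V A).2 (VOpen.preimage ((open_V A).1 hU) f.2)
  | .base _, .V, f, U, _ => by
    obtain ⟨y, hy⟩ := f.2
    exact open_preimage_const A f y hy U
  | .V, .base _, f, U, _ => by
    obtain ⟨y, hy⟩ := f.2
    exact open_preimage_const A f y hy U

lemma mem_injective : ∀ {a b : WithV S} (m : a ⟶ b), Mem A m → Function.Injective m.1
  | .base _, .base _, _, ⟨m, hm, rfl⟩ => fun p q h => by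
    have := A.mono m hm
    exact (cancel_mono m).1 h
  | .base _, .V, _, hm => fun p _ _ => (IsEmpty.false (self := hm) p).elim
  | .V, .base _, _, hm => hm.elim
  | .V, .V, m, ⟨n, hn⟩ => fun x y h => by
    have h' : x.down + n = y.down + n := by
      rw [← hn, ← hn]
      exact congrArg ULift.down h
    exact ULift.ext _ _ (ENat.add_left_injective_of_ne_top (ENat.natCast_ne_top n) h')

/-- Maps whose image lies in the image of a member of the class factor through it. -/
lemma factors_of_im : ∀ {a b c : WithV S} (m : a ⟶ b) (_ : Mem A m) (f : c ⟶ b),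
    im f ⊆ im m → FactorsVia f m
  | .base d, .base c, .base e, _, ⟨m, hm, rfl⟩, f, h => by
    obtain ⟨f, rfl⟩ := (incl S).map_surjective f
    obtain ⟨g, hg⟩ := A.factors m hm f fun p => h ⟨p, rfl⟩
    exact ⟨(incl S).map g, by rw [← hg]; exact ((incl S).map_comp _ _).symm⟩
  | .base _, .base _, .V, _, ⟨m, hm, rfl⟩, f, h => by
    obtain ⟨y, hy⟩ := f.2
    obtain ⟨q, hq⟩ := h ⟨⟨0⟩, rfl⟩
    exact ⟨constHom _ q, hom_ext' fun p => (hq.trans (hy _)).trans (hy p).symm⟩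
  | .base d, .V, .base e, m, hm, f, h => by
    have he : IsEmpty (S.star ⟶ e) := ⟨fun p => by
      obtain ⟨q, -⟩ := h ⟨p, rfl⟩
      exact IsEmpty.false (self := hm) q⟩
    obtain ⟨g, -⟩ := A.factors (S.isInitial.to e) (A.zero e) (𝟙 e) fun p => (he.false p).elim
    exact ⟨(incl S).map (g ≫ S.isInitial.to d), hom_ext' fun p => (he.false p).elim⟩
  | .base _, .V, .V, m, hm, f, h => by
    obtain ⟨q, -⟩ := h ⟨⟨0⟩, rfl⟩
    exact (IsEmpty.false (self := hm) q).elim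
  | .V, .base _, _, _, hm, _, _ => hm.elim
  | .V, .V, .base e, m, hm, f, h => by
    by_cases he : Nonempty (S.star ⟶ e)
    · obtain ⟨p⟩ := he
      obtain ⟨y, hy⟩ := f.2
      obtain ⟨q, hq⟩ := h ⟨p, rfl⟩
      exact ⟨constHom _ q, hom_ext' fun p' => (hq.trans (hy _)).trans (hy p').symm⟩
    · exact ⟨constHom _ ⟨0⟩, hom_ext' fun p => (he ⟨p⟩).elim⟩
  | .V, .V, .V, m, ⟨n, hn⟩, f, h => by
    refine ⟨⟨fun x => ⟨(f.1 x).down - n⟩, ?_⟩, hom_ext' fun x => ULift.ext _ _ ?_⟩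
    · exact OmegaCompletePartialOrder.ωScottContinuous.comp (g := fun x : ℕ∞ => x - n)
        (f := fun x : ℕ∞ => (f.1 ⟨x⟩).down) (ωcont_sub n) f.2
    · have h' : f.1 x ∈ im m := h ⟨x, rfl⟩
      rw [im_shift m n hn] at h'
      exact (hn _).trans (tsub_add_cancel_of_le h')

lemma im_comp {a b c : WithV S} (m : a ⟶ b) (f : c ⟶ a) : im (f ≫ m) ⊆ im m := by
  rintro _ ⟨p, rfl⟩
  exact ⟨_, rfl⟩

lemma factorsVia_pt {a b : WithV S} (m : a ⟶ b) (p : star' S ⟶ b) :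
    FactorsVia p m ↔ p.1 (pt₀ S) ∈ im m := by
  constructor
  · rintro ⟨g, rfl⟩
    exact ⟨_, rfl⟩
  · rintro ⟨q, hq⟩
    exact ⟨ofPt q, by rw [← ofPt_val p, ← hq]; rfl⟩

lemma mem_iso : ∀ {a b : WithV S} (f : a ⟶ b), IsIso f → Mem A f
  | .base c, .base d, f, _ => by
    obtain ⟨f, rfl⟩ := (incl S).map_surjective f
    exact ⟨f, A.iso f (isIso_of_reflects_iso f (incl S)), rfl⟩
  | .base c, .V, f, _ => by
    obtain ⟨y, hy⟩ := f.2
    have h : ∀ x : Pt S (V : WithV S), x = y := fun x => by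
      have := congrFun (congrArg Subtype.val (IsIso.inv_hom_id f)) x
      exact this.symm.trans (hy _)
    have h01 : (0 : ℕ∞) = 1 := congrArg ULift.down ((h ⟨0⟩).trans (h ⟨1⟩).symm)
    exact absurd h01 (by simp)
  | .V, .base c, f, _ => by
    obtain ⟨y, hy⟩ := f.2
    have h : ∀ x : Pt S (V : WithV S), x = (inv f).1 y := fun x => by
      have := congrFun (congrArg Subtype.val (IsIso.hom_inv_id f)) x
      exact this.symm.trans (congrArg (inv f).1 (hy x))
    have h01 : (0 : ℕ∞) = 1 := congrArg ULift.down ((h ⟨0⟩).trans (h ⟨1⟩).symm)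
    exact absurd h01 (by simp)
  | .V, .V, f, _ => by
    have h1 : ∀ x, f.1 ((inv f).1 x) = x := fun x =>
      congrFun (congrArg Subtype.val (IsIso.inv_hom_id f)) x
    have h2 : ∀ x, (inv f).1 (f.1 x) = x := fun x =>
      congrFun (congrArg Subtype.val (IsIso.hom_inv_id f)) x
    have m1 : Monotone fun x : ℕ∞ => (f.1 ⟨x⟩).down :=
      OmegaCompletePartialOrder.ωScottContinuous.monotone f.2
    have m2 : Monotone fun x : ℕ∞ => ((inv f).1 ⟨x⟩).down :=
      OmegaCompletePartialOrder.ωScottContinuous.monotone (inv f).2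
    let e : ℕ∞ ≃o ℕ∞ :=
      { toFun := fun x => (f.1 ⟨x⟩).down
        invFun := fun x => ((inv f).1 ⟨x⟩).down
        left_inv := fun x => congrArg ULift.down (h2 ⟨x⟩)
        right_inv := fun x => congrArg ULift.down (h1 ⟨x⟩)
        map_rel_iff' := fun {x y} => ⟨fun h => by
          have := m2 h
          have hx := congrArg ULift.down (h2 ⟨x⟩)
          have hy := congrArg ULift.down (h2 ⟨y⟩)
          dsimp only at hx hy
          rw [← hx, ← hy]
          exact this, fun h => m1 h⟩ }
    refine ⟨0, fun x => ?_⟩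
    have he : e = OrderIso.refl ℕ∞ := Subsingleton.elim _ _
    have : (f.1 ⟨x⟩).down = x := congrArg (fun e : ℕ∞ ≃o ℕ∞ => e x) he
    exact this.trans (by simp)

lemma mem_comp : ∀ {a b c : WithV S} (m : b ⟶ a) (m' : c ⟶ b), Mem A m → Mem A m' →
    Mem A (m' ≫ m)
  | .base _, .base _, .base _, _, _, ⟨m, hm, rfl⟩, ⟨m', hm', rfl⟩ =>
    ⟨m' ≫ m, A.comp m m' hm hm', ((incl S).map_comp _ _).symm⟩
  | .V, .base _, .base _, _, m', hm, _ => ⟨fun p => IsEmpty.false (self := hm) (m'.1 p)⟩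
  | .V, .V, .base _, _, _, _, hm' => hm'
  | .V, .V, .V, m, m', ⟨n, hn⟩, ⟨k, hk⟩ => ⟨k + n, fun x => by
      have : (m.1 ⟨(m'.1 ⟨x⟩).down⟩).down = x + ((k + n : ℕ) : ℕ∞) := by
        rw [hn, hk, add_assoc, Nat.cast_add]
      exact this⟩
  | .base _, .V, _, _, _, hm, _ => hm.elim
  | _, .base _, .V, _, _, _, hm' => hm'.elim

/-- The class of monos of `C + V₀`. -/
def stable : StableMonos (WithV S) where
  mem := Mem A
  mono m hm := ⟨fun f g h => hom_ext' fun p =>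
    mem_injective A m hm (congrFun (congrArg Subtype.val h) p)⟩
  iso := mem_iso A
  comp := mem_comp A
  pullback {c d e} m f hm := by
    obtain ⟨e', m', hm', h⟩ := open_preimage A f (U := im m) ⟨_, m, hm, rfl⟩
    obtain ⟨f', hf'⟩ := factors_of_im A m hm (m' ≫ f) (by
      rintro _ ⟨p, rfl⟩
      have : m'.1 p ∈ f.1 ⁻¹' im m := by rw [h]; exact ⟨p, rfl⟩
      exact this)
    have hmono : Mono m' := ⟨fun f g h => hom_ext' fun p =>
      mem_injective A m' hm' (congrFun (congrArg Subtype.val h) p)⟩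
    have hmono' : Mono m := ⟨fun f g h => hom_ext' fun p =>
      mem_injective A m hm (congrFun (congrArg Subtype.val h) p)⟩
    have hs : ∀ s : PullbackCone m f, im s.snd ⊆ im m' := by
      rintro s _ ⟨p, rfl⟩
      rw [← h]
      exact ⟨s.fst.1 p, congrFun (congrArg Subtype.val s.condition) p⟩
    choose l hl using fun s => factors_of_im A m' hm' s.snd (hs s)
    refine ⟨e', f', m', ⟨⟨hf'⟩, ⟨PullbackCone.IsLimit.mk _ l ?_ hl ?_⟩⟩, hm'⟩
    · intro s
      rw [← cancel_mono m, Category.assoc, hf', ← Category.assoc,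
        hl, s.condition]
    · intro s g _ hg
      rw [← cancel_mono m', hg, hl]

lemma stable_reflect {c d d' : WithV S} (m : d ⟶ c) (m' : d' ⟶ c) (hm' : Mem A m')
    (h : ∀ p : star' S ⟶ c, FactorsVia p m → FactorsVia p m') : FactorsVia m m' := by
  refine factors_of_im A m' hm' m ?_
  intro y hy
  have := (factorsVia_pt m' (ofPt y)).1 (h (ofPt y) ((factorsVia_pt m _).2 hy))
  exact this

lemma stable_sup : ∀ {c : WithV S} (d : ℕ → WithV S) (m : ∀ n, d n ⟶ c)
    (_ : ∀ n, Mem A (m n)) (_ : ∀ n, FactorsVia (m n) (m (n + 1))),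
    Open A (⋃ n, im (m n))
  | .base c, d, m, hm, h => by
    have h1 : ∀ n, Open A (im (m n)) := fun n => ⟨_, m n, hm n, rfl⟩
    choose d₀ m₀ hm₀ h₀ using fun n => (open_base A).1 (h1 n)
    obtain ⟨d', m', hm', h'⟩ := A.sup d₀ m₀ hm₀ (fun n => A.reflect _ _ (hm₀ n) (hm₀ _)
      fun p hp => by
        rw [← h₀] at hp ⊢
        obtain ⟨g, hg⟩ := h n
        rw [← hg] at hp
        exact im_comp _ _ hp)
    refine (open_base A).2 ⟨d', m', hm', fun p => ?_⟩
    rw [h', Set.mem_iUnion]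
    exact exists_congr fun n => h₀ n p
  | .V, d, m, hm, _ => by
    refine (open_V A).2 ?_
    have h1 : ∀ n, VOpen { x : ℕ∞ | (⟨x⟩ : ULift ℕ∞) ∈ im (m n) } :=
      fun n => (open_V A).1 ⟨_, m n, hm n, rfl⟩
    have h2 : { x : ℕ∞ | (⟨x⟩ : ULift ℕ∞) ∈ ⋃ n, im (m n) } =
        ⋃ n, { x : ℕ∞ | (⟨x⟩ : ULift ℕ∞) ∈ im (m n) } := by
      ext x
      simp
    rw [h2]
    exact VOpen.iUnion h1

lemma stable_chain_cover : ∀ {c : WithV S} (d : ℕ → WithV S) (m : ∀ n, d n ⟶ c)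
    (_ : ∀ n, Mem A (m n)) (_ : ∀ n, FactorsVia (m n) (m (n + 1))) {d' : WithV S}
    (m' : d' ⟶ c) (_ : Mem A m') (_ : im m' = ⋃ n, im (m n)),
    ∃ R ∈ coverage S d', ∀ ⦃e : WithV S⦄ (f : e ⟶ d'), R f → ∃ n, FactorsVia (f ≫ m') (m n)
  | .base c, d, m, hm, h, .base d', _, ⟨m', hm', rfl⟩, hU => by
    have h1 : ∀ n, Open A (im (m n)) := fun n => ⟨_, m n, hm n, rfl⟩
    choose d₀ m₀ hm₀ h₀ using fun n => (open_base A).1 (h1 n)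
    obtain ⟨R, hR, hR'⟩ := A.chain_cover d₀ m₀ hm₀ (fun n => A.reflect _ _ (hm₀ n) (hm₀ _)
      (fun p hp => by
        rw [← h₀] at hp ⊢
        obtain ⟨g, hg⟩ := h n
        rw [← hg] at hp
        exact im_comp _ _ hp)) m' hm' (fun p => by
        have h2 : p ∈ im ((incl S).map m') ↔ p ∈ ⋃ n, im (m n) := by rw [hU]
        rw [Set.mem_iUnion] at h2
        exact h2.trans (exists_congr fun n => h₀ n p))
    refine ⟨_, ⟨R, hR, rfl⟩, ?_⟩
    rintro _ _ ⟨hf⟩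
    obtain ⟨n, g, hg⟩ := hR' _ hf
    refine ⟨n, factors_of_im A _ (hm n) _ ?_⟩
    rintro _ ⟨p, rfl⟩
    refine (h₀ n _).2 ⟨p ≫ g, ?_⟩
    rw [Category.assoc, hg]
    exact (Category.assoc _ _ _).symm
  | .base _, _, _, _, _, .V, _, hm', _ => hm'.elim
  | .V, d, m, hm, _, .base d', m', hm', _ => by
    refine ⟨_, covers_id S _, ?_⟩
    rintro _ _ ⟨⟩
    refine ⟨0, factors_of_im A _ (hm 0) _ ?_⟩
    rintro _ ⟨p, -⟩
    exact (IsEmpty.false (self := hm') p).elim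
  | .V, d, m, hm, _, .V, m', hm', hU => by
    refine ⟨_, covers_id S _, ?_⟩
    rintro _ _ ⟨⟩
    obtain ⟨k, hk⟩ := hm'
    have h1 : (⟨(k : ℕ∞)⟩ : ULift ℕ∞) ∈ ⋃ n, im (m n) := by
      rw [← hU, im_shift m' k hk]
      exact le_refl (k : ℕ∞)
    obtain ⟨n, hn⟩ := Set.mem_iUnion.1 h1
    refine ⟨n, factors_of_im A _ (hm n) _ ((im_comp _ _).trans ?_)⟩
    rw [im_shift m' k hk]
    intro y hy
    exact ((open_V A).1 ⟨_, m n, hm n, rfl⟩).upper hy hn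

lemma stable_local : ∀ {c : WithV S} (R : Presieve c) (_ : R ∈ coverage S c)
    (U : Set (Pt S c)) (_ : ∀ ⦃d : WithV S⦄ (f : d ⟶ c), R f → Open A (f.1 ⁻¹' U)), Open A U
  | .base c, _, ⟨R, hR, rfl⟩, U, h => by
    refine (open_base A).2 (A.local_mem U R hR fun d f hf => ?_)
    obtain ⟨e, m, hm, h'⟩ := (open_base A).1 (h _ (Presieve.map_map hf))
    exact ⟨e, m, hm, h'⟩
  | .V, _, rfl, U, h => h _ (Presieve.singleton_self _)

lemma exists_mem_iff {c : WithV S} (U : Set (star' S ⟶ c)) :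
    (∃ (e : WithV S) (m : e ⟶ c), Mem A m ∧ ∀ p : star' S ⟶ c, p ∈ U ↔ FactorsVia p m) ↔
      Open A { y : Pt S c | ofPt y ∈ U } := by
  constructor
  · rintro ⟨e, m, hm, h⟩
    exact ⟨e, m, hm, Set.ext fun y => (h _).trans (factorsVia_pt m _)⟩
  · rintro ⟨e, m, hm, h⟩
    refine ⟨e, m, hm, fun p => ?_⟩
    rw [factorsVia_pt, ← h, Set.mem_ofPred_eq, ofPt_val]

/-- The class of admissible monos of `C + V₀`. -/
def admissible : AdmissibleMonos (site S) where
  toStableMonos := stable A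
  zero := mem_zero A
  reflect m m' _ hm' h := stable_reflect A m m' hm' h
  sup d m hm h := by
    obtain ⟨d', m', hm', h'⟩ := stable_sup A d m hm h
    refine ⟨d', m', hm', fun p => ?_⟩
    refine (factorsVia_pt m' p).trans ?_
    rw [← h', Set.mem_iUnion]
    exact exists_congr fun n => (factorsVia_pt (m n) p).symm
  chain_cover d m hm h d' m' hm' h' := by
    refine stable_chain_cover A d m hm h m' hm' (Set.ext fun y => ?_)
    have h2 := h' (ofPt y)
    rw [Set.mem_iUnion]
    exact (factorsVia_pt m' (ofPt y)).symm.trans <| h2.trans (exists_congr fun n => factorsVia_pt (m n) _)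
  sheaf R hR := by
    refine StableMonos.isSheafFor_of_local (S := site S) (stable A)
      (fun m m' _ hm' h => stable_reflect A m m' hm' h) R hR fun U hU => ?_
    refine (exists_mem_iff A U).2 (stable_local A R hR _ fun d f hf => ?_)
    exact (exists_mem_iff A { p : star' S ⟶ d | p ≫ f ∈ U }).1 (hU f hf)

end WithV

/-! ### Sheaves on a concrete site and their lifting monad -/

section Sheaves

variable {C : Type u} [SmallCategory C]

/-- The category of sheaves of sets on a concrete site. -/
abbrev Sh (S : ConcreteSite C) := Sheaf S.cov.toGrothendieck (Type u)

instance (S : ConcreteSite C) :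
    @MonoidalClosed (Sh S) _ SemiCartesianMonoidalCategory.toMonoidalCategory :=
  inferInstanceAs (MonoidalClosed (Sheaf S.cov.toGrothendieck (Type u)))

instance (S : ConcreteSite C) : HasColimitsOfShape (Discrete ℕ) (Sh S) :=
  Sheaf.instHasColimitsOfShape

instance (S : ConcreteSite C) : HasCoproduct (fun _ : ℕ => 𝟙_ (Sh S)) :=
  HasColimitsOfShape.has_colimit _

/-- A sheaf `X` is concrete if its elements over `c` are determined by their restrictions to the
points of `c`. -/
def IsConcrete {S : ConcreteSite C} (X : Sh S) : Prop :=
  ∀ c : C, Function.Injective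
    fun (x : X.obj.obj (op c)) (p : S.star ⟶ c) => X.obj.map p.op x

/-- A partial element of a presheaf `X` over `c`: an element of `X` over an `M`-subobject of `c`.
The subobject is presented as the sieve of the morphisms that factor through it, and the element
by its restrictions along these morphisms. -/
structure PartialElem (M : StableMonos C) (X : Cᵒᵖ ⥤ Type u) (c : C) : Type u where
  val : ∀ ⦃d : C⦄, (d ⟶ c) → Option (X.obj (op d))
  val_comp : ∀ ⦃d e : C⦄ (f : d ⟶ c) (g : e ⟶ d) (x : X.obj (op d)), val f = some x →
    val (g ≫ f) = some (X.map g.op x)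
  dom : ∃ (d : C) (m : d ⟶ c), M.mem m ∧ ∀ ⦃e : C⦄ (f : e ⟶ c), (val f).isSome ↔ FactorsVia f m

namespace PartialElem

lemma ext {M : StableMonos C} {X : Cᵒᵖ ⥤ Type u} {c : C} {s t : PartialElem M X c}
    (h : s.val = t.val) : s = t := by
  obtain ⟨_, _, _⟩ := s
  obtain ⟨_, _, _⟩ := t
  obtain rfl := h
  rfl

variable {M : StableMonos C} {X Y : Cᵒᵖ ⥤ Type u} {c : C}

/-- The sieve on which a partial element is defined. -/
def sieve (s : PartialElem M X c) : Sieve c where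
  arrows _ f := (s.val f).isSome
  downward_closed {_ _ f} hf g := by
    obtain ⟨x, hx⟩ := Option.isSome_iff_exists.1 hf
    exact Option.isSome_iff_exists.2 ⟨_, s.val_comp f g x hx⟩

lemma sieve_classified (s : PartialElem M X c) : M.Classified s.sieve := s.dom

lemma ext_some {s t : PartialElem M X c}
    (h : ∀ ⦃d : C⦄ (f : d ⟶ c) (x : X.obj (op d)), s.val f = some x ↔ t.val f = some x) :
    s = t :=
  PartialElem.ext (by
    funext d f
    exact Option.ext fun x => h f x)

/-- Restriction of partial elements. -/
def restrict {d : C} (h : d ⟶ c) (s : PartialElem M X c) : PartialElem M X d where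
  val _ f := s.val (f ≫ h)
  val_comp _ _ f g x hx := by rw [Category.assoc]; exact s.val_comp _ _ _ hx
  dom := s.sieve_classified.pullback h

/-- The image of a partial element under a natural transformation. -/
def map (φ : X ⟶ Y) (s : PartialElem M X c) : PartialElem M Y c where
  val d f := (s.val f).map (φ.app (op d))
  val_comp _ _ f g y hy := by
    obtain ⟨x, hx, rfl⟩ := Option.map_eq_some_iff.1 hy
    rw [s.val_comp _ _ _ hx]
    exact congrArg some (NatTrans.naturality_apply φ g.op x)
  dom := by
    obtain ⟨d, m, hm, h⟩ := s.dom
    exact ⟨d, m, hm, fun _ f => by rw [Option.isSome_map]; exact h f⟩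

/-- An element, as a total partial element. -/
def unit (x : X.obj (op c)) : PartialElem M X c where
  val _ f := some (X.map f.op x)
  val_comp _ _ f g y hy := by
    obtain rfl := Option.some.inj hy
    rw [op_comp, X.map_comp]; rfl
  dom := ⟨c, 𝟙 c, M.iso _ inferInstance, fun _ f =>
    ⟨fun _ => ⟨f, Category.comp_id f⟩, fun _ => rfl⟩⟩

variable (M X) in
/-- The presheaf of partial elements. -/
def presheaf : Cᵒᵖ ⥤ Type u where
  obj c := PartialElem M X c.unop
  map f := ↾(restrict f.unop)
  map_id c := by
    ext s
    refine PartialElem.ext (funext fun d => funext fun f => ?_)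
    exact congrArg (fun k => s.val k) (Category.comp_id f)
  map_comp g h := by
    ext s
    refine PartialElem.ext (funext fun d => funext fun f => ?_)
    exact congrArg (fun k => s.val k) (Category.assoc f h.unop g.unop).symm

/-- The partial element obtained from a partial element of the presheaf of partial elements. -/
def join (s : PartialElem M (presheaf M X) c) : PartialElem M X c where
  val d f := (s.val f).bind fun t => PartialElem.val t (𝟙 d)
  val_comp d e f g x hx := by
    obtain ⟨t, ht, h⟩ := Option.bind_eq_some_iff.1 hx
    rw [s.val_comp _ g _ ht]
    change t.val (𝟙 e ≫ g) = _
    have := t.val_comp (𝟙 d) g x h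
    rw [Category.comp_id] at this
    rwa [Category.id_comp]
  dom := by
    obtain ⟨d, m, hm, h⟩ := s.dom
    obtain ⟨t, ht⟩ := Option.isSome_iff_exists.1 ((h m).2 ⟨𝟙 d, Category.id_comp m⟩)
    obtain ⟨d', m', hm', h'⟩ := PartialElem.dom t
    refine ⟨d', m' ≫ m, M.comp m m' hm hm', fun e f => ?_⟩
    have key : ∀ g : e ⟶ d, ((s.val (g ≫ m)).bind fun t => PartialElem.val t (𝟙 e)) = t.val g := by
      intro g
      rw [s.val_comp _ g _ ht]
      change t.val (𝟙 e ≫ g) = _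
      rw [Category.id_comp]
    constructor
    · intro hf
      have hf' : (s.val f).isSome := by
        cases hs : s.val f with
        | none => rw [hs] at hf; exact hf
        | some _ => rfl
      obtain ⟨g, rfl⟩ := (h f).1 hf'
      rw [key] at hf
      obtain ⟨k, rfl⟩ := (h' g).1 hf
      exact ⟨k, (Category.assoc _ _ _).symm⟩
    · rintro ⟨k, rfl⟩
      rw [← Category.assoc, key]
      exact (h' _).2 ⟨k, rfl⟩

/-- The partial element given by an element and a partial element. -/
def pair (x : X.obj (op c)) (s : PartialElem M Y c) : PartialElem M (X ⊗ Y) c where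
  val d f := (s.val f).map fun y => show (X ⊗ Y).obj (op d) from (X.map f.op x, y)
  val_comp _ _ f g z hz := by
    obtain ⟨y, hy, rfl⟩ := Option.map_eq_some_iff.1 hz
    rw [s.val_comp _ _ _ hy]
    refine congrArg some ?_
    rw [op_comp, X.map_comp]
    rfl
  dom := by
    obtain ⟨d, m, hm, h⟩ := s.dom
    exact ⟨d, m, hm, fun _ f => by rw [Option.isSome_map]; exact h f⟩

end PartialElem

variable {S : ConcreteSite C} (A : AdmissibleMonos S)

lemma sh_isSheafFor (X : Sh S) {c : C} (R : Presieve c) (hR : R ∈ S.cov c) :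
    Presieve.IsSheafFor X.obj R :=
  (Presieve.isSheaf_coverage _ _).1 ((isSheaf_iff_isSheaf_of_type _ _).1 X.property) R hR

lemma existsUnique_zero (X : Sh S) : ∃! _ : X.obj.obj (op S.zero), True := by
  obtain ⟨x, -, h⟩ := sh_isSheafFor X ⊥ S.cov_zero (fun _ _ h => h.elim)
    (fun _ _ _ _ _ _ _ h => h.elim)
  exact ⟨x, trivial, fun y _ => h y (fun _ _ h => h.elim)⟩

/-- The only element of a sheaf over the initial object. -/
def zeroElt (X : Sh S) : X.obj.obj (op S.zero) := (existsUnique_zero X).choose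

lemma eq_zeroElt (X : Sh S) (x : X.obj.obj (op S.zero)) : x = zeroElt X :=
  (existsUnique_zero X).choose_spec.2 x trivial

lemma eq_of_toZero (X : Sh S) {e : C} (g : e ⟶ S.zero) (x y : X.obj.obj (op e)) : x = y := by
  have hg : g ≫ S.isInitial.to e = 𝟙 e := S.faithful _ _ fun p => by
    obtain ⟨_, _, h, _⟩ := S.cov_points _ S.cov_zero (p ≫ g)
    exact h.elim
  have h : ∀ z : X.obj.obj (op e), z = X.obj.map g.op (zeroElt X) := fun z => by
    rw [← eq_zeroElt X (X.obj.map (S.isInitial.to e).op z), ← CategoryTheory.comp_apply, ← X.obj.map_comp,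
      ← op_comp, hg, op_id, X.obj.map_id]
    rfl
  rw [h x, h y]

open Classical in
/-- The least partial element, whose domain is the initial object. -/
def PartialElem.bot (X : Sh S) (c : C) : PartialElem A.toStableMonos X.obj c where
  val e _ := if h : Nonempty (e ⟶ S.zero) then some (X.obj.map h.some.op (zeroElt X)) else none
  val_comp d e f g x hx := by
    by_cases h : Nonempty (d ⟶ S.zero)
    · have h' : Nonempty (e ⟶ S.zero) := ⟨g ≫ h.some⟩
      rw [dif_pos h']
      exact congrArg some (eq_of_toZero X h'.some _ _)
    · rw [dif_neg h] at hx
      exact nomatch hx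
  dom := ⟨S.zero, S.isInitial.to c, A.zero c, fun e f => by
    by_cases h : Nonempty (e ⟶ S.zero)
    · rw [dif_pos h]
      refine ⟨fun _ => ⟨h.some, S.faithful _ _ fun p => ?_⟩, fun _ => rfl⟩
      obtain ⟨_, _, h, _⟩ := S.cov_points _ S.cov_zero (p ≫ h.some)
      exact h.elim
    · rw [dif_neg h]
      exact ⟨fun h => (nomatch h), fun ⟨g, _⟩ => (h ⟨g⟩).elim⟩⟩

lemma PartialElem.eq_bot {X : Sh S} {c : C} {s : PartialElem A.toStableMonos X.obj c}
    (h : ∀ ⦃e : C⦄ (f : e ⟶ c), (s.val f).isSome ↔ Nonempty (e ⟶ S.zero)) :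
    s = PartialElem.bot A X c := by
  refine PartialElem.ext (funext fun e => funext fun f => ?_)
  by_cases h' : Nonempty (e ⟶ S.zero)
  · obtain ⟨x, hx⟩ := Option.isSome_iff_exists.1 ((h f).2 h')
    rw [hx]
    refine Eq.trans ?_ (dif_pos h').symm
    exact congrArg some (eq_of_toZero X h'.some _ _)
  · have : s.val f = none := by
      rw [← Option.not_isSome_iff_eq_none]
      exact fun hs => h' ((h f).1 hs)
    rw [this]
    exact Eq.symm (dif_neg h' : (PartialElem.bot A X c).val f = none)

lemma PartialElem.bot_isSome (X : Sh S) (c : C) ⦃e : C⦄ (f : e ⟶ c) :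
    ((PartialElem.bot A X c).val f).isSome ↔ Nonempty (e ⟶ S.zero) := by
  by_cases h : Nonempty (e ⟶ S.zero)
  · have : (PartialElem.bot A X c).val f = _ := dif_pos h
    rw [this]
    exact ⟨fun _ => h, fun _ => rfl⟩
  · have : (PartialElem.bot A X c).val f = none := dif_neg h
    rw [this]
    exact ⟨fun h => (nomatch h), fun h' => (h h').elim⟩

/-- Partial elements of a sheaf form a sheaf. -/
lemma PartialElem.isSheafFor (X : Sh S) {c : C} (R : Presieve c) (hR : R ∈ S.cov c) :
    Presieve.IsSheafFor (presheaf A.toStableMonos X.obj) R := by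
  classical
  intro x hx
  -- the domain of the amalgamation
  obtain ⟨⟨T, hT⟩, hTR, hTuniq⟩ := A.sheaf R hR
    (fun d f hf => ⟨PartialElem.sieve (x f hf), PartialElem.sieve_classified _⟩)
    (fun d d' a g g' f f' hf hf' hgf => Subtype.ext
      (congrArg (PartialElem.sieve (C := C)) (hx g g' hf hf' hgf)))
  have hTx : ∀ {d a : C} (f : d ⟶ c) (hf : R f) (l : a ⟶ d),
      T (l ≫ f) ↔ (PartialElem.val (x f hf) l).isSome := by
    intro d a f hf l
    have h1 : T.pullback f = PartialElem.sieve (x f hf) := congrArg Subtype.val (hTR f hf)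
    rw [← Sieve.pullback_apply, h1]
    rfl
  -- the values of the members of the family
  let P : ∀ {a : C}, (a ⟶ c) → X.obj.obj (op a) → Prop := fun {a} j v =>
    ∃ (d : C) (f : d ⟶ c) (hf : R f) (l : a ⟶ d), l ≫ f = j ∧
      PartialElem.val (x f hf) l = some v
  have P_uniq : ∀ {a : C} (j : a ⟶ c) (v w : X.obj.obj (op a)), P j v → P j w → v = w := by
    rintro a j v w ⟨d, f, hf, l, hl, hv⟩ ⟨d', f', hf', l', hl', hw⟩
    have h1 := hx l l' hf hf' (hl.trans hl'.symm)
    have h2 : PartialElem.val (x f hf) (𝟙 a ≫ l) = PartialElem.val (x f' hf') (𝟙 a ≫ l') :=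
      congrArg (fun s => PartialElem.val s (𝟙 a)) h1
    rw [Category.id_comp, Category.id_comp, hv, hw] at h2
    exact Option.some.inj h2
  have P_comp : ∀ {a b : C} (j : a ⟶ c) (k : b ⟶ a) (v : X.obj.obj (op a)), P j v →
      P (k ≫ j) (X.obj.map k.op v) := by
    rintro a b j k v ⟨d, f, hf, l, hl, hv⟩
    exact ⟨d, f, hf, k ≫ l, by rw [Category.assoc, hl], PartialElem.val_comp _ l k v hv⟩
  have map_comp' : ∀ {a b d : C} (f : a ⟶ b) (g : b ⟶ d) (v : X.obj.obj (op d)),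
      X.obj.map (f ≫ g).op v = X.obj.map f.op (X.obj.map g.op v) := by
    intro a b d f g v
    rw [op_comp, X.obj.map_comp]
    rfl
  have P_glue : ∀ {e : C} (k : e ⟶ c), T k → ∃! v : X.obj.obj (op e),
      ∀ ⦃a : C⦄ (r : a ⟶ e) (w : X.obj.obj (op a)), P (r ≫ k) w → X.obj.map r.op v = w := by
    intro e k hk
    obtain ⟨R', hR', h'⟩ := S.cov.pullback k R hR
    have hP : ∀ ⦃a : C⦄ (r : a ⟶ e), R' r → ∃ v, P (r ≫ k) v := by
      intro a r hr
      obtain ⟨d, l, f, hf, hl⟩ := h' hr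
      have h1 : T (l ≫ f) := by rw [hl]; exact T.downward_closed hk r
      obtain ⟨v, hv⟩ := Option.isSome_iff_exists.1 ((hTx f hf l).1 h1)
      exact ⟨v, d, f, hf, l, hl, hv⟩
    choose z hz using hP
    obtain ⟨v, hv, hv'⟩ := sh_isSheafFor X R' hR' z (by
      intro a a' b g g' r r' hr hr' hgr
      refine P_uniq (g ≫ r ≫ k) _ _ (P_comp _ g _ (hz r hr)) ?_
      rw [← Category.assoc, hgr, Category.assoc]
      exact P_comp _ g' _ (hz r' hr'))
    refine ⟨v, ?_, fun v' h => hv' v' fun a r hr => h r _ (hz r hr)⟩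
    intro a r w hw
    obtain ⟨R'', hR'', h''⟩ := S.cov.pullback r R' hR'
    refine (sh_isSheafFor X R'' hR'').isSeparatedFor.ext fun b j hj => ?_
    obtain ⟨d, l, r', hr', hl⟩ := h'' hj
    rw [← map_comp', ← hl, map_comp']
    have h1 : X.obj.map r'.op v = z r' hr' := hv r' hr'
    rw [h1]
    refine P_uniq (l ≫ r' ≫ k) _ _ (P_comp _ l _ (hz r' hr')) ?_
    rw [← Category.assoc, hl, Category.assoc]
    exact P_comp _ j _ hw
  choose G hG hG' using @P_glue
  let y : PartialElem A.toStableMonos X.obj c :=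
    { val := fun e k => if h : T k then some (G k h) else none
      val_comp := by
        intro d e f g v hv
        by_cases hf : T f
        · rw [dif_pos hf] at hv
          obtain rfl := Option.some.inj hv
          have hgf : T (g ≫ f) := T.downward_closed hf g
          rw [dif_pos hgf]
          refine congrArg some (hG' _ hgf _ fun a r w hw => ?_).symm
          rw [← map_comp']
          exact hG f hf _ _ (by rwa [Category.assoc])
        · rw [dif_neg hf] at hv
          exact nomatch hv
      dom := by
        obtain ⟨d, m, hm, h⟩ := hT
        refine ⟨d, m, hm, fun e f => (Iff.trans ?_ (h f))⟩
        by_cases hf : T f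
        · rw [dif_pos hf]; exact ⟨fun _ => hf, fun _ => rfl⟩
        · rw [dif_neg hf]; exact ⟨fun h => (nomatch h), fun h => (hf h).elim⟩ }
  refine ⟨y, fun d f hf => PartialElem.ext (funext fun a => funext fun l => ?_), fun t ht => ?_⟩
  · change (if h : T (l ≫ f) then some (G (l ≫ f) h) else none) = PartialElem.val (x f hf) l
    by_cases hl : T (l ≫ f)
    · obtain ⟨w, hw⟩ := Option.isSome_iff_exists.1 ((hTx f hf l).1 hl)
      have h1 := hG (l ≫ f) hl (𝟙 a) w ⟨d, f, hf, l, (Category.id_comp _).symm, hw⟩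
      rw [op_id, X.obj.map_id] at h1
      rw [dif_pos hl, hw]
      exact congrArg some h1
    · rw [dif_neg hl]
      have h1 := fun h => hl ((hTx f hf l).2 h)
      exact (Option.not_isSome_iff_eq_none.1 h1).symm
  · have htT : PartialElem.sieve t = T := congrArg Subtype.val
      (hTuniq ⟨PartialElem.sieve t, PartialElem.sieve_classified t⟩ fun d f hf =>
        Subtype.ext (congrArg (PartialElem.sieve (C := C)) (ht f hf)))
    refine PartialElem.ext (funext fun e => funext fun k => ?_)
    change _ = if h : T k then some (G k h) else none
    by_cases hk : T k
    · have hk' : (PartialElem.val t k).isSome := by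
        rw [← htT] at hk
        exact hk
      obtain ⟨v, hv⟩ := Option.isSome_iff_exists.1 hk'
      rw [dif_pos hk, hv]
      refine congrArg some (hG' k hk v ?_)
      rintro a r w ⟨d, f, hf, l, hl, hw⟩
      have h1 := PartialElem.val_comp t k r v hv
      have h2 : PartialElem.val t (l ≫ f) = PartialElem.val (x f hf) l :=
        congrArg (fun s => PartialElem.val s l) (ht f hf)
      rw [← hl, h2, hw] at h1
      exact (Option.some.inj h1).symm
    · rw [dif_neg hk, ← Option.not_isSome_iff_eq_none]
      intro hk'
      exact hk (by rw [← htT]; exact hk')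

/-- The lifting of a sheaf. -/
def shLift (X : Sh S) : Sh S :=
  ⟨PartialElem.presheaf A.toStableMonos X.obj, (isSheaf_iff_isSheaf_of_type _ _).2
    ((Presieve.isSheaf_coverage _ _).2 fun R hR => PartialElem.isSheafFor A X R hR)⟩

/-- The action of the lifting on morphisms. -/
def shLiftMap {X Y : Sh S} (f : X ⟶ Y) : shLift A X ⟶ shLift A Y :=
  ⟨{ app := fun _ => ↾(PartialElem.map f.hom)
     naturality := fun _ _ _ => rfl }⟩

/-- The lifting functor. -/
def shLiftFunctor : Sh S ⥤ Sh S where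
  obj := shLift A
  map := shLiftMap A
  map_id X := by
    apply ObjectProperty.hom_ext
    ext c s
    exact PartialElem.ext (funext fun d => funext fun f => Option.map_id_apply)
  map_comp g h := by
    apply ObjectProperty.hom_ext
    ext c s
    refine PartialElem.ext (funext fun d => funext fun f => ?_)
    change Option.map _ (PartialElem.val s f) = Option.map _ (Option.map _ (PartialElem.val s f))
    cases PartialElem.val s f <;> rfl

/-- The unit of the lifting monad. -/
def shUnit (X : Sh S) : X ⟶ shLift A X :=
  ⟨{ app := fun _ => ↾PartialElem.unit
     naturality := fun c d f => by
      ext x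
      refine PartialElem.ext (funext fun e => funext fun g => congrArg some ?_)
      exact congrArg (fun k => k x) (X.obj.map_comp f g.op).symm }⟩

/-- The multiplication of the lifting monad. -/
def shJoin (X : Sh S) : shLift A (shLift A X) ⟶ shLift A X :=
  ⟨{ app := fun _ => ↾PartialElem.join
     naturality := fun _ _ _ => rfl }⟩

/-- The strength of the lifting monad. -/
def shStr (X Y : Sh S) : X ⊗ shLift A Y ⟶ shLift A (X ⊗ Y) :=
  ⟨{ app := fun _ => ↾fun p => PartialElem.pair p.1 p.2
     naturality := fun c d f => by
      ext p
      refine PartialElem.ext (funext fun e => funext fun g => ?_)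
      refine congrArg (fun k => Option.map k (PartialElem.val p.2 (g ≫ f.unop))) ?_
      funext y
      refine Prod.ext ?_ rfl
      exact congrArg (fun k => k p.1) (X.obj.map_comp f g.op).symm }⟩

/-- The least element of the lifting. -/
def shBot (X : Sh S) : 𝟙_ (Sh S) ⟶ shLift A X :=
  ⟨{ app := fun c => ↾fun _ => PartialElem.bot A X c.unop
     naturality := fun _ _ _ => rfl }⟩

/-- The lifting monad on sheaves on a concrete site. -/
def shLifting : PointedStrongMonad (Sh S) where
  toFunctor := shLiftFunctor A
  η := { app := shUnit A
         naturality := fun X Y f => by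
          apply ObjectProperty.hom_ext
          ext c x
          refine PartialElem.ext (funext fun e => funext fun g => congrArg some ?_)
          exact (NatTrans.naturality_apply f.hom g.op x).symm }
  μ := { app := shJoin A
         naturality := fun X Y f => by
          apply ObjectProperty.hom_ext
          ext c s
          refine PartialElem.ext (funext fun e => funext fun g => ?_)
          change (Option.map _ (PartialElem.val s g)).bind _ =
            Option.map _ ((PartialElem.val s g).bind _)
          cases PartialElem.val s g <;> rfl }
  assoc X := by
    apply ObjectProperty.hom_ext
    ext c s
    refine PartialElem.ext (funext fun e => funext fun g => ?_)
    change (Option.map _ (PartialElem.val s g)).bind _ = ((PartialElem.val s g).bind _).bind _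
    cases PartialElem.val s g <;> rfl
  left_unit X := by
    apply ObjectProperty.hom_ext
    ext c s
    refine PartialElem.ext (funext fun e => funext fun g => ?_)
    change PartialElem.val s (𝟙 e ≫ g) = _
    rw [Category.id_comp]
    rfl
  right_unit X := by
    apply ObjectProperty.hom_ext
    ext c s
    refine PartialElem.ext (funext fun e => funext fun g => ?_)
    change (Option.map _ (PartialElem.val s g)).bind _ = PartialElem.val s g
    cases h : PartialElem.val s g with
    | none => rfl
    | some x =>
      change some (X.obj.map (𝟙 e).op x) = _
      rw [op_id, X.obj.map_id]
      rfl
  str := shStr A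
  str_natural f g := by
    apply ObjectProperty.hom_ext
    ext c p
    refine PartialElem.ext (funext fun e => funext fun k => ?_)
    change Option.map _ (Option.map _ (PartialElem.val p.2 k)) =
      Option.map _ (Option.map _ (PartialElem.val p.2 k))
    cases PartialElem.val p.2 k with
    | none => rfl
    | some y =>
      refine congrArg some (Prod.ext ?_ rfl)
      exact (NatTrans.naturality_apply f.hom k.op p.1).symm
  str_unit Y := by
    apply ObjectProperty.hom_ext
    ext c p
    refine PartialElem.ext (funext fun e => funext fun k => ?_)
    change Option.map _ (Option.map _ (PartialElem.val p.2 k)) = PartialElem.val p.2 k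
    cases PartialElem.val p.2 k <;> rfl
  str_assoc X Y Z := by
    apply ObjectProperty.hom_ext
    ext c p
    refine PartialElem.ext (funext fun e => funext fun k => ?_)
    change Option.map _ (Option.map _ (PartialElem.val p.2 k)) =
      Option.map _ (Option.map _ (PartialElem.val p.2 k))
    cases PartialElem.val p.2 k <;> rfl
  str_η X Y := by
    apply ObjectProperty.hom_ext
    ext c p
    rfl
  str_μ X Y := by
    apply ObjectProperty.hom_ext
    ext c p
    refine PartialElem.ext (funext fun e => funext fun k => ?_)
    change Option.map _ ((PartialElem.val p.2 k).bind _) =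
      (Option.map _ (Option.map _ (PartialElem.val p.2 k))).bind _
    cases h : PartialElem.val p.2 k with
    | none => rfl
    | some y =>
      change Option.map _ (PartialElem.val y (𝟙 e)) = Option.map _ (PartialElem.val y (𝟙 e))
      cases PartialElem.val y (𝟙 e) with
      | none => rfl
      | some z =>
        refine congrArg some (Prod.ext ?_ rfl)
        change X.obj.map k.op p.1 = X.obj.map (𝟙 e).op (X.obj.map k.op p.1)
        rw [op_id, X.obj.map_id]
        rfl
  bot := shBot A
  bot_natural f := by
    apply ObjectProperty.hom_ext
    ext c p
    refine PartialElem.eq_bot A fun e k => ?_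
    change (Option.map _ _).isSome ↔ _
    rw [Option.isSome_map]
    exact PartialElem.bot_isSome A _ _ k
  str_bot X Y := by
    apply ObjectProperty.hom_ext
    ext c p
    refine PartialElem.eq_bot A fun e k => ?_
    change (Option.map _ _).isSome ↔ _
    rw [Option.isSome_map]
    exact PartialElem.bot_isSome A _ _ k

end Sheaves

/-! ### Concrete sheaves and their lifting monad -/

/-- A concrete sheaf on a concrete site: a set `carrier` with, for each object `c` of the site, a
set of functions from the points of `c` to the carrier. -/
structure Conc {C : Type u} [SmallCategory C] (S : ConcreteSite C) : Type (u + 1) where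
  carrier : Type u
  plots (c : C) : Set ((S.star ⟶ c) → carrier)
  const_mem (c : C) (x : carrier) : (fun _ => x) ∈ plots c
  comp_mem {c d : C} (h : d ⟶ c) (g : (S.star ⟶ c) → carrier) (hg : g ∈ plots c) :
    (fun p => g (p ≫ h)) ∈ plots d
  glue {c : C} (g : (S.star ⟶ c) → carrier) (R : Presieve c) (hR : R ∈ S.cov c)
    (h : ∀ ⦃d : C⦄ (f : d ⟶ c), R f → (fun p => g (p ≫ f)) ∈ plots d) : g ∈ plots c

namespace Conc

section Basic

variable {C : Type u} [SmallCategory C] {S : ConcreteSite C}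

/-- Morphisms of concrete sheaves are the functions that preserve the plots. -/
instance : Category (Conc S) where
  Hom X Y := { φ : X.carrier → Y.carrier // ∀ (c : C) (g : (S.star ⟶ c) → X.carrier),
    g ∈ X.plots c → (fun p => φ (g p)) ∈ Y.plots c }
  id X := ⟨fun x => x, fun _ _ h => h⟩
  comp f g := ⟨fun x => g.1 (f.1 x), fun c k h => g.2 c _ (f.2 c k h)⟩

lemma hom_ext {X Y : Conc S} {f g : X ⟶ Y} (h : ∀ x, f.1 x = g.1 x) : f = g :=
  Subtype.ext (funext h)

@[simp] lemma comp_val {X Y Z : Conc S} (f : X ⟶ Y) (g : Y ⟶ Z) (x : X.carrier) :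
    (f ≫ g).1 x = g.1 (f.1 x) := rfl

@[simp] lemma id_val {X : Conc S} (x : X.carrier) : (𝟙 X : X ⟶ X).1 x = x := rfl

variable (S) in
/-- The terminal concrete sheaf. -/
def unit : Conc S where
  carrier := PUnit
  plots _ := Set.univ
  const_mem _ _ := trivial
  comp_mem _ _ _ := trivial
  glue _ _ _ _ := trivial

/-- The product of concrete sheaves. -/
def prod (X Y : Conc S) : Conc S where
  carrier := X.carrier × Y.carrier
  plots c := { g | (fun p => (g p).1) ∈ X.plots c ∧ (fun p => (g p).2) ∈ Y.plots c }
  const_mem c x := ⟨X.const_mem c x.1, Y.const_mem c x.2⟩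
  comp_mem h _ hg := ⟨X.comp_mem h _ hg.1, Y.comp_mem h _ hg.2⟩
  glue g R hR h := ⟨X.glue _ R hR fun _ f hf => (h f hf).1, Y.glue _ R hR fun _ f hf => (h f hf).2⟩

instance : CartesianMonoidalCategory (Conc S) :=
  .ofChosenFiniteProducts
    ⟨asEmptyCone (unit S), IsTerminal.ofUniqueHom
      (fun _ => ⟨fun _ => PUnit.unit, fun _ _ _ => trivial⟩) fun _ _ => rfl⟩
    fun X Y =>
      { cone := BinaryFan.mk (P := prod X Y) ⟨fun p => p.1, fun _ _ h => h.1⟩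
          ⟨fun p => p.2, fun _ _ h => h.2⟩
        isLimit := BinaryFan.isLimitMk
          (fun s => ⟨fun x => (s.fst.1 x, s.snd.1 x), fun c g hg =>
            ⟨s.fst.2 c g hg, s.snd.2 c g hg⟩⟩)
          (fun _ => rfl) (fun _ => rfl)
          (fun s m h₁ h₂ => hom_ext fun x => Prod.ext
            (congrFun (congrArg Subtype.val h₁) x) (congrFun (congrArg Subtype.val h₂) x)) }

lemma tensorHom_val {X X' Y Y' : Conc S} (f : X ⟶ Y) (g : X' ⟶ Y') (p : X.carrier × X'.carrier) :
    (f ⊗ₘ g).1 p = (f.1 p.1, g.1 p.2) := rfl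

/-- The exponential of concrete sheaves. -/
def exp (X Y : Conc S) : Conc S where
  carrier := X ⟶ Y
  plots c := { f | ∀ (d : C) (h : d ⟶ c) (g : (S.star ⟶ d) → X.carrier), g ∈ X.plots d →
    (fun p => (f (p ≫ h)).1 (g p)) ∈ Y.plots d }
  const_mem _ φ d _ g hg := φ.2 d g hg
  comp_mem h f hf d k g hg := by
    have := hf d (k ≫ h) g hg
    simpa only [Category.assoc] using this
  glue f R hR h d k g hg := by
    obtain ⟨R', hR', h'⟩ := S.cov.pullback k R hR
    refine Y.glue _ R' hR' fun a j hj => ?_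
    obtain ⟨e, l, i, hi, hl⟩ := h' hj
    have := h i hi a l _ (X.comp_mem j g hg)
    simp only [Category.assoc, hl] at this
    simpa only [Category.assoc] using this

/-- Currying. -/
def curryEquiv (X Z Y : Conc S) : (X ⊗ Z ⟶ Y) ≃ (Z ⟶ exp X Y) where
  toFun f := ⟨fun z => ⟨fun x => f.1 (x, z), fun c g hg =>
      f.2 c (fun p => (g p, z)) ⟨hg, Z.const_mem c z⟩⟩,
    fun _ k hk d h g hg => f.2 d (fun p => (g p, k (p ≫ h))) ⟨hg, Z.comp_mem h k hk⟩⟩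
  invFun f := ⟨fun p => (f.1 p.2).1 p.1, fun c g hg => by
    have := f.2 c _ hg.2 c (𝟙 c) _ hg.1
    simpa only [Category.comp_id] using this⟩
  left_inv _ := rfl
  right_inv _ := rfl

instance : MonoidalClosed (Conc S) where
  closed X :=
    { rightAdj :=
        { obj := exp X
          map := fun f => ⟨fun φ => φ ≫ f, fun _ k hk d h g hg => f.2 d _ (hk d h g hg)⟩ }
      adj := Adjunction.mkOfHomEquiv
        { homEquiv := fun Z Y => curryEquiv X Z Y
          homEquiv_naturality_left_symm := fun _ _ => rfl
          homEquiv_naturality_right := fun _ _ => rfl } }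

variable {J : Type} [SmallCategory J] (F : J ⥤ Conc S)

/-- The limit of a diagram of concrete sheaves. -/
def lim : Conc S where
  carrier := { x : ∀ j, (F.obj j).carrier // ∀ ⦃i j⦄ (k : i ⟶ j), (F.map k).1 (x i) = x j }
  plots c := { g | ∀ j, (fun p => (g p).1 j) ∈ (F.obj j).plots c }
  const_mem c x j := (F.obj j).const_mem c (x.1 j)
  comp_mem h _ hg j := (F.obj j).comp_mem h _ (hg j)
  glue _ R hR h j := (F.obj j).glue _ R hR fun _ f hf => h f hf j

/-- The limit cone. -/
def limCone : Cone F where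
  pt := lim F
  π :=
    { app := fun j => ⟨fun x => x.1 j, fun _ _ hg => hg j⟩
      naturality := fun i j k => hom_ext fun x => (x.2 k).symm }

/-- The limit cone is a limit. -/
def isLimit : IsLimit (limCone F) where
  lift s := ⟨fun x => ⟨fun j => (s.π.app j).1 x, fun _ _ k =>
    congrFun (congrArg Subtype.val (s.w k)) x⟩, fun c g hg j => (s.π.app j).2 c g hg⟩
  fac _ _ := rfl
  uniq s m h := hom_ext fun x => Subtype.ext (funext fun j =>
    congrFun (congrArg Subtype.val (h j)) x)

instance : HasLimitsOfShape J (Conc S) where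
  has_limit F := ⟨⟨limCone F, isLimit F⟩⟩

/-- The identification of elements in a colimit. -/
def colimRel (x y : Σ j, (F.obj j).carrier) : Prop :=
  ∃ k : x.1 ⟶ y.1, (F.map k).1 x.2 = y.2

/-- The colimit of a diagram of concrete sheaves: the plots are the functions that locally come
from a plot of an object of the diagram. -/
def colim : Conc S where
  carrier := Quot (colimRel F)
  plots c := { g | ∃ R ∈ S.cov c, ∀ ⦃d : C⦄ (f : d ⟶ c), R f →
    ∃ j, ∃ k ∈ (F.obj j).plots d, ∀ p, g (p ≫ f) = Quot.mk _ ⟨j, k p⟩ }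
  const_mem c x := by
    obtain ⟨⟨j, x⟩, rfl⟩ := Quot.exists_rep x
    exact ⟨_, S.cov_id c, fun d f _ => ⟨j, _, (F.obj j).const_mem d x, fun _ => rfl⟩⟩
  comp_mem h g := by
    rintro ⟨R, hR, hg⟩
    obtain ⟨R', hR', h'⟩ := S.cov.pullback h R hR
    refine ⟨R', hR', fun a f hf => ?_⟩
    obtain ⟨e, l, i, hi, hl⟩ := h' hf
    obtain ⟨j, k, hk, hgk⟩ := hg i hi
    refine ⟨j, _, (F.obj j).comp_mem l k hk, fun p => ?_⟩
    have := hgk (p ≫ l)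
    rwa [Category.assoc, hl, ← Category.assoc] at this
  glue g R hR h := by
    choose T hT h' using h
    refine ⟨_, S.cov_bind R hR (fun _ f hf => T f hf) (fun _ f hf => hT f hf), ?_⟩
    rintro d _ ⟨e, a, f, hf, ha, rfl⟩
    obtain ⟨j, k, hk, hgk⟩ := h' f hf a ha
    refine ⟨j, k, hk, fun p => ?_⟩
    rw [← Category.assoc]
    exact hgk p

/-- The colimit cocone. -/
def colimCocone : Cocone F where
  pt := colim F
  ι :=
    { app := fun j => ⟨fun x => Quot.mk _ ⟨j, x⟩, fun c g hg =>
        ⟨_, S.cov_id c, fun _ f _ => ⟨j, _, (F.obj j).comp_mem f g hg, fun _ => rfl⟩⟩⟩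
      naturality := fun _ _ k => hom_ext fun _ => (Quot.sound ⟨k, rfl⟩).symm }

/-- The colimit cocone is a colimit. -/
def isColimit : IsColimit (colimCocone F) where
  desc s := ⟨Quot.lift (fun x => (s.ι.app x.1).1 x.2) (by
      rintro ⟨i, x⟩ ⟨j, y⟩ ⟨k, hk⟩
      have h₁ : (s.ι.app j).1 ((F.map k).1 x) = (s.ι.app i).1 x :=
        congrFun (congrArg Subtype.val (s.w k)) x
      exact h₁.symm.trans (congrArg (s.ι.app j).1 hk)), by
    rintro c g ⟨R, hR, hg⟩
    refine s.pt.glue _ R hR fun d f hf => ?_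
    obtain ⟨j, k, hk, h⟩ := hg f hf
    have := (s.ι.app j).2 d k hk
    simp only [h]
    exact this⟩
  fac _ _ := rfl
  uniq s m h := hom_ext fun x => by
    obtain ⟨⟨j, x⟩, rfl⟩ := Quot.exists_rep x
    exact congrFun (congrArg Subtype.val (h j)) x

instance : HasColimitsOfShape J (Conc S) where
  has_colimit F := ⟨⟨colimCocone F, isColimit F⟩⟩

end Basic

section Lifting

variable {C : Type u} [SmallCategory C] {S : ConcreteSite C} (A : AdmissibleMonos S)

/-- The lifting of a concrete sheaf: the plots are the partial functions whose domain is an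
`M`-subobject, and which are plots on their domain. -/
def lift (X : Conc S) : Conc S where
  carrier := Option X.carrier
  plots c := { g | ∃ (d : C) (m : d ⟶ c), A.mem m ∧ (∀ p, (g p).isSome ↔ FactorsVia p m) ∧
    ∃ r ∈ X.plots d, ∀ q, g (q ≫ m) = some (r q) }
  const_mem c x := by
    have h0 : ∀ p : S.star ⟶ S.zero, False := fun p => by
      obtain ⟨_, _, h, _⟩ := S.cov_points _ S.cov_zero p
      exact h
    cases x with
    | none => exact ⟨S.zero, S.isInitial.to c, A.zero c, fun p =>
        ⟨fun h => (nomatch h), fun ⟨q, _⟩ => (h0 q).elim⟩, fun q => (h0 q).elim,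
        X.glue _ _ S.cov_zero fun _ _ h => h.elim, fun q => (h0 q).elim⟩
    | some x => exact ⟨c, 𝟙 c, A.iso _ inferInstance, fun p =>
        ⟨fun _ => ⟨p, Category.comp_id p⟩, fun _ => rfl⟩, _, X.const_mem c x, fun _ => rfl⟩
  comp_mem {c d} h g := by
    rintro ⟨e, m, hm, hg, r, hr, hgr⟩
    obtain ⟨e', f', m', hp, hm'⟩ := A.pullback m h hm
    refine ⟨e', m', hm', fun p => ?_, _, X.comp_mem f' r hr, fun q => ?_⟩
    · refine (hg _).trans ⟨fun ⟨q, hq⟩ => ⟨hp.lift q p hq, hp.lift_snd _ _ _⟩, ?_⟩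
      rintro ⟨q, rfl⟩
      exact ⟨q ≫ f', by rw [Category.assoc, hp.w, Category.assoc]⟩
    · have := hgr (q ≫ f')
      rwa [Category.assoc, hp.w, ← Category.assoc] at this
  glue {c} g R hR h := by
    choose e m hm hg r hr hgr using h
    obtain ⟨d, n, hn, h'⟩ := A.local_mem { p | (g p).isSome } R hR
      fun a f hf => ⟨_, m f hf, hm f hf, fun p => hg f hf p⟩
    refine ⟨d, n, hn, h', fun q => (g (q ≫ n)).get ((h' _).2 ⟨q, rfl⟩), ?_,
      fun q => (Option.some_get _).symm⟩
    obtain ⟨R', hR', hR''⟩ := S.cov.pullback n R hR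
    refine X.glue _ R' hR' fun a j hj => ?_
    obtain ⟨b, l, f, hf, hl⟩ := hR'' hj
    obtain ⟨k, rfl⟩ := A.factors (m f hf) (hm f hf) l fun p => by
      refine (hg f hf _).1 ?_
      have := (h' ((p ≫ j) ≫ n)).2 ⟨p ≫ j, rfl⟩
      rwa [Category.assoc, ← hl, ← Category.assoc] at this
    have h1 : (fun p => (g ((p ≫ j) ≫ n)).get ((h' _).2 ⟨p ≫ j, rfl⟩)) =
        fun p => r f hf (p ≫ k) := by
      funext p
      apply Option.some_injective
      rw [Option.some_get, ← hgr]
      change _ = g (((p ≫ k) ≫ m f hf) ≫ f)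
      rw [Category.assoc, ← hl, Category.assoc, Category.assoc, Category.assoc]
    rw [h1]
    exact X.comp_mem k _ (hr f hf)

lemma join_mem {X : Conc S} {c : C} {g : (S.star ⟶ c) → Option (Option X.carrier)}
    (hg : g ∈ (lift A (lift A X)).plots c) :
    (fun p => (g p).bind fun y => y) ∈ (lift A X).plots c := by
  obtain ⟨d, m, hm, h, r, ⟨d', m', hm', h', r', hr', hg'⟩, hg⟩ := hg
  have key : ∀ q, (g (q ≫ m)).bind (fun y => y) = r q := fun q => by rw [hg]; rfl
  refine ⟨d', m' ≫ m, A.comp m m' hm hm', fun p => ⟨fun hp => ?_, ?_⟩, r', hr', fun q => ?_⟩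
  · have hp' : (g p).isSome := by
      cases h0 : g p with
      | none => simp [h0] at hp
      | some _ => rfl
    obtain ⟨q, rfl⟩ := (h p).1 hp'
    obtain ⟨q', rfl⟩ := (h' q).1 ((congrArg (fun o : Option X.carrier => o.isSome = true) (key q)).mp hp)
    exact ⟨q', (Category.assoc _ _ _).symm⟩
  · rintro ⟨q, rfl⟩
    refine (congrArg (fun o : Option X.carrier => o.isSome = true) ?_).mpr ((h' (q ≫ m')).2 ⟨q, rfl⟩)
    exact (congrArg (fun k => (g k).bind fun y => y) (Category.assoc _ _ _).symm).trans (key _)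
  · exact ((congrArg (fun k => (g k).bind fun y => y) (Category.assoc _ _ _).symm).trans
      (key _)).trans (hg' q)

/-- The lifting monad on concrete sheaves on a concrete site. -/
def concLifting : PointedStrongMonad (Conc S) where
  obj := lift A
  map f := ⟨fun x => x.map f.1, by
    rintro c g ⟨d, m, hm, h, r, hr, hg⟩
    refine ⟨d, m, hm, fun p => ?_, _, f.2 d r hr, fun q => ?_⟩
    · refine Iff.trans (iff_of_eq (congrArg (· = true) ?_)) (h p)
      exact Option.isSome_map (f := f.1) (x := g p)
    · change Option.map f.1 (g (q ≫ m)) = _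
      rw [hg]
      rfl⟩
  map_id X := hom_ext fun x => by cases x <;> rfl
  map_comp f g := hom_ext fun x => by cases x <;> rfl
  η :=
    { app := fun X => ⟨fun x => some x, fun c g hg => ⟨c, 𝟙 c, A.iso _ inferInstance,
        fun p => ⟨fun _ => ⟨p, Category.comp_id p⟩, fun _ => rfl⟩, g, hg,
        fun q => by rw [Category.comp_id]⟩⟩
      naturality := fun _ _ _ => rfl }
  μ :=
    { app := fun X => ⟨fun x => x.bind fun y => y, fun _ _ hg => join_mem A hg⟩
      naturality := fun _ _ f => hom_ext fun x => by
        rcases x with _ | _ | _ <;> rfl }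
  assoc X := hom_ext fun x => by rcases x with _ | _ | _ <;> rfl
  left_unit X := hom_ext fun x => rfl
  right_unit X := hom_ext fun x => by cases x <;> rfl
  str X Y := ⟨fun p => p.2.map fun y => (p.1, y), by
    rintro c g ⟨hg₁, d, m, hm, h, r, hr, hg⟩
    refine ⟨d, m, hm, fun p => ?_, fun q => ((g (q ≫ m)).1, r q),
      ⟨X.comp_mem m _ hg₁, hr⟩, fun q => ?_⟩
    · refine Iff.trans (iff_of_eq (congrArg (· = true) ?_)) (h p)
      exact Option.isSome_map (f := fun y => ((g p).1, y)) (x := (g p).2)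
    · exact congrArg (Option.map fun y => ((g (q ≫ m)).1, y)) (hg q)⟩
  str_natural f g := hom_ext fun ⟨x, y⟩ => by cases y <;> rfl
  str_unit Y := hom_ext fun ⟨x, y⟩ => by cases y <;> rfl
  str_assoc X Y Z := hom_ext fun ⟨⟨x, y⟩, z⟩ => by cases z <;> rfl
  str_η X Y := rfl
  str_μ X Y := hom_ext fun ⟨x, y⟩ => by rcases y with _ | _ | _ <;> rfl
  bot X := ⟨fun _ => none, fun c _ _ => (lift A X).const_mem c none⟩
  bot_natural f := rfl
  str_bot X Y := rfl

end Lifting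

end Conc

end Sites

end SheafPCF

end

open SheafPCF

-- Soundness is a formal consequence of completeness. A recursive function denotes the value at `∞`
-- of the extension to `Γ × ω̄` of the finite iterates of `g`. Shifting this extension by the
-- successor of `ω̄` and applying `g` to it give maps that agree on `Γ × ω`, hence on `Γ × ω̄` by
-- uniqueness of extensions (`succ_fixExt`). As `∞ + 1 = ∞`, the value at `∞` is a fixed point of
-- `g` (`fix_eq`). The same uniqueness makes fixed points stable under change of context, so that
-- substitution is interpreted by composition (`value_subst`), and soundness follows by induction on
-- evaluation (`SigInterp.sound`).
--
-- Completeness of the types rests on one direct construction, `complete_lift`, for liftings `L Z`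
-- of objects such as `1` and `1 + 1 + ⋯` whose plots over `V` are constant. The object `V` carries
-- a path through all the points `0 ≤ 1 ≤ ⋯ ≤ ∞` of `ω̄`, and a partial map on `V` is defined either
-- nowhere or from some finite stage on. Hence an extension of `f : B × ω ⟶ L Z` can only be the
-- eventual value of `f (b, min x n)` as `n` grows. This is a morphism: its domain is an increasing
-- union of admissible subobjects, which is admissible and has a covering family on whose members
-- some finite stage already gives the value. Function types then follow: exponentials into complete
-- objects are complete, and an object `X` with a retraction `L X ⟶ X` of the unit has `L X` as a
-- retract of `X × L 1`.
--
-- Adequacy uses a logical relation `Rel` between points and closed values, with a fundamental lemma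
-- (`rel_value`, `rel_comp`) by induction on terms. The only serious case is recursion, where the
-- relation must pass from the finite iterates to their limit (`rel_infty`). If a map `ω̄ ⟶ L X` is
-- defined at `∞`, then pulling it back along the path on `V` shows that it is defined from some
-- stage `N` on (`exists_total_shift`). So the applications of all iterates from `N` on converge, by
-- determinism to one and the same syntactic value, and induction on the type carries the relation
-- with that value to `∞`.
--
-- These arguments see the two categories only through points and plots. `PlotModel` collects what
-- they use, and it is verified separately for concrete sheaves and for sheaves.

set_option linter.unusedSectionVars false

namespace SheafPCF

-- Substitution calculus and determinism of evaluation.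

section Language

variable {S : Signature.{u, v, w}}

lemma liftRen_comp {K : Type v} {Γ Δ Θ : Ctx K} {ρ : ∀ τ, Var Γ τ → Var Δ τ}
    {ρ' : ∀ τ, Var Δ τ → Var Θ τ} {ρ'' : ∀ τ, Var Γ τ → Var Θ τ}
    (h : ∀ τ x, ρ' τ (ρ τ x) = ρ'' τ x) (σ : Ty K) :
    ∀ τ x, liftRen ρ' σ τ (liftRen ρ σ τ x) = liftRen ρ'' σ τ x
  | _, .zero => rfl
  | _, .succ x => congrArg Var.succ (h _ x)

-- The composite is a third function, constrained pointwise. Under a binder the constraint is passed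
-- on by `liftRen_comp`, so equalities between functions on variables are never needed. The laws
-- below for substitutions have the same form.
mutual
lemma Value.rename_rename : ∀ {Γ Δ Θ : Ctx S.TyConst} {τ : Ty S.TyConst} (a : Value S Γ τ)
    {ρ : ∀ τ, Var Γ τ → Var Δ τ} {ρ' : ∀ τ, Var Δ τ → Var Θ τ} {ρ'' : ∀ τ, Var Γ τ → Var Θ τ}
    (_ : ∀ τ x, ρ' τ (ρ τ x) = ρ'' τ x), (a.rename ρ).rename ρ' = a.rename ρ''
  | _, _, _, _, .var x, _, _, _, h => by simp only [Value.rename, h]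
  | _, _, _, _, .zero, _, _, _, _ => by simp only [Value.rename]
  | _, _, _, _, .succ n, _, _, _, h => by simp only [Value.rename, Value.rename_rename n h]
  | _, _, _, _, .fn t, _, _, _, h => by
    simp only [Value.rename, Computation.rename_rename t (liftRen_comp (liftRen_comp h _) _)]
  | _, _, _, _, .const c, _, _, _, _ => by simp only [Value.rename]
  | _, _, _, _, .op f, _, _, _, _ => by simp only [Value.rename]
lemma Computation.rename_rename : ∀ {Γ Δ Θ : Ctx S.TyConst} {τ : Ty S.TyConst}
    (t : Computation S Γ τ) {ρ : ∀ τ, Var Γ τ → Var Δ τ} {ρ' : ∀ τ, Var Δ τ → Var Θ τ}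
    {ρ'' : ∀ τ, Var Γ τ → Var Θ τ} (_ : ∀ τ x, ρ' τ (ρ τ x) = ρ'' τ x),
    (t.rename ρ).rename ρ' = t.rename ρ''
  | _, _, _, _, .app f a, _, _, _, h => by
    simp only [Computation.rename, Value.rename_rename f h, Value.rename_rename a h]
  | _, _, _, _, .ret a, _, _, _, h => by
    simp only [Computation.rename, Value.rename_rename a h]
  | _, _, _, _, .bind t t', _, _, _, h => by
    simp only [Computation.rename, Computation.rename_rename t h,
      Computation.rename_rename t' (liftRen_comp h _)]
  | _, _, _, _, .case n t t', _, _, _, h => by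
    simp only [Computation.rename, Value.rename_rename n h, Computation.rename_rename t h,
      Computation.rename_rename t' (liftRen_comp h _)]
end

lemma liftSub_liftRen {Γ Δ Θ : Ctx S.TyConst} {ρ : ∀ τ, Var Γ τ → Var Δ τ}
    {s : ∀ τ, Var Δ τ → Value S Θ τ} {s' : ∀ τ, Var Γ τ → Value S Θ τ}
    (h : ∀ τ x, s τ (ρ τ x) = s' τ x) (σ : Ty S.TyConst) :
    ∀ τ x, liftSub s σ τ (liftRen ρ σ τ x) = liftSub s' σ τ x
  | _, .zero => rfl
  | _, .succ x => congrArg (Value.rename fun _ => Var.succ) (h _ x)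

mutual
lemma Value.subst_rename : ∀ {Γ Δ Θ : Ctx S.TyConst} {τ : Ty S.TyConst} (a : Value S Γ τ)
    {ρ : ∀ τ, Var Γ τ → Var Δ τ} {s : ∀ τ, Var Δ τ → Value S Θ τ}
    {s' : ∀ τ, Var Γ τ → Value S Θ τ}
    (_ : ∀ τ x, s τ (ρ τ x) = s' τ x), (a.rename ρ).subst s = a.subst s'
  | _, _, _, _, .var x, _, _, _, h => by simp only [Value.rename, Value.subst, h]
  | _, _, _, _, .zero, _, _, _, _ => by simp only [Value.rename, Value.subst]
  | _, _, _, _, .succ n, _, _, _, h => by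
    simp only [Value.rename, Value.subst, Value.subst_rename n h]
  | _, _, _, _, .fn t, _, _, _, h => by
    simp only [Value.rename, Value.subst,
      Computation.subst_rename t (liftSub_liftRen (liftSub_liftRen h _) _)]
  | _, _, _, _, .const c, _, _, _, _ => by simp only [Value.rename, Value.subst]
  | _, _, _, _, .op f, _, _, _, _ => by simp only [Value.rename, Value.subst]
lemma Computation.subst_rename : ∀ {Γ Δ Θ : Ctx S.TyConst} {τ : Ty S.TyConst}
    (t : Computation S Γ τ) {ρ : ∀ τ, Var Γ τ → Var Δ τ} {s : ∀ τ, Var Δ τ → Value S Θ τ}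
    {s' : ∀ τ, Var Γ τ → Value S Θ τ} (_ : ∀ τ x, s τ (ρ τ x) = s' τ x),
    (t.rename ρ).subst s = t.subst s'
  | _, _, _, _, .app f a, _, _, _, h => by
    simp only [Computation.rename, Computation.subst, Value.subst_rename f h,
      Value.subst_rename a h]
  | _, _, _, _, .ret a, _, _, _, h => by
    simp only [Computation.rename, Computation.subst, Value.subst_rename a h]
  | _, _, _, _, .bind t t', _, _, _, h => by
    simp only [Computation.rename, Computation.subst, Computation.subst_rename t h,
      Computation.subst_rename t' (liftSub_liftRen h _)]
  | _, _, _, _, .case n t t', _, _, _, h => by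
    simp only [Computation.rename, Computation.subst, Value.subst_rename n h,
      Computation.subst_rename t h, Computation.subst_rename t' (liftSub_liftRen h _)]
end

/-- For an old variable, weakening and `ρ` are applied in opposite orders on the two sides; both
reduce to the single renaming `y ↦ succ (ρ y)`. -/
lemma liftSub_rename {Γ Δ Θ : Ctx S.TyConst} {s : ∀ τ, Var Γ τ → Value S Δ τ}
    {ρ : ∀ τ, Var Δ τ → Var Θ τ} {s' : ∀ τ, Var Γ τ → Value S Θ τ}
    (h : ∀ τ x, (s τ x).rename ρ = s' τ x) (σ : Ty S.TyConst) :
    ∀ τ x, (liftSub s σ τ x).rename (liftRen ρ σ) = liftSub s' σ τ x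
  | _, .zero => by simp only [liftSub, Value.rename, liftRen]
  | _, .succ x => by
    simp only [liftSub, ← h]
    exact (Value.rename_rename _ (ρ'' := fun _ y => Var.succ (ρ _ y)) (by intros; rfl)).trans
      (Value.rename_rename _ (by intros; rfl)).symm

mutual
lemma Value.rename_subst : ∀ {Γ Δ Θ : Ctx S.TyConst} {τ : Ty S.TyConst} (a : Value S Γ τ)
    {s : ∀ τ, Var Γ τ → Value S Δ τ} {ρ : ∀ τ, Var Δ τ → Var Θ τ}
    {s' : ∀ τ, Var Γ τ → Value S Θ τ}
    (_ : ∀ τ x, (s τ x).rename ρ = s' τ x), (a.subst s).rename ρ = a.subst s'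
  | _, _, _, _, .var x, _, _, _, h => by simp only [Value.subst, h]
  | _, _, _, _, .zero, _, _, _, _ => by simp only [Value.rename, Value.subst]
  | _, _, _, _, .succ n, _, _, _, h => by
    simp only [Value.rename, Value.subst, Value.rename_subst n h]
  | _, _, _, _, .fn t, _, _, _, h => by
    simp only [Value.rename, Value.subst,
      Computation.rename_subst t (liftSub_rename (liftSub_rename h _) _)]
  | _, _, _, _, .const c, _, _, _, _ => by simp only [Value.rename, Value.subst]
  | _, _, _, _, .op f, _, _, _, _ => by simp only [Value.rename, Value.subst]
lemma Computation.rename_subst : ∀ {Γ Δ Θ : Ctx S.TyConst} {τ : Ty S.TyConst}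
    (t : Computation S Γ τ) {s : ∀ τ, Var Γ τ → Value S Δ τ} {ρ : ∀ τ, Var Δ τ → Var Θ τ}
    {s' : ∀ τ, Var Γ τ → Value S Θ τ} (_ : ∀ τ x, (s τ x).rename ρ = s' τ x),
    (t.subst s).rename ρ = t.subst s'
  | _, _, _, _, .app f a, _, _, _, h => by
    simp only [Computation.rename, Computation.subst, Value.rename_subst f h,
      Value.rename_subst a h]
  | _, _, _, _, .ret a, _, _, _, h => by
    simp only [Computation.rename, Computation.subst, Value.rename_subst a h]
  | _, _, _, _, .bind t t', _, _, _, h => by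
    simp only [Computation.rename, Computation.subst, Computation.rename_subst t h,
      Computation.rename_subst t' (liftSub_rename h _)]
  | _, _, _, _, .case n t t', _, _, _, h => by
    simp only [Computation.rename, Computation.subst, Value.rename_subst n h,
      Computation.rename_subst t h, Computation.rename_subst t' (liftSub_rename h _)]
end

/-- For an old variable, weakening before and after `s'` both amount to substituting the weakened
values of `s'`. This is where the two mixed laws for renaming and substitution are consumed. -/
lemma liftSub_subst {Γ Δ Θ : Ctx S.TyConst} {s : ∀ τ, Var Γ τ → Value S Δ τ}
    {s' : ∀ τ, Var Δ τ → Value S Θ τ} {s'' : ∀ τ, Var Γ τ → Value S Θ τ}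
    (h : ∀ τ x, (s τ x).subst s' = s'' τ x) (σ : Ty S.TyConst) :
    ∀ τ x, (liftSub s σ τ x).subst (liftSub s' σ) = liftSub s'' σ τ x
  | _, .zero => by simp only [liftSub, Value.subst]
  | _, .succ x => by
    simp only [liftSub, ← h]
    rw [Value.subst_rename _ (s' := fun _ y => (s' _ y).rename fun _ => Var.succ) (by intros; rfl),
      Value.rename_subst _ (s' := fun _ y => (s' _ y).rename fun _ => Var.succ) (by intros; rfl)]

mutual
lemma Value.subst_subst : ∀ {Γ Δ Θ : Ctx S.TyConst} {τ : Ty S.TyConst} (a : Value S Γ τ)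
    {s : ∀ τ, Var Γ τ → Value S Δ τ} {s' : ∀ τ, Var Δ τ → Value S Θ τ}
    {s'' : ∀ τ, Var Γ τ → Value S Θ τ}
    (_ : ∀ τ x, (s τ x).subst s' = s'' τ x), (a.subst s).subst s' = a.subst s''
  | _, _, _, _, .var x, _, _, _, h => by simp only [Value.subst, h]
  | _, _, _, _, .zero, _, _, _, _ => by simp only [Value.subst]
  | _, _, _, _, .succ n, _, _, _, h => by
    simp only [Value.subst, Value.subst_subst n h]
  | _, _, _, _, .fn t, _, _, _, h => by
    simp only [Value.subst,
      Computation.subst_subst t (liftSub_subst (liftSub_subst h _) _)]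
  | _, _, _, _, .const c, _, _, _, _ => by simp only [Value.subst]
  | _, _, _, _, .op f, _, _, _, _ => by simp only [Value.subst]
lemma Computation.subst_subst : ∀ {Γ Δ Θ : Ctx S.TyConst} {τ : Ty S.TyConst}
    (t : Computation S Γ τ) {s : ∀ τ, Var Γ τ → Value S Δ τ} {s' : ∀ τ, Var Δ τ → Value S Θ τ}
    {s'' : ∀ τ, Var Γ τ → Value S Θ τ} (_ : ∀ τ x, (s τ x).subst s' = s'' τ x),
    (t.subst s).subst s' = t.subst s''
  | _, _, _, _, .app f a, _, _, _, h => by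
    simp only [Computation.subst, Value.subst_subst f h, Value.subst_subst a h]
  | _, _, _, _, .ret a, _, _, _, h => by
    simp only [Computation.subst, Value.subst_subst a h]
  | _, _, _, _, .bind t t', _, _, _, h => by
    simp only [Computation.subst, Computation.subst_subst t h,
      Computation.subst_subst t' (liftSub_subst h _)]
  | _, _, _, _, .case n t t', _, _, _, h => by
    simp only [Computation.subst, Value.subst_subst n h,
      Computation.subst_subst t h, Computation.subst_subst t' (liftSub_subst h _)]
end

lemma liftSub_var {Γ : Ctx S.TyConst} {s : ∀ τ, Var Γ τ → Value S Γ τ}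
    (h : ∀ τ x, s τ x = .var x) (σ : Ty S.TyConst) : ∀ τ x, liftSub s σ τ x = .var x
  | _, .zero => rfl
  | _, .succ x => by simp only [liftSub, h, Value.rename]

mutual
lemma Value.subst_var : ∀ {Γ : Ctx S.TyConst} {τ : Ty S.TyConst} (a : Value S Γ τ)
    {s : ∀ τ, Var Γ τ → Value S Γ τ} (_ : ∀ τ x, s τ x = .var x), a.subst s = a
  | _, _, .var x, _, h => by simp only [Value.subst, h]
  | _, _, .zero, _, _ => by simp only [Value.subst]
  | _, _, .succ n, _, h => by simp only [Value.subst, Value.subst_var n h]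
  | _, _, .fn t, _, h => by
    simp only [Value.subst, Computation.subst_var t (liftSub_var (liftSub_var h _) _)]
  | _, _, .const c, _, _ => by simp only [Value.subst]
  | _, _, .op f, _, _ => by simp only [Value.subst]
lemma Computation.subst_var : ∀ {Γ : Ctx S.TyConst} {τ : Ty S.TyConst} (t : Computation S Γ τ)
    {s : ∀ τ, Var Γ τ → Value S Γ τ} (_ : ∀ τ x, s τ x = .var x), t.subst s = t
  | _, _, .app f a, _, h => by
    simp only [Computation.subst, Value.subst_var f h, Value.subst_var a h]
  | _, _, .ret a, _, h => by simp only [Computation.subst, Value.subst_var a h]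
  | _, _, .bind t t', _, h => by
    simp only [Computation.subst, Computation.subst_var t h,
      Computation.subst_var t' (liftSub_var h _)]
  | _, _, .case n t t', _, h => by
    simp only [Computation.subst, Value.subst_var n h,
      Computation.subst_var t h, Computation.subst_var t' (liftSub_var h _)]
end

/-- Evaluation instantiates the bound variable of a body that has already been closed by `s`, while
the induction for adequacy provides one extended substitution; this identifies the two. On an old
variable, weakening followed by instantiation does nothing. -/
lemma Computation.inst_subst {Γ : Ctx S.TyConst} {σ τ : Ty S.TyConst}
    (t : Computation S (σ :: Γ) τ) (s : ∀ τ, Var Γ τ → Value S [] τ) (a : Value S [] σ) :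
    (t.subst (liftSub s σ)).inst a = t.subst (consSub a s) := by
  refine Computation.subst_subst t ?_
  rintro _ (_ | x)
  · simp only [liftSub, Value.subst, consSub]
  · simp only [liftSub, consSub]
    exact (Value.subst_rename _ (s' := fun _ => .var) (by intros; rfl)).trans
      (Value.subst_var _ (by intros; rfl))

lemma Computation.inst₂_subst {Γ : Ctx S.TyConst} {σ τ : Ty S.TyConst}
    (t : Computation S (σ :: .arr σ τ :: Γ) τ) (s : ∀ τ, Var Γ τ → Value S [] τ)
    (f : Value S [] (.arr σ τ)) (a : Value S [] σ) :
    (t.subst (liftSub (liftSub s _) σ)).inst₂ f a = t.subst (consSub a (consSub f s)) := by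
  refine Computation.subst_subst t ?_
  rintro _ (_ | _ | x)
  · simp only [liftSub, Value.subst, consSub]
  · simp only [liftSub, Value.subst, Value.rename, consSub]
  · simp only [liftSub, consSub]
    exact (Value.subst_rename _ (s' := consSub f fun _ => .var) (by intros; rfl)).trans
      ((Value.subst_rename _ (s' := fun _ => .var) (by intros; rfl)).trans
        (Value.subst_var _ (by intros; rfl)))

/-- The element of the set of values of a ground type given by a closed value of that type. -/
lemma Value.exists_ofGround : ∀ {g : Ground S.TyConst} (a : Value S [] (.base g)),
    ∃ x, a = Value.ofGround g x
  | _, .zero => ⟨⟨0⟩, rfl⟩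
  | _, .succ n => by
    obtain ⟨x, hx⟩ := Value.exists_ofGround n
    exact ⟨⟨x.down + 1⟩, congrArg Value.succ hx⟩
  | _, .const c => ⟨c, rfl⟩

lemma Value.numeral_injective : Function.Injective (Value.numeral (S := S))
  | 0, 0, _ => rfl
  | m + 1, n + 1, h => by
    simp only [Value.numeral, Value.succ.injEq] at h
    exact congrArg _ (Value.numeral_injective h)

lemma Value.ofGround_injective : ∀ g : Ground S.TyConst, Function.Injective (Value.ofGround g)
  | .nat => fun _ _ h => ULift.ext _ _ (Value.numeral_injective h)
  | .const _ => fun _ _ h => by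
    injection h

lemma Eval.app_inv {σ τ : Ty S.TyConst} {t : Computation S [σ, .arr σ τ] τ} {a : Value S [] σ}
    {b : Value S [] τ} (h : Eval (.app (.fn t) a) b) : Eval (t.inst₂ (.fn t) a) b := by
  cases h with
  | app _ _ _ h => exact h

/-- The partial function computed by a value `.op f`. -/
def Value.RunsTo : ∀ {σ τ : Ty S.TyConst}, Value S [] (.arr σ τ) → Value S [] σ →
    Value S [] τ → Prop
  | _, _, .op f, a, b => ∃ x y, a = .ofGround _ x ∧ b = .ofGround _ y ∧ S.run f x = some y
  | _, _, .fn _, _, _ => True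

/-- The partial function computed by an application of a value `.op f`. -/
def Computation.RunsTo : ∀ {τ : Ty S.TyConst}, Computation S [] τ → Value S [] τ → Prop
  | _, .app f a, b => f.RunsTo a b
  | _, _, _ => True

/-- Inversion for `.op f` goes through a predicate on arbitrary computations, so that the case split
is made on an evaluation whose type, computation and value are all variables. -/
lemma Eval.runsTo {τ : Ty S.TyConst} {t : Computation S [] τ} {b : Value S [] τ}
    (h : Eval t b) : t.RunsTo b := by
  cases h with
  | app => simp only [Computation.RunsTo, Value.RunsTo]
  | op f a b h => exact ⟨a, b, rfl, rfl, h⟩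
  | _ => trivial

lemma Eval.op_inv {f : S.Op} {a : Value S [] (.base (S.src f))} {b : Value S [] (.base (S.tgt f))}
    (h : Eval (.app (.op f) a) b) :
    ∃ x y, a = .ofGround _ x ∧ b = .ofGround _ y ∧ S.run f x = some y :=
  h.runsTo

/-- Needed for adequacy: when the approximations of a recursive function converge at a given
argument, they are all related to the same syntactic value. -/
lemma Eval.det {τ : Ty S.TyConst} {t : Computation S [] τ} {a b : Value S [] τ} (h : Eval t a)
    (h' : Eval t b) : a = b := by
  induction h with
  | ret a => cases h'; rfl
  | app t a b h ih => exact ih h'.app_inv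
  | bind t t' a b h₁ h₂ ih₁ ih₂ =>
    cases h' with
    | bind _ _ a' _ h h' =>
      obtain rfl := ih₁ h
      exact ih₂ h'
  | case_zero t t' b h ih =>
    cases h' with
    | case_zero _ _ _ h' => exact ih h'
  | case_succ n t t' b h ih =>
    cases h' with
    | case_succ _ _ _ _ h' => exact ih h'
  | op f a c h =>
    obtain ⟨x, y, hx, rfl, h'⟩ := h'.op_inv
    obtain rfl := Value.ofGround_injective _ hx
    rw [h] at h'
    rw [Option.some.inj h']

end Language

end SheafPCF

namespace SheafPCF

namespace PointedStrongMonad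

-- Fixed points from unique extension along `ω ⟶ ω̄`.

noncomputable section Fixpoints

variable {E : Type u₁} [Category.{v₁} E] [CartesianMonoidalCategory E]
  (L : PointedStrongMonad E)

/-- The unit of the monad, as a map into `L.obj X`. -/
def ret (X : E) : X ⟶ L.obj X := L.η.app X

/-- The multiplication of the monad, as a map into `L.obj X`. -/
def join (X : E) : L.obj (L.obj X) ⟶ L.obj X := L.μ.app X

lemma whisker_ret_str (X Y : E) : X ◁ L.ret Y ≫ L.str X Y = L.ret (X ⊗ Y) := L.str_η X Y

lemma ret_map {X Y : E} (f : X ⟶ Y) : L.ret X ≫ L.map f = f ≫ L.ret Y :=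
  (L.η.naturality f).symm

lemma ret_join (X : E) : L.ret (L.obj X) ≫ L.join X = 𝟙 _ := L.left_unit X

lemma lift_bot_str {Γ X Y : E} (f : Γ ⟶ X) (g : Γ ⟶ 𝟙_ E) :
    lift f (g ≫ L.bot Y) ≫ L.str X Y = g ≫ L.bot (X ⊗ Y) := by
  have h : lift f (g ≫ L.bot Y) = lift f g ≫ X ◁ L.bot Y := by
    ext <;> simp
  rw [h, Category.assoc, L.str_bot, ← Category.assoc]
  congr 1
  exact toUnit_unique _ _

lemma lift_ret_str {Γ X Y : E} (f : Γ ⟶ X) (g : Γ ⟶ Y) :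
    lift f (g ≫ L.ret Y) ≫ L.str X Y = lift f g ≫ L.ret (X ⊗ Y) := by
  have h : lift f (g ≫ L.ret Y) = lift f g ≫ X ◁ L.ret Y := by
    ext <;> simp
  rw [h, Category.assoc, L.whisker_ret_str]

lemma whiskerRight_str {X X' : E} (f : X ⟶ X') (Y : E) :
    f ▷ L.obj Y ≫ L.str X' Y = L.str X Y ≫ L.map (f ▷ Y) := by
  have h := L.str_natural f (𝟙 Y)
  rw [tensorHom_id] at h
  rw [← h]
  congr 1
  rw [← tensorHom_id]
  congr 1
  exact (L.map_id Y).symm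

/-- The unit, as a map `Lⁿ 1 ⟶ Lⁿ⁺¹ 1`. -/
def up (n : ℕ) : L.iter n ⟶ L.iter (n + 1) := L.ret (L.iter n)

lemma up_emb (n : ℕ) : L.up n ≫ L.emb (n + 1) = L.emb n ≫ L.up (n + 1) := L.ret_map _

lemma up_proj (n : ℕ) : L.up (n + 1) ≫ L.proj (n + 1) = L.proj n ≫ L.up n := L.ret_map _

lemma up_trunc (n m : ℕ) : L.up n ≫ L.trunc (n + 1) (m + 1) = L.trunc n m ≫ L.up m := L.ret_map _

lemma top_succ (n : ℕ) : L.top (n + 1) = L.top n ≫ L.up n := rfl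

section

variable [HasColimitsOfShape ℕ E]

lemma emb_omegaι (n : ℕ) : L.emb n ≫ L.omegaι (n + 1) = L.omegaι n := by
  have h := colimit.w (Functor.ofSequence L.emb) (homOfLE (Nat.le_add_right n 1))
  rw [Functor.ofSequence_map_homOfLE_succ] at h
  exact h

lemma omega_hom_ext {X : E} {f g : L.omega ⟶ X}
    (h : ∀ n, L.omegaι n ≫ f = L.omegaι n ≫ g) : f = g :=
  colimit.hom_ext h

/-- The successor map on `ω`. -/
def omegaSucc : L.omega ⟶ L.omega :=
  L.fromOmega (fun n => L.up n ≫ L.omegaι (n + 1)) fun n => by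
    rw [← Category.assoc, ← L.up_emb, Category.assoc, L.emb_omegaι]

lemma omegaι_succ (n : ℕ) :
    L.omegaι n ≫ L.omegaSucc = L.up n ≫ L.omegaι (n + 1) :=
  L.omegaι_fromOmega _ _ n

end

section

variable [HasLimitsOfShape ℕᵒᵖ E]

lemma omegaBarπ_proj (n : ℕ) : L.omegaBarπ (n + 1) ≫ L.proj n = L.omegaBarπ n := by
  have h := limit.w (Functor.ofOpSequence L.proj) (homOfLE (Nat.le_add_right n 1)).op
  rw [Functor.ofOpSequence_map_homOfLE_succ] at h
  exact h

/-- The components of the successor map on `ω̄`. -/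
def omegaBarSuccπ : ∀ n : ℕ, L.omegaBar ⟶ L.iter n
  | 0 => toUnit _
  | n + 1 => L.omegaBarπ n ≫ L.up n

/-- The successor map on `ω̄`. -/
def omegaBarSucc : L.omegaBar ⟶ L.omegaBar :=
  L.toOmegaBar L.omegaBarSuccπ fun n => by
    cases n with
    | zero => exact toUnit_unique _ _
    | succ n =>
      change (L.omegaBarπ (n + 1) ≫ L.up (n + 1)) ≫ L.proj (n + 1) = L.omegaBarπ n ≫ L.up n
      rw [Category.assoc, L.up_proj, ← Category.assoc, L.omegaBarπ_proj]

lemma omegaBarSucc_π (n : ℕ) :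
    L.omegaBarSucc ≫ L.omegaBarπ (n + 1) = L.omegaBarπ n ≫ L.up n :=
  L.toOmegaBar_π _ _ (n + 1)

lemma infty_π (n : ℕ) : L.infty ≫ L.omegaBarπ n = L.top n := L.toOmegaBar_π _ _ n

/-- The components of `∞` are the iterated units, and one more unit moves each to the next. This is
the reason why evaluation at `∞` yields a fixed point. -/
lemma infty_succ : L.infty ≫ L.omegaBarSucc = L.infty := by
  refine L.omegaBar_hom_ext fun n => ?_
  cases n with
  | zero => exact toUnit_unique _ _
  | succ n =>
    rw [Category.assoc, L.omegaBarSucc_π, ← Category.assoc, L.infty_π, L.infty_π, L.top_succ]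

end

variable [HasColimitsOfShape ℕ E] [HasLimitsOfShape ℕᵒᵖ E]

lemma omegaι_comparison_π (n m : ℕ) :
    L.omegaι n ≫ L.comparison ≫ L.omegaBarπ m = L.trunc n m := by
  rw [← Category.assoc, comparison, L.omegaι_fromOmega, L.toOmegaBar_π]

lemma succ_comparison : L.omegaSucc ≫ L.comparison = L.comparison ≫ L.omegaBarSucc := by
  refine L.omega_hom_ext fun n => L.omegaBar_hom_ext fun m => ?_
  cases m with
  | zero => exact toUnit_unique _ _
  | succ m =>
    simp only [Category.assoc, L.omegaBarSucc_π]
    rw [← Category.assoc, L.omegaι_succ, Category.assoc, L.omegaι_comparison_π,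
      ← Category.assoc L.comparison, ← Category.assoc, L.omegaι_comparison_π, L.up_trunc]

variable [MonoidalClosed E] {Γ A B : E}

/-- In a closed category `A ⊗ -` preserves the colimit `ω`; concretely, the two maps are compared
after transposition. -/
lemma whisker_omega_hom_ext {X : E} {f g : A ⊗ L.omega ⟶ X}
    (h : ∀ n, A ◁ L.omegaι n ≫ f = A ◁ L.omegaι n ≫ g) : f = g := by
  apply MonoidalClosed.curry_injective
  refine L.omega_hom_ext fun n => ?_
  rw [← MonoidalClosed.curry_natural_left, ← MonoidalClosed.curry_natural_left, h]

lemma omegaι_approxOmega (g : Γ ⊗ (ihom A).obj (L.obj B) ⟶ (ihom A).obj (L.obj B)) (n : ℕ) :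
    Γ ◁ L.omegaι n ≫ L.approxOmega g = L.approx g n := by
  rw [approxOmega, ← MonoidalClosed.uncurry_natural_left, L.omegaι_fromOmega,
    MonoidalClosed.uncurry_curry]

lemma algebra_def (A B : E) : L.algebra A B = MonoidalClosed.curry
    (L.str A ((ihom A).obj (L.obj B)) ≫ L.map ((ihom.ev A).app (L.obj B)) ≫ L.join B) := rfl

/-- Used twice: it unfolds one step of the approximations, and it exhibits `A ⇒ L B` as a retract of
its lifting, which makes function types well-complete. -/
lemma ret_algebra (A B : E) : L.ret _ ≫ L.algebra A B = 𝟙 ((ihom A).obj (L.obj B)) := by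
  rw [algebra_def, ← MonoidalClosed.curry_natural_left, ← Category.assoc, L.whisker_ret_str,
    ← Category.assoc, L.ret_map, Category.assoc]
  erw [L.ret_join, Category.comp_id]
  apply MonoidalClosed.uncurry_injective
  rw [MonoidalClosed.uncurry_curry, MonoidalClosed.uncurry_id_eq_ev]

/-- On points, moving from `k` to `k + 1` costs exactly one application of `g`: on total elements
the lifting and the algebra structure in `approx` cancel. -/
lemma up_approx (g : Γ ⊗ (ihom A).obj (L.obj B) ⟶ (ihom A).obj (L.obj B)) (n : ℕ) :
    Γ ◁ L.up n ≫ L.approx g (n + 1) =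
      CartesianMonoidalCategory.lift (fst _ _) (L.approx g n) ≫ g := by
  change Γ ◁ L.ret (L.iter n) ≫ L.str Γ (L.iter n) ≫ L.map _ ≫ L.algebra A B = _
  rw [← Category.assoc, L.whisker_ret_str, ← Category.assoc, L.ret_map, Category.assoc,
    L.ret_algebra]
  exact Category.comp_id _

lemma approx_natural {Γ' : E} (m : Γ' ⟶ Γ)
    (g : Γ ⊗ (ihom A).obj (L.obj B) ⟶ (ihom A).obj (L.obj B)) :
    ∀ n : ℕ, m ▷ L.iter n ≫ L.approx g n = L.approx (m ▷ _ ≫ g) n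
  | 0 => by
    change m ▷ L.iter 0 ≫ toUnit _ ≫ L.bot _ ≫ L.algebra A B = toUnit _ ≫ L.bot _ ≫ L.algebra A B
    rw [← Category.assoc]
    congr 1
    exact toUnit_unique _ _
  | n + 1 => by
    change m ▷ L.obj (L.iter n) ≫ L.str Γ (L.iter n) ≫ L.map _ ≫ L.algebra A B =
      L.str Γ' (L.iter n) ≫ L.map _ ≫ L.algebra A B
    rw [← Category.assoc, L.whiskerRight_str, Category.assoc, ← Category.assoc (L.map _),
      ← L.map_comp]
    congr 3
    rw [← approx_natural m g n, ← Category.assoc, ← Category.assoc]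
    congr 1
    ext <;> simp

/-- The extension of the approximations of the fixed point of `g` to `Γ × ω̄`. -/
def fixExt (h : L.Complete ((ihom A).obj (L.obj B)))
    (g : Γ ⊗ (ihom A).obj (L.obj B) ⟶ (ihom A).obj (L.obj B)) :
    Γ ⊗ L.omegaBar ⟶ (ihom A).obj (L.obj B) :=
  (h Γ (L.approxOmega g)).choose

lemma comparison_fixExt (h : L.Complete ((ihom A).obj (L.obj B)))
    (g : Γ ⊗ (ihom A).obj (L.obj B) ⟶ (ihom A).obj (L.obj B)) :
    Γ ◁ L.comparison ≫ L.fixExt h g = L.approxOmega g :=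
  (h Γ (L.approxOmega g)).choose_spec.1

lemma fix_eq_fixExt (h : L.Complete ((ihom A).obj (L.obj B)))
    (g : Γ ⊗ (ihom A).obj (L.obj B) ⟶ (ihom A).obj (L.obj B)) :
    L.fix g = lift (𝟙 Γ) (toUnit Γ ≫ L.infty) ≫ L.fixExt h g :=
  dif_pos h

/-- The uniqueness half of completeness, in the form in which it is applied: an extension is
recognised by its restrictions to the stages `Lⁿ 1`. -/
lemma fixExt_unique (h : L.Complete ((ihom A).obj (L.obj B)))
    {g : Γ ⊗ (ihom A).obj (L.obj B) ⟶ (ihom A).obj (L.obj B)}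
    {k : Γ ⊗ L.omegaBar ⟶ (ihom A).obj (L.obj B)}
    (hk : ∀ n, Γ ◁ (L.omegaι n ≫ L.comparison) ≫ k = L.approx g n) : k = L.fixExt h g := by
  refine (h Γ (L.approxOmega g)).choose_spec.2 k (L.whisker_omega_hom_ext fun n => ?_)
  rw [L.omegaι_approxOmega, ← hk, MonoidalCategory.whiskerLeft_comp, Category.assoc]

lemma omegaι_fixExt (h : L.Complete ((ihom A).obj (L.obj B)))
    (g : Γ ⊗ (ihom A).obj (L.obj B) ⟶ (ihom A).obj (L.obj B)) (n : ℕ) :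
    Γ ◁ (L.omegaι n ≫ L.comparison) ≫ L.fixExt h g = L.approx g n := by
  rw [MonoidalCategory.whiskerLeft_comp, Category.assoc, L.comparison_fixExt,
    L.omegaι_approxOmega]

/-- Both sides extend the approximations in the context `Γ'`. This is what the recursive case of the
substitution lemma needs. -/
lemma fixExt_natural (h : L.Complete ((ihom A).obj (L.obj B)))
    {Γ' : E} (m : Γ' ⟶ Γ)
    (g : Γ ⊗ (ihom A).obj (L.obj B) ⟶ (ihom A).obj (L.obj B)) :
    m ▷ _ ≫ L.fixExt h g = L.fixExt h (m ▷ _ ≫ g) := by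
  refine L.fixExt_unique h fun n => ?_
  rw [← Category.assoc, whisker_exchange, Category.assoc, L.omegaι_fixExt, L.approx_natural]

lemma fix_natural (h : L.Complete ((ihom A).obj (L.obj B)))
    {Γ' : E} (m : Γ' ⟶ Γ)
    (g : Γ ⊗ (ihom A).obj (L.obj B) ⟶ (ihom A).obj (L.obj B)) :
    m ≫ L.fix g = L.fix (m ▷ _ ≫ g) := by
  rw [L.fix_eq_fixExt h, L.fix_eq_fixExt h, ← L.fixExt_natural h, ← Category.assoc,
    ← Category.assoc]
  congr 1
  ext <;> simp

/-- On `Γ × ω` the equation is the recursion for the approximations, since the successors of `ω` and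
`ω̄` correspond under the comparison map. It propagates to `Γ × ω̄` because both sides extend the
same map. -/
lemma succ_fixExt (h : L.Complete ((ihom A).obj (L.obj B)))
    (g : Γ ⊗ (ihom A).obj (L.obj B) ⟶ (ihom A).obj (L.obj B)) :
    Γ ◁ L.omegaBarSucc ≫ L.fixExt h g = lift (fst _ _) (L.fixExt h g) ≫ g := by
  have key : Γ ◁ L.comparison ≫ Γ ◁ L.omegaBarSucc ≫ L.fixExt h g =
      Γ ◁ L.comparison ≫ lift (fst _ _) (L.fixExt h g) ≫ g := by
    refine L.whisker_omega_hom_ext fun n => ?_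
    have h₁ : Γ ◁ L.omegaι n ≫ Γ ◁ L.comparison ≫ Γ ◁ L.omegaBarSucc ≫ L.fixExt h g =
        Γ ◁ L.up n ≫ Γ ◁ (L.omegaι (n + 1) ≫ L.comparison) ≫ L.fixExt h g := by
      simp only [← Category.assoc, ← MonoidalCategory.whiskerLeft_comp]
      congr 2
      rw [Category.assoc, ← L.succ_comparison, ← Category.assoc, L.omegaι_succ]
    have h₂ : Γ ◁ L.omegaι n ≫ Γ ◁ L.comparison ≫ lift (fst _ _) (L.fixExt h g) ≫ g =
        lift (fst _ _) (Γ ◁ (L.omegaι n ≫ L.comparison) ≫ L.fixExt h g) ≫ g := by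
      simp only [← Category.assoc]
      congr 1
      ext <;> simp
    rw [h₁, h₂, L.omegaι_fixExt, L.omegaι_fixExt, L.up_approx]
  exact (h Γ (Γ ◁ L.comparison ≫ lift (fst _ _) (L.fixExt h g) ≫ g)).unique key rfl

lemma fix_eq (h : L.Complete ((ihom A).obj (L.obj B)))
    (g : Γ ⊗ (ihom A).obj (L.obj B) ⟶ (ihom A).obj (L.obj B)) :
    lift (𝟙 Γ) (L.fix g) ≫ g = L.fix g := by
  have h₁ : lift (𝟙 Γ) (L.fix g) =
      lift (𝟙 Γ) (toUnit Γ ≫ L.infty) ≫ lift (fst _ _) (L.fixExt h g) := by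
    ext <;> simp [L.fix_eq_fixExt h]
  rw [h₁, Category.assoc, ← L.succ_fixExt h, ← Category.assoc, lift_whiskerLeft, Category.assoc,
    L.infty_succ, ← L.fix_eq_fixExt h]

end Fixpoints

end PointedStrongMonad

end SheafPCF

namespace SheafPCF

-- The semantic substitution lemma and soundness.

noncomputable section Semantics

variable {E : Type u₁} [Category.{v₁} E] [CartesianMonoidalCategory E]

namespace PointedStrongMonad

variable (L : PointedStrongMonad E)

/-- Kleisli composition in context. -/
def bind {Γ X Y : E} (f : Γ ⟶ L.obj X) (k : X ⊗ Γ ⟶ L.obj Y) : Γ ⟶ L.obj Y :=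
  lift (𝟙 _) f ≫ L.str _ _ ≫ L.map (lift (snd _ _) (fst _ _) ≫ k) ≫ L.join Y

lemma bind_natural {Γ Δ X Y : E} (m : Δ ⟶ Γ) (f : Γ ⟶ L.obj X) (k : X ⊗ Γ ⟶ L.obj Y) :
    m ≫ L.bind f k = L.bind (m ≫ f) (X ◁ m ≫ k) := by
  have h₁ : m ≫ lift (𝟙 _) f = lift (𝟙 _) (m ≫ f) ≫ m ▷ L.obj X := by
    ext <;> simp
  have h₂ : m ▷ X ≫ lift (snd _ _) (fst _ _) ≫ k = lift (snd _ _) (fst _ _) ≫ X ◁ m ≫ k := by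
    simp only [← Category.assoc]
    congr 1
    ext <;> simp
  rw [bind, ← Category.assoc, h₁, Category.assoc, ← Category.assoc (m ▷ L.obj X),
    L.whiskerRight_str, Category.assoc, ← Category.assoc (L.map _), ← L.map_comp, h₂]
  rfl

lemma bind_ret {Γ X Y : E} (f : Γ ⟶ X) (k : X ⊗ Γ ⟶ L.obj Y) :
    L.bind (f ≫ L.ret X) k = lift f (𝟙 _) ≫ k := by
  have h := L.lift_ret_str (𝟙 Γ) f
  change lift (𝟙 _) (f ≫ L.ret X) ≫ L.str _ _ = _ at h
  rw [bind, ← Category.assoc, h, Category.assoc, ← Category.assoc (L.ret _), L.ret_map,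
    Category.assoc, L.ret_join, Category.comp_id, ← Category.assoc, comp_lift, lift_snd, lift_fst]

end PointedStrongMonad

lemma toUnit_comp_eq {X Y Z : E} (m : X ⟶ Y) (p : 𝟙_ E ⟶ Z) :
    toUnit X ≫ p = m ≫ toUnit Y ≫ p := by
  rw [← Category.assoc]
  congr 1
  exact toUnit_unique _ _

lemma toUnit_unit_comp {Z : E} (p : 𝟙_ E ⟶ Z) : toUnit (𝟙_ E) ≫ p = p := by
  rw [toUnit_unique (toUnit _) (𝟙 (𝟙_ E)), Category.id_comp]

section Exponentials

variable [MonoidalClosed E]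

/-- The application of a map into an exponential. -/
def evalAt {X A B : E} (a : X ⟶ A) (f : X ⟶ (ihom A).obj B) : X ⟶ B :=
  lift a f ≫ (ihom.ev A).app B

lemma comp_evalAt {X Y A B : E} (m : Y ⟶ X) (a : X ⟶ A) (f : X ⟶ (ihom A).obj B) :
    m ≫ evalAt a f = evalAt (m ≫ a) (m ≫ f) := by
  rw [evalAt, evalAt, ← Category.assoc, comp_lift]

lemma evalAt_curry {X A Γ B : E} (a : X ⟶ A) (m : X ⟶ Γ) (k : A ⊗ Γ ⟶ B) :
    evalAt a (m ≫ MonoidalClosed.curry k) = lift a m ≫ k := by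
  have h : lift a (m ≫ MonoidalClosed.curry k) = lift a m ≫ A ◁ MonoidalClosed.curry k := by
    ext <;> simp
  rw [evalAt, h, Category.assoc, ← MonoidalClosed.uncurry_eq, MonoidalClosed.uncurry_curry]

lemma curry_fst_natural {Γ Δ A B : E} (m : Δ ⟶ Γ) (f : A ⟶ B) :
    MonoidalClosed.curry (fst A Δ ≫ f) = m ≫ MonoidalClosed.curry (fst A Γ ≫ f) := by
  rw [← MonoidalClosed.curry_natural_left, whiskerLeft_fst_assoc]

lemma evalAt_curry_fst {X A Γ B : E} (a : X ⟶ A) (m : X ⟶ Γ) (f : A ⟶ B) :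
    evalAt a (m ≫ MonoidalClosed.curry (fst A Γ ≫ f)) = a ≫ f := by
  rw [evalAt_curry, lift_fst_assoc]

/-- Currying, with the two other variables exchanged. -/
def swapCurry {Γ A F B : E} (k : A ⊗ (F ⊗ Γ) ⟶ B) : Γ ⊗ F ⟶ (ihom A).obj B :=
  MonoidalClosed.curry ((A ◁ lift (snd _ _) (fst _ _)) ≫ k)

lemma swapCurry_natural {Γ Δ A F B : E} (k : A ⊗ (F ⊗ Γ) ⟶ B) (m : Δ ⟶ Γ) :
    m ▷ F ≫ swapCurry k = swapCurry ((A ◁ (F ◁ m)) ≫ k) := by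
  rw [swapCurry, swapCurry, ← MonoidalClosed.curry_natural_left]
  congr 1
  simp only [← Category.assoc, ← MonoidalCategory.whiskerLeft_comp]
  congr 2
  ext <;> simp

lemma evalAt_swapCurry {X Γ A F B : E} (k : A ⊗ (F ⊗ Γ) ⟶ B) (a : X ⟶ A) (m : X ⟶ Γ)
    (f : X ⟶ F) :
    evalAt a (lift m f ≫ swapCurry k) = lift a (lift f m) ≫ k := by
  rw [swapCurry, evalAt_curry, ← Category.assoc]
  congr 1
  ext <;> simp

end Exponentials

variable {S : Signature.{u, v, w}} {L : PointedStrongMonad E} [MonoidalClosed E]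
  [HasCoproduct (fun _ : ℕ => 𝟙_ E)] [HasColimitsOfShape ℕ E] [HasLimitsOfShape ℕᵒᵖ E]

lemma ι_natSucc (n : ℕ) :
    natPt E n ≫ Sigma.desc (fun k : ℕ => natPt E (k + 1)) = natPt E (n + 1) :=
  Sigma.ι_desc _ _

namespace SigInterp

/-- In a closed category `Γ ⊗ -` preserves the coproduct `1 + 1 + ⋯`, so a map in context is tested
on the numerals. -/
lemma natCase_hom_ext {Γ X : E} {f g : Γ ⊗ natObj E ⟶ X}
    (h : ∀ n, Γ ◁ natPt E n ≫ f = Γ ◁ natPt E n ≫ g) : f = g := by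
  apply MonoidalClosed.curry_injective
  refine Sigma.hom_ext _ _ fun n => ?_
  have := congrArg MonoidalClosed.curry (h n)
  rwa [MonoidalClosed.curry_natural_left, MonoidalClosed.curry_natural_left] at this

lemma whisker_zero_natCase {Γ X : E} (f : Γ ⟶ X) (g : natObj E ⊗ Γ ⟶ X) :
    Γ ◁ natPt E 0 ≫ natCase f g = fst _ _ ≫ f := by
  rw [natCase, ← MonoidalClosed.uncurry_natural_left]
  erw [Sigma.ι_desc]
  exact MonoidalClosed.uncurry_curry _

lemma whisker_succ_natCase {Γ X : E} (f : Γ ⟶ X) (g : natObj E ⊗ Γ ⟶ X) (n : ℕ) :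
    Γ ◁ natPt E (n + 1) ≫ natCase f g = lift (snd _ _ ≫ natPt E n) (fst _ _) ≫ g := by
  rw [natCase, ← MonoidalClosed.uncurry_natural_left]
  erw [Sigma.ι_desc]
  exact MonoidalClosed.uncurry_curry _

lemma natCase_natural {Γ Δ X : E} (m : Δ ⟶ Γ) (f : Γ ⟶ X) (g : natObj E ⊗ Γ ⟶ X) :
    m ▷ _ ≫ natCase f g = natCase (m ≫ f) (_ ◁ m ≫ g) := by
  refine natCase_hom_ext fun n => ?_
  rw [← Category.assoc, whisker_exchange, Category.assoc]
  cases n with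
  | zero =>
    rw [whisker_zero_natCase, whisker_zero_natCase, ← Category.assoc, ← Category.assoc,
      whiskerRight_fst]
  | succ n =>
    rw [whisker_succ_natCase, whisker_succ_natCase]
    simp only [← Category.assoc]
    congr 1
    refine CartesianMonoidalCategory.hom_ext _ _ ?_ ?_
    · simp [toUnit_unique (toUnit _) (snd _ _)]
    · simp only [Category.assoc, lift_snd, whiskerRight_fst, whiskerLeft_snd, lift_snd_assoc]

lemma lift_natCase {Γ Δ X : E} (m : Δ ⟶ Γ) (k : Γ ⟶ natObj E) (f : Γ ⟶ X)
    (g : natObj E ⊗ Γ ⟶ X) :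
    m ≫ lift (𝟙 _) k ≫ natCase f g = lift (𝟙 _) (m ≫ k) ≫ natCase (m ≫ f) (_ ◁ m ≫ g) := by
  rw [← natCase_natural, ← Category.assoc, ← Category.assoc]
  congr 1
  ext <;> simp

lemma lift_zero_natCase {Γ X : E} (f : Γ ⟶ X) (g : natObj E ⊗ Γ ⟶ X) :
    lift (𝟙 _) (toUnit Γ ≫ natPt E 0) ≫ natCase f g = f := by
  have h : lift (𝟙 _) (toUnit Γ ≫ natPt E 0) = lift (𝟙 _) (toUnit Γ) ≫ Γ ◁ natPt E 0 := by
    ext <;> simp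
  rw [h, Category.assoc, whisker_zero_natCase, ← Category.assoc, lift_fst, Category.id_comp]

lemma lift_succ_natCase {Γ X : E} (f : Γ ⟶ X) (g : natObj E ⊗ Γ ⟶ X) (n : ℕ) :
    lift (𝟙 _) (toUnit Γ ≫ natPt E (n + 1)) ≫ natCase f g =
      lift (toUnit Γ ≫ natPt E n) (𝟙 _) ≫ g := by
  have h : lift (𝟙 _) (toUnit Γ ≫ natPt E (n + 1)) =
      lift (𝟙 _) (toUnit Γ) ≫ Γ ◁ natPt E (n + 1) := by
    ext <;> simp
  rw [h, Category.assoc, whisker_succ_natCase, ← Category.assoc]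
  congr 1
  ext <;> simp

variable (I : SigInterp L S)

lemma value_zero (Γ : Ctx S.TyConst) :
    I.value (.zero : Value S Γ _) = toUnit _ ≫ natPt E 0 := by
  simp only [value]
  rfl

lemma value_succ {Γ : Ctx S.TyConst} (n : Value S Γ (.base .nat)) :
    I.value n.succ = (show I.ctx Γ ⟶ natObj E from I.value n) ≫
      Sigma.desc fun k : ℕ => natPt E (k + 1) := by
  simp only [value]
  rfl

lemma value_var {Γ : Ctx S.TyConst} {τ : Ty S.TyConst} (x : Var Γ τ) :
    I.value (.var x) = I.var x := by
  simp only [value]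

lemma value_const {Γ : Ctx S.TyConst} {α : S.TyConst} (c : S.Val α) :
    I.value (.const c : Value S Γ _) = toUnit _ ≫ I.pt α c := by
  simp only [value]
  rfl

lemma value_op {Γ : Ctx S.TyConst} (f : S.Op) :
    I.value (.op f : Value S Γ _) = MonoidalClosed.curry (fst _ _ ≫ I.op f) := by
  simp only [value]
  rfl

/-- The interpretation of the body of a recursive function. -/
def body {Γ : Ctx S.TyConst} {σ τ : Ty S.TyConst} (t : Computation S (σ :: .arr σ τ :: Γ) τ) :
    I.ctx Γ ⊗ (ihom (I.ty σ)).obj (L.obj (I.ty τ)) ⟶ (ihom (I.ty σ)).obj (L.obj (I.ty τ)) :=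
  swapCurry (F := I.ty (.arr σ τ)) (I.comp t)

lemma value_fn {Γ : Ctx S.TyConst} {σ τ : Ty S.TyConst}
    (t : Computation S (σ :: .arr σ τ :: Γ) τ) : I.value (.fn t) = L.fix (I.body t) := by
  simp only [value]
  rfl

lemma comp_app {Γ : Ctx S.TyConst} {σ τ : Ty S.TyConst} (f : Value S Γ (.arr σ τ))
    (a : Value S Γ σ) : I.comp (.app f a) =
      evalAt (A := I.ty σ) (B := L.obj (I.ty τ)) (I.value a) (I.value f) := by
  simp only [comp]
  rfl

lemma comp_ret {Γ : Ctx S.TyConst} {τ : Ty S.TyConst} (a : Value S Γ τ) :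
    I.comp (.ret a) = I.value a ≫ L.ret _ := by
  simp only [comp]
  rfl

lemma comp_bind {Γ : Ctx S.TyConst} {σ τ : Ty S.TyConst} (t : Computation S Γ σ)
    (t' : Computation S (σ :: Γ) τ) :
    I.comp (.bind t t') = L.bind (I.comp t) (I.comp t') := by
  simp only [comp]
  rfl

lemma comp_case {Γ : Ctx S.TyConst} {τ : Ty S.TyConst} (n : Value S Γ (.base .nat))
    (t : Computation S Γ τ) (t' : Computation S (.base .nat :: Γ) τ) :
    I.comp (.case n t t') = lift (𝟙 _) (I.value n) ≫ natCase (I.comp t) (I.comp t') := by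
  simp only [comp]

lemma body_natural {Γ Δ : Ctx S.TyConst} {σ τ : Ty S.TyConst}
    (t : Computation S (σ :: .arr σ τ :: Γ) τ) (t' : Computation S (σ :: .arr σ τ :: Δ) τ)
    (m : I.ctx Δ ⟶ I.ctx Γ)
    (h : I.comp t' = (I.ty σ ◁ (I.ty (.arr σ τ) ◁ m)) ≫ I.comp t) :
    m ▷ _ ≫ I.body t = I.body t' :=
  (swapCurry_natural (I.comp t) m).trans (congrArg swapCurry h.symm)

lemma evalAt_body {X : E} {Γ : Ctx S.TyConst} {σ τ : Ty S.TyConst}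
    (t : Computation S (σ :: .arr σ τ :: Γ) τ) (a : X ⟶ I.ty σ) (m : X ⟶ I.ctx Γ)
    (f : X ⟶ I.ty (.arr σ τ)) :
    evalAt a (lift m f ≫ I.body t) = lift a (lift f m) ≫ I.comp t :=
  evalAt_swapCurry _ _ _ _

lemma evalAt_op {X : E} {Γ : Ctx S.TyConst} (f : S.Op) (m : X ⟶ I.ctx Γ)
    (a : X ⟶ I.ty (.base (S.src f))) :
    evalAt (A := I.ty (.base (S.src f))) (B := L.obj (I.ty (.base (S.tgt f)))) a
      (m ≫ I.value (.op f)) = a ≫ I.op f := by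
  rw [value_op]
  exact evalAt_curry_fst a m (I.op f)

/-- A map between the interpretations of contexts which interprets a renaming. -/
def InterpretsRen {Γ Δ : Ctx S.TyConst} (ρ : ∀ τ, Var Γ τ → Var Δ τ)
    (m : I.ctx Δ ⟶ I.ctx Γ) : Prop :=
  ∀ τ x, I.var (ρ τ x) = m ≫ I.var x

/-- A map between the interpretations of contexts which interprets a substitution. -/
def InterpretsSub {Γ Δ : Ctx S.TyConst} (s : ∀ τ, Var Γ τ → Value S Δ τ)
    (m : I.ctx Δ ⟶ I.ctx Γ) : Prop :=
  ∀ τ x, I.value (s τ x) = m ≫ I.var x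

variable {I}

lemma InterpretsRen.lift {Γ Δ : Ctx S.TyConst} {ρ : ∀ τ, Var Γ τ → Var Δ τ}
    {m : I.ctx Δ ⟶ I.ctx Γ} (h : I.InterpretsRen ρ m) (σ : Ty S.TyConst) :
    I.InterpretsRen (liftRen ρ σ) (I.ty σ ◁ m)
  | _, .zero => (whiskerLeft_fst _ _).symm
  | _, .succ x => by
    change snd (I.ty σ) (I.ctx Δ) ≫ I.var (ρ _ x) = (I.ty σ ◁ m) ≫ snd (I.ty σ) (I.ctx Γ) ≫ I.var x
    rw [h, whiskerLeft_snd_assoc]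

-- Renaming precedes substitution because a substitution is weakened under binders. Completeness
-- enters only for recursive functions, through `fix_natural`; without it `fix` would be the default
-- value `⊥`.
mutual
lemma value_rename (hc : ∀ τ, L.Complete (I.ty τ)) : ∀ {Γ Δ : Ctx S.TyConst} {τ : Ty S.TyConst}
    (a : Value S Γ τ) {ρ : ∀ τ, Var Γ τ → Var Δ τ} {m : I.ctx Δ ⟶ I.ctx Γ}
    (_ : I.InterpretsRen ρ m), I.value (a.rename ρ) = m ≫ I.value a
  | _, _, _, .var x, _, _, h => by
    rw [Value.rename, value_var, value_var, h]
  | _, _, _, .zero, _, _, _ => by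
    rw [Value.rename, value_zero, value_zero]
    exact toUnit_comp_eq _ _
  | _, _, _, .succ n, _, _, h => by
    rw [Value.rename, value_succ, value_succ, value_rename hc n h]
    exact Category.assoc _ _ _
  | _, _, _, .fn (σ := σ) (τ := τ) t, _, _, h => by
    rw [Value.rename, value_fn, value_fn]
    refine Eq.trans ?_ (L.fix_natural (hc (.arr σ τ)) _ _).symm
    rw [body_natural I t _ _ (comp_rename hc t ((h.lift _).lift _))]
  | _, _, _, .const c, _, _, _ => by
    rw [Value.rename, value_const, value_const]
    exact toUnit_comp_eq _ _
  | _, _, _, .op f, _, _, _ => by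
    rw [Value.rename, value_op, value_op]
    exact curry_fst_natural _ _
lemma comp_rename (hc : ∀ τ, L.Complete (I.ty τ)) : ∀ {Γ Δ : Ctx S.TyConst} {τ : Ty S.TyConst}
    (t : Computation S Γ τ) {ρ : ∀ τ, Var Γ τ → Var Δ τ} {m : I.ctx Δ ⟶ I.ctx Γ}
    (_ : I.InterpretsRen ρ m), I.comp (t.rename ρ) = m ≫ I.comp t
  | _, _, _, .app f a, _, _, h => by
    rw [Computation.rename, comp_app, comp_app, value_rename hc f h, value_rename hc a h]
    exact (comp_evalAt _ _ _).symm
  | _, _, _, .ret a, _, _, h => by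
    rw [Computation.rename, comp_ret, comp_ret, value_rename hc a h, Category.assoc]
  | _, _, _, .bind t t', _, _, h => by
    rw [Computation.rename, comp_bind, comp_bind, comp_rename hc t h,
      comp_rename hc t' (h.lift _)]
    exact (L.bind_natural _ _ _).symm
  | _, _, _, .case n t t', _, _, h => by
    rw [Computation.rename, comp_case, comp_case, value_rename hc n h, comp_rename hc t h,
      comp_rename hc t' (h.lift _)]
    exact (lift_natCase _ _ _ _).symm
end

lemma InterpretsSub.lift (hc : ∀ τ, L.Complete (I.ty τ)) {Γ Δ : Ctx S.TyConst}
    {s : ∀ τ, Var Γ τ → Value S Δ τ} {m : I.ctx Δ ⟶ I.ctx Γ} (h : I.InterpretsSub s m)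
    (σ : Ty S.TyConst) : I.InterpretsSub (liftSub s σ) (I.ty σ ◁ m)
  | _, .zero => (I.value_var _).trans (whiskerLeft_fst _ _).symm
  | _, .succ x => by
    refine (value_rename hc (Δ := σ :: Δ) (s _ x) (m := snd (I.ty σ) (I.ctx Δ))
      fun _ _ => rfl).trans ?_
    rw [h]
    exact (whiskerLeft_snd_assoc (I.ty σ) m (I.var x)).symm

-- Syntactic substitution is precomposition. As for renaming, the recursive case is the naturality
-- of fixed points in their parameters.
mutual
lemma value_subst (hc : ∀ τ, L.Complete (I.ty τ)) : ∀ {Γ Δ : Ctx S.TyConst} {τ : Ty S.TyConst}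
    (a : Value S Γ τ) {s : ∀ τ, Var Γ τ → Value S Δ τ} {m : I.ctx Δ ⟶ I.ctx Γ}
    (_ : I.InterpretsSub s m), I.value (a.subst s) = m ≫ I.value a
  | _, _, _, .var x, _, _, h => by
    rw [Value.subst, value_var, h]
  | _, _, _, .zero, _, _, _ => by
    rw [Value.subst, value_zero, value_zero]
    exact toUnit_comp_eq _ _
  | _, _, _, .succ n, _, _, h => by
    rw [Value.subst, value_succ, value_succ, value_subst hc n h]
    exact Category.assoc _ _ _
  | _, _, _, .fn (σ := σ) (τ := τ) t, _, _, h => by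
    rw [Value.subst, value_fn, value_fn]
    refine Eq.trans ?_ (L.fix_natural (hc (.arr σ τ)) _ _).symm
    rw [body_natural I t _ _ (comp_subst hc t ((h.lift hc _).lift hc _))]
  | _, _, _, .const c, _, _, _ => by
    rw [Value.subst, value_const, value_const]
    exact toUnit_comp_eq _ _
  | _, _, _, .op f, _, _, _ => by
    rw [Value.subst, value_op, value_op]
    exact curry_fst_natural _ _
lemma comp_subst (hc : ∀ τ, L.Complete (I.ty τ)) : ∀ {Γ Δ : Ctx S.TyConst} {τ : Ty S.TyConst}
    (t : Computation S Γ τ) {s : ∀ τ, Var Γ τ → Value S Δ τ} {m : I.ctx Δ ⟶ I.ctx Γ}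
    (_ : I.InterpretsSub s m), I.comp (t.subst s) = m ≫ I.comp t
  | _, _, _, .app f a, _, _, h => by
    rw [Computation.subst, comp_app, comp_app, value_subst hc f h, value_subst hc a h]
    exact (comp_evalAt _ _ _).symm
  | _, _, _, .ret a, _, _, h => by
    rw [Computation.subst, comp_ret, comp_ret, value_subst hc a h, Category.assoc]
  | _, _, _, .bind t t', _, _, h => by
    rw [Computation.subst, comp_bind, comp_bind, comp_subst hc t h,
      comp_subst hc t' (h.lift hc _)]
    exact (L.bind_natural _ _ _).symm
  | _, _, _, .case n t t', _, _, h => by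
    rw [Computation.subst, comp_case, comp_case, value_subst hc n h, comp_subst hc t h,
      comp_subst hc t' (h.lift hc _)]
    exact (lift_natCase _ _ _ _).symm
end

lemma interpretsSub_nil : I.InterpretsSub (Γ := []) (Δ := []) (fun _ x => .var x) (𝟙 _) :=
  fun _ x => nomatch x

lemma InterpretsSub.cons {Γ Δ : Ctx S.TyConst} {s : ∀ τ, Var Γ τ → Value S Δ τ}
    {m : I.ctx Δ ⟶ I.ctx Γ} (h : I.InterpretsSub s m) {σ : Ty S.TyConst} (a : Value S Δ σ) :
    I.InterpretsSub (consSub a s) (CartesianMonoidalCategory.lift (I.value a) m)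
  | _, .zero => (lift_fst _ _).symm
  | _, .succ x => (h _ x).trans (lift_snd_assoc _ _ _).symm

lemma groundPt_eq_value (g : Ground S.TyConst) (x : g.Val S.Val) :
    I.value (Value.ofGround g x) = groundPt I.pt g x := by
  match g, x with
  | .nat, ⟨n⟩ =>
    change I.value (Value.numeral n) = natPt E n
    induction n with
    | zero =>
      exact (I.value_zero []).trans (toUnit_unit_comp _)
    | succ n ih =>
      refine (I.value_succ _).trans ?_
      rw [ih]
      exact ι_natSucc n
  | .const α, c =>
    exact (I.value_const c).trans (toUnit_unit_comp _)

lemma value_fn_eq (hc : ∀ τ, L.Complete (I.ty τ)) {Γ : Ctx S.TyConst} {σ τ : Ty S.TyConst}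
    (t : Computation S (σ :: .arr σ τ :: Γ) τ) :
    I.value (.fn t) = lift (𝟙 _) (I.value (.fn t)) ≫ I.body t := by
  rw [value_fn]
  exact (L.fix_eq (hc (.arr σ τ)) _).symm

/-- Each evaluation rule becomes an equation: application unrolls the fixed point once, sequencing
is the unit law of Kleisli composition, and case analysis computes on coproduct injections. -/
theorem sound (hc : ∀ τ, L.Complete (I.ty τ)) {τ : Ty S.TyConst} {t : Computation S [] τ}
    {a : Value S [] τ} (h : Eval t a) : I.comp t = I.comp (.ret a) := by
  induction h with
  | ret a => rfl
  | app t a b _ ih =>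
    rw [← ih, Computation.inst₂, comp_subst hc t ((interpretsSub_nil.cons _).cons _), comp_app,
      value_fn_eq hc]
    exact (I.evalAt_body t _ _ _).trans (by rw [← value_fn_eq hc]; rfl)
  | bind t t' a b _ _ ih₁ ih₂ =>
    rw [comp_bind, ih₁, ← ih₂, comp_ret, Computation.inst,
      comp_subst hc t' (interpretsSub_nil.cons _)]
    exact L.bind_ret _ _
  | case_zero t t' b _ ih =>
    rw [comp_case, value_zero, ← ih]
    exact lift_zero_natCase _ _
  | case_succ n t t' b _ ih =>
    -- A closed value of type `nat` is a numeral, so its denotation is a coprojection and the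
    -- coproduct computation rule applies.
    obtain ⟨x, rfl⟩ := n.exists_ofGround
    have h₁ : I.value (Value.ofGround .nat x) = toUnit _ ≫ natPt E x.down := by
      rw [groundPt_eq_value]
      exact (toUnit_unit_comp _).symm
    have h₂ : I.value (Value.ofGround .nat x).succ = toUnit _ ≫ natPt E (x.down + 1) := by
      rw [value_succ, h₁]
      exact (Category.assoc _ _ _).trans (congrArg _ (ι_natSucc _))
    rw [comp_case, h₂, ← ih, Computation.inst, comp_subst hc t' (interpretsSub_nil.cons _), h₁]
    exact lift_succ_natCase _ _ _
  | op f a b h =>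
    rw [comp_app, comp_ret, groundPt_eq_value, groundPt_eq_value]
    refine Eq.trans ?_ (I.op_some f a b h)
    refine Eq.trans ?_ (I.evalAt_op (Γ := []) f (𝟙 _) (groundPt I.pt _ a))
    exact congrArg (evalAt _) (Category.id_comp _).symm

end SigInterp

end Semantics

end SheafPCF

namespace SheafPCF

-- Closure properties of complete objects.

noncomputable section Completeness

variable {E : Type u₁} [Category.{v₁} E] [CartesianMonoidalCategory E]

namespace PointedStrongMonad

variable {L : PointedStrongMonad E} [HasColimitsOfShape ℕ E] [HasLimitsOfShape ℕᵒᵖ E]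

/-- Extend in `Y` and retract; two extensions in `X` become equal in `Y`, where `s` is a split mono.
-/
lemma Complete.retract {X Y : E} (h : L.Complete Y) (s : X ⟶ Y) (r : Y ⟶ X) (hs : s ≫ r = 𝟙 X) :
    L.Complete X := by
  intro A f
  obtain ⟨g, hg, hg'⟩ := h A (f ≫ s)
  dsimp only at hg hg'
  refine ⟨g ≫ r, ?_, fun k hk => ?_⟩
  · dsimp only
    rw [← Category.assoc, hg, Category.assoc, hs, Category.comp_id]
  · rw [← hg' (k ≫ s) (by rw [← hk, Category.assoc]), Category.assoc, hs, Category.comp_id]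

lemma Complete.tensor {X Y : E} (hX : L.Complete X) (hY : L.Complete Y) : L.Complete (X ⊗ Y) := by
  intro A f
  obtain ⟨g, hg, hg'⟩ := hX A (f ≫ fst _ _)
  obtain ⟨k, hk, hk'⟩ := hY A (f ≫ snd _ _)
  dsimp only at hg hg' hk hk'
  refine ⟨lift g k, ?_, fun l hl => ?_⟩
  · dsimp only
    ext
    · rw [Category.assoc, lift_fst, hg]
    · rw [Category.assoc, lift_snd, hk]
  · ext
    · rw [lift_fst]
      exact hg' _ (by rw [← hl, Category.assoc])
    · rw [lift_snd]
      exact hk' _ (by rw [← hl, Category.assoc])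

/-- Transposition turns extending into `B ⇒ Y` with parameters `A` into extending into `Y` with
parameters `B × A`. This is why completeness quantifies over parameter objects. -/
lemma Complete.ihom [MonoidalClosed E] {Y : E} (hY : L.Complete Y) (B : E) :
    L.Complete ((ihom B).obj Y) := by
  intro A f
  obtain ⟨g, hg, hg'⟩ := hY (B ⊗ A) ((α_ _ _ _).hom ≫ MonoidalClosed.uncurry f)
  dsimp only at hg hg'
  have key : ∀ k : B ⊗ A ⊗ L.omegaBar ⟶ Y,
      (B ⊗ A) ◁ L.comparison ≫ (α_ _ _ _).hom ≫ k =
        (α_ _ _ _).hom ≫ B ◁ A ◁ L.comparison ≫ k := fun k => by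
    rw [← Category.assoc, ← Category.assoc, associator_naturality_right]
  refine ⟨MonoidalClosed.curry ((α_ _ _ _).inv ≫ g), ?_, fun k hk => ?_⟩
  · dsimp only
    rw [← MonoidalClosed.curry_natural_left]
    apply MonoidalClosed.uncurry_injective
    rw [MonoidalClosed.uncurry_curry, ← cancel_epi (α_ _ _ _).hom, ← key,
      Iso.hom_inv_id_assoc, hg]
  · apply MonoidalClosed.uncurry_injective
    rw [MonoidalClosed.uncurry_curry, ← cancel_epi (α_ _ _ _).hom, Iso.hom_inv_id_assoc]
    refine hg' _ ?_
    rw [key, ← MonoidalClosed.uncurry_natural_left, hk]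

/-- If the lifting of `1` is complete, so is the lifting of a complete object with a retraction
of the unit, provided that partial elements are determined by their domain and by a total
element that extends them. -/
lemma Complete.wellComplete_of_algebra (h1 : L.WellComplete (𝟙_ E)) {X : E} (hX : L.Complete X)
    (α : L.obj X ⟶ X)
    (h : lift α (L.map (toUnit X)) ≫ L.str X (𝟙_ E) ≫ L.map (fst X (𝟙_ E)) = 𝟙 _) :
    L.WellComplete X :=
  (Complete.tensor hX h1).retract _ _ h

/-- A map into `X` is a total map into `L X`, and extends as such. The domain of the extension is
classified by a map into `L 1` which is total on `A × ω`; by uniqueness of extensions into `L 1` it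
is total on `A × ω̄`, so the extension factors through the unit. -/
lemma WellComplete.complete (h1 : L.WellComplete (𝟙_ E)) {X : E} (hX : L.WellComplete X)
    (hmono : Mono (L.ret X))
    (htotal : ∀ {B : E} (k : B ⟶ L.obj X), k ≫ L.map (toUnit X) = toUnit B ≫ L.ret (𝟙_ E) →
      ∃ k' : B ⟶ X, k' ≫ L.ret X = k) : L.Complete X := by
  intro A f
  obtain ⟨g, hg, hg'⟩ := hX A (f ≫ L.ret X)
  dsimp only at hg hg'
  -- Two extensions into `L 1` of the everywhere defined map are compared: the domain of `g`, and
  -- the constant one.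
  obtain ⟨k, rfl⟩ := htotal g ((h1 A (toUnit _ ≫ L.ret (𝟙_ E))).unique
    (by
      rw [← Category.assoc, hg, Category.assoc, L.ret_map, ← Category.assoc]
      congr 1
      exact toUnit_unique _ _)
    (by
      rw [← Category.assoc]
      congr 1
      exact toUnit_unique _ _))
  refine ⟨k, ?_, fun l hl => ?_⟩
  · dsimp only
    rw [← cancel_mono (L.ret X), Category.assoc, hg]
  · rw [← cancel_mono (L.ret X)]
    exact hg' _ (by rw [← hl, Category.assoc])

/-! ### Points of `ω` and `ω̄` -/

variable (L) in
/-- The point `⊥` of `Lⁿ⁺¹ 1`. -/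
def iterBot (n : ℕ) : 𝟙_ E ⟶ L.iter (n + 1) := L.bot (L.iter n)

variable (L) in
/-- The points of `Lⁿ 1`. -/
def iterPt : ∀ n : ℕ, ℕ∞ → (𝟙_ E ⟶ L.iter n)
  | 0, _ => 𝟙 _
  | n + 1, x => if x = 0 then L.iterBot n else iterPt n (x - 1) ≫ L.up n

lemma iterPt_zero (n : ℕ) : L.iterPt (n + 1) 0 = L.iterBot n := if_pos rfl

lemma iterPt_add_one (n : ℕ) (x : ℕ∞) : L.iterPt (n + 1) (x + 1) = L.iterPt n x ≫ L.up n := by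
  have h : (x + 1 : ℕ∞) ≠ 0 := by simp
  have h' : x + 1 - 1 = x := ENat.addLECancellable_of_ne_top (by simp) |>.add_tsub_cancel_right
  rw [iterPt, if_neg h, h']

lemma enat_cases {motive : ℕ∞ → Prop} (x : ℕ∞) (zero : motive 0) (add_one : ∀ y, motive (y + 1)) :
    motive x := by
  by_cases h : x = 0
  · exact h ▸ zero
  · have := add_one (x - 1)
    rwa [tsub_add_cancel_of_le (Order.one_le_iff_ne_zero.2 h)] at this

lemma iterPt_of_le : ∀ (n : ℕ) (x : ℕ∞), (n : ℕ∞) ≤ x → L.iterPt n x = L.top n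
  | 0, _, _ => rfl
  | n + 1, x, h => by
    induction x using enat_cases with
    | zero => simp at h
    | add_one y =>
      rw [iterPt_add_one, iterPt_of_le n y, top_succ]
      push_cast at h
      exact (ENat.add_le_add_iff_right (by simp)).1 h

lemma iterPt_proj : ∀ (n : ℕ) (x : ℕ∞), L.iterPt (n + 1) x ≫ L.proj n = L.iterPt n x
  | 0, _ => toUnit_unique _ _
  | n + 1, x => by
    induction x using enat_cases with
    | zero =>
      rw [iterPt_zero, iterPt_zero]
      exact L.bot_natural _
    | add_one y =>
      rw [iterPt_add_one, iterPt_add_one, Category.assoc, up_proj, ← Category.assoc,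
        iterPt_proj n]

/-- The bound is essential: an index above `n` is truncated to `n` before the inclusion but at most
to `n + 1` after it. -/
lemma iterPt_emb : ∀ (n k : ℕ), k ≤ n → L.iterPt n k ≫ L.emb n = L.iterPt (n + 1) k
  | 0, k, h => by
    obtain rfl : k = 0 := by omega
    exact (Category.id_comp _).trans (iterPt_zero 0).symm
  | n + 1, 0, _ => by
    rw [Nat.cast_zero, iterPt_zero, iterPt_zero]
    exact L.bot_natural _
  | n + 1, k + 1, h => by
    rw [Nat.cast_add, Nat.cast_one, iterPt_add_one, iterPt_add_one, Category.assoc, up_emb,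
      ← Category.assoc, iterPt_emb n k (by omega)]

lemma top_trunc : ∀ (n m : ℕ), L.top n ≫ L.trunc n m = L.iterPt m n
  | _, 0 => toUnit_unique _ _
  | 0, m + 1 => (Category.id_comp _).trans (iterPt_zero m).symm
  | n + 1, m + 1 => by
    rw [top_succ, Category.assoc, up_trunc, ← Category.assoc, top_trunc n m, Nat.cast_add,
      Nat.cast_one, iterPt_add_one]

variable (L) in
/-- The points of `ω`. -/
def omegaPt (n : ℕ) : 𝟙_ E ⟶ L.omega := L.top n ≫ L.omegaι n

variable (L) in
/-- The points of `ω̄`. -/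
def barPt (x : ℕ∞) : 𝟙_ E ⟶ L.omegaBar :=
  L.toOmegaBar (fun n => L.iterPt n x) fun n => iterPt_proj n x

lemma barPt_π (x : ℕ∞) (n : ℕ) : L.barPt x ≫ L.omegaBarπ n = L.iterPt n x :=
  L.toOmegaBar_π _ _ n

lemma barPt_top : L.barPt ⊤ = L.infty :=
  L.omegaBar_hom_ext fun n => by rw [barPt_π, infty_π, iterPt_of_le n ⊤ le_top]

lemma iterPt_omegaι {n k : ℕ} (h : k ≤ n) : L.iterPt n k ≫ L.omegaι n = L.omegaPt k := by
  induction n, h using Nat.le_induction with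
  | base => rw [iterPt_of_le k k le_rfl, omegaPt]
  | succ n h ih => rw [← iterPt_emb n k h, Category.assoc, emb_omegaι, ih]

lemma omegaPt_comparison (n : ℕ) : L.omegaPt n ≫ L.comparison = L.barPt n :=
  L.omegaBar_hom_ext fun m => by
    rw [barPt_π, omegaPt, Category.assoc, Category.assoc, omegaι_comparison_π, top_trunc]

/-- The composite `ω̄ ⟶ Lⁿ 1 ⟶ ω` acts on points as `x ↦ min x n`. These maps back to `ω` allow a
map on `ω` to be evaluated approximately on `ω̄`, and are the source of all extensions below. -/
lemma barPt_π_omegaι (x : ℕ∞) (n : ℕ) :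
    ∃ k : ℕ, (k : ℕ∞) = min x n ∧ L.barPt x ≫ L.omegaBarπ n ≫ L.omegaι n = L.omegaPt k := by
  rw [← Category.assoc, barPt_π]
  rcases le_total x n with h | h
  · lift x to ℕ using ne_top_of_le_ne_top (by simp) h
    exact ⟨x, (min_eq_left h).symm, iterPt_omegaι (by exact_mod_cast h)⟩
  · exact ⟨n, (min_eq_right h).symm, by rw [iterPt_of_le n x h, omegaPt]⟩

lemma barPt_succ (x : ℕ∞) : L.barPt x ≫ L.omegaBarSucc = L.barPt (x + 1) :=
  L.omegaBar_hom_ext fun n => by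
    cases n with
    | zero => exact toUnit_unique _ _
    | succ n =>
      rw [Category.assoc, omegaBarSucc_π, ← Category.assoc, barPt_π, barPt_π, iterPt_add_one]

end PointedStrongMonad

end Completeness

end SheafPCF

namespace SheafPCF

-- Categories described by points and plots.

noncomputable section Plots

/-- A map out of the coproduct that sends only the index `n` to `x`, and all others to `y`,
separates the coprojections. -/
lemma natPt_injective_of_ne {E : Type u₁} [Category.{v₁} E] [CartesianMonoidalCategory E]
    [HasCoproduct (fun _ : ℕ => 𝟙_ E)] {X : E} {x y : 𝟙_ E ⟶ X} (h : x ≠ y) :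
    Function.Injective (natPt E) := by
  intro m n hmn
  by_contra hne
  have h' := congrArg (· ≫ Sigma.desc fun k : ℕ => if k = n then x else y) hmn
  simp only [natPt, Sigma.ι_desc, if_neg hne, if_true] at h'
  exact h h'.symm

/-- A description of the category `E` and of its monad `L` in terms of points and plots: a plot of
`X` over `c` is a function from the points of `c` to the points of `X` which is induced by an
element of `X` over `c`. An object is concrete if morphisms into it are the functions on
points that preserve the plots. -/
structure PlotModel {D : Type u} [SmallCategory D] {S : ConcreteSite D} (A : AdmissibleMonos S)
    {E : Type u₁} [Category.{v₁} E] [CartesianMonoidalCategory E]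
    [HasCoproduct (fun _ : ℕ => 𝟙_ E)] [HasColimitsOfShape ℕ E] [HasLimitsOfShape ℕᵒᵖ E]
    (L : PointedStrongMonad E) where
  plots (X : E) (c : D) : Set ((S.star ⟶ c) → (𝟙_ E ⟶ X))
  const_mem {X : E} (c : D) (x : 𝟙_ E ⟶ X) : (fun _ => x) ∈ plots X c
  pre_mem {X : E} {c d : D} (h : d ⟶ c) (g : (S.star ⟶ c) → (𝟙_ E ⟶ X)) (hg : g ∈ plots X c) :
    (fun p => g (p ≫ h)) ∈ plots X d
  comp_mem {X Y : E} (f : X ⟶ Y) {c : D} (g : (S.star ⟶ c) → (𝟙_ E ⟶ X)) (hg : g ∈ plots X c) :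
    (fun p => g p ≫ f) ∈ plots Y c
  lift_mem {X Y : E} {c : D} (g : (S.star ⟶ c) → (𝟙_ E ⟶ X)) (hg : g ∈ plots X c)
    (k : (S.star ⟶ c) → (𝟙_ E ⟶ Y)) (hk : k ∈ plots Y c) :
    (fun p => lift (g p) (k p)) ∈ plots (X ⊗ Y) c
  omegaBar_mem {c : D} (g : (S.star ⟶ c) → (𝟙_ E ⟶ L.omegaBar))
    (hg : ∀ n, (fun p => g p ≫ L.omegaBarπ n) ∈ plots (L.iter n) c) : g ∈ plots L.omegaBar c
  -- This is the link between the monad and the admissible monos: a plot of `L X` is a plot of `X`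
  -- on a subobject, continued by `⊥`.
  lift_mem_iff {X : E} {c : D} (g : (S.star ⟶ c) → (𝟙_ E ⟶ L.obj X)) :
    g ∈ plots (L.obj X) c ↔ ∃ (d : D) (m : d ⟶ c), A.mem m ∧
      (∀ p, ¬ FactorsVia p m → g p = L.bot X) ∧
      ∃ r ∈ plots X d, ∀ q, g (q ≫ m) = r q ≫ L.ret X
  pt_lift {X : E} (p : 𝟙_ E ⟶ L.obj X) : p = L.bot X ∨ ∃ x, p = x ≫ L.ret X
  ret_ne_bot {X : E} (x : 𝟙_ E ⟶ X) : x ≫ L.ret X ≠ L.bot X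
  mono_ret (X : E) : Mono (L.ret X)
  bot_join (X : E) : L.bot (L.obj X) ≫ L.join X = L.bot X
  -- A partial map with full domain is a map; no concreteness of `X` is assumed, since it is applied
  -- to function types as well.
  total {X B : E} (k : B ⟶ L.obj X) (hk : k ≫ L.map (toUnit X) = toUnit B ≫ L.ret (𝟙_ E)) :
    ∃ k' : B ⟶ X, k' ≫ L.ret X = k
  -- A partial element is recovered from its domain and from a total element extending it, here the
  -- one given by `α`.
  restrict {X : E} (α : L.obj X ⟶ X) (hα : L.ret X ≫ α = 𝟙 X) :
    lift α (L.map (toUnit X)) ≫ L.str X (𝟙_ E) ≫ L.map (fst X (𝟙_ E)) = 𝟙 _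
  omega_pt (p : 𝟙_ E ⟶ L.omega) : ∃ n q, p = q ≫ L.omegaι n
  -- Only ground types and liftings of concrete objects are ever required to be concrete; what is
  -- used of function types holds for all objects.
  Concrete : E → Prop
  concrete_unit : Concrete (𝟙_ E)
  concrete_nat : Concrete (natObj E)
  nat_local {c : D} (g : (S.star ⟶ c) → (𝟙_ E ⟶ natObj E)) (hg : g ∈ plots (natObj E) c) :
    ∃ R ∈ S.cov c, ∀ ⦃d : D⦄ (f : d ⟶ c), R f → ∃ n, ∀ p, g (p ≫ f) = natPt E n
  concrete_lift {X : E} (hX : Concrete X) : Concrete (L.obj X)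
  hom_ext {X B : E} (hX : Concrete X) {f g : B ⟶ X} (h : ∀ b : 𝟙_ E ⟶ B, b ≫ f = b ≫ g) : f = g
  exists_hom {X B : E} (hX : Concrete X) (φ : (𝟙_ E ⟶ B) → (𝟙_ E ⟶ X))
    (h : ∀ (c : D), ∀ g ∈ plots B c, (fun p => φ (g p)) ∈ plots X c) :
    ∃ f : B ⟶ X, ∀ b, b ≫ f = φ b
  glue {X : E} (hX : Concrete X) {c : D} (g : (S.star ⟶ c) → (𝟙_ E ⟶ X)) (R : Presieve c)
    (hR : R ∈ S.cov c) (h : ∀ ⦃d : D⦄ (f : d ⟶ c), R f → (fun p => g (p ≫ f)) ∈ plots X d) :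
    g ∈ plots X c

namespace PlotModel

open PointedStrongMonad

section Points

variable {D : Type u} [SmallCategory D] {S : ConcreteSite D} {A : AdmissibleMonos S}
  {E : Type u₁} [Category.{v₁} E] [CartesianMonoidalCategory E]
  [HasCoproduct (fun _ : ℕ => 𝟙_ E)] [HasColimitsOfShape ℕ E] [HasLimitsOfShape ℕᵒᵖ E]
  {L : PointedStrongMonad E}

lemma ret_injective (P : PlotModel A L) {X : E} {x y : 𝟙_ E ⟶ X}
    (h : x ≫ L.ret X = y ≫ L.ret X) : x = y := by
  have := P.mono_ret X
  exact (cancel_mono _).1 h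

lemma exists_iterPt (P : PlotModel A L) : ∀ (n : ℕ) (p : 𝟙_ E ⟶ L.iter n),
    ∃ k : ℕ, k ≤ n ∧ p = L.iterPt n k
  | 0, p => ⟨0, le_rfl, toUnit_unique _ _⟩
  | n + 1, p => by
    rcases P.pt_lift (X := L.iter n) p with h | ⟨x, h⟩
    · exact ⟨0, by omega, h.trans (iterPt_zero n).symm⟩
    · obtain ⟨k, hk, rfl⟩ := exists_iterPt P n x
      refine ⟨k + 1, by omega, h.trans ?_⟩
      rw [Nat.cast_add, Nat.cast_one, iterPt_add_one]
      rfl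

lemma iterPt_injective (P : PlotModel A L) :
    ∀ {n j k : ℕ}, j ≤ n → k ≤ n → L.iterPt n j = L.iterPt n k → j = k
  | 0, j, k, hj, hk, _ => by omega
  | n + 1, 0, 0, _, _, _ => rfl
  | n + 1, j + 1, 0, _, _, h => by
    rw [Nat.cast_add, Nat.cast_one, iterPt_add_one, Nat.cast_zero, iterPt_zero] at h
    exact (P.ret_ne_bot _ h).elim
  | n + 1, 0, k + 1, _, _, h => by
    rw [Nat.cast_add, Nat.cast_one, iterPt_add_one, Nat.cast_zero, iterPt_zero] at h
    exact (P.ret_ne_bot _ h.symm).elim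
  | n + 1, j + 1, k + 1, hj, hk, h => by
    rw [Nat.cast_add, Nat.cast_one, iterPt_add_one, Nat.cast_add, Nat.cast_one,
      iterPt_add_one] at h
    rw [iterPt_injective P (by omega) (by omega) (P.ret_injective h)]

lemma exists_omegaPt (P : PlotModel A L) (p : 𝟙_ E ⟶ L.omega) : ∃ n, p = L.omegaPt n := by
  obtain ⟨n, q, rfl⟩ := P.omega_pt p
  obtain ⟨k, hk, rfl⟩ := P.exists_iterPt n q
  exact ⟨k, iterPt_omegaι hk⟩

/-- A point of the limit is a compatible sequence of indices `k n ≤ n`. Either every entry is the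
maximal one, which gives `∞`, or the sequence is constant from the first known drop on, and that
constant is the point. -/
lemma exists_barPt (P : PlotModel A L) (p : 𝟙_ E ⟶ L.omegaBar) : ∃ x, p = L.barPt x := by
  choose k hk hp using fun n => P.exists_iterPt n (p ≫ L.omegaBarπ n)
  have hproj : ∀ n, L.iterPt n (k (n + 1)) = L.iterPt n (k n) := fun n => by
    rw [← iterPt_proj, ← hp, ← hp, Category.assoc, omegaBarπ_proj]
  by_cases h : ∀ n, k n = n
  · refine ⟨⊤, L.omegaBar_hom_ext fun n => ?_⟩
    rw [barPt_π, hp, h, iterPt_of_le _ _ le_rfl, iterPt_of_le _ _ le_top]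
  · push Not at h
    obtain ⟨N, hN⟩ := h
    have hN' : k N < N := lt_of_le_of_ne (hk N) hN
    have hge : ∀ n, N ≤ n → k n = k N := fun n hn => by
      induction n, hn using Nat.le_induction with
      | base => rfl
      | succ n hn ih =>
        have h₁ := hproj n
        rw [ih] at h₁
        -- If the next entry were maximal, it would project to the top of `Lⁿ 1`, so entry `n` would
        -- be `n`, whereas it is smaller than `N ≤ n`.
        rcases Nat.lt_or_ge n (k (n + 1)) with h₂ | h₂
        · rw [iterPt_of_le n _ (by exact_mod_cast h₂.le),
            ← iterPt_of_le n (n : ℕ∞) le_rfl] at h₁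
          have := P.iterPt_injective le_rfl (by omega) h₁
          omega
        · exact P.iterPt_injective h₂ (by omega) h₁
    have hle : ∀ i n, n + i = N → L.iterPt n (k n) = L.iterPt n (k N) := fun i => by
      induction i with
      | zero => rintro n rfl; rfl
      | succ i ih =>
        intro n hn
        rw [← hproj, ← iterPt_proj, ← iterPt_proj n (k N : ℕ∞), ih (n + 1) (by omega)]
    refine ⟨k N, L.omegaBar_hom_ext fun n => ?_⟩
    rw [barPt_π, hp]
    rcases le_total N n with h | h
    · rw [hge n h]
    · exact hle (N - n) n (by omega)

lemma exists_lift {X Y : E} (p : 𝟙_ E ⟶ X ⊗ Y) : ∃ x y, p = lift x y :=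
  ⟨p ≫ fst _ _, p ≫ snd _ _, by ext <;> simp⟩

lemma natPt_injective (P : PlotModel A L) : Function.Injective (natPt E) :=
  natPt_injective_of_ne fun h => P.ret_ne_bot (𝟙 (𝟙_ E)) ((Category.id_comp _).trans h)

end Points

-- Paths along `V`, and completeness of liftings.

section Vertical

variable {C : Type u} [SmallCategory C] {S : ConcreteSite C} {A : AdmissibleMonos S}
  {E : Type u₁} [Category.{v₁} E] [CartesianMonoidalCategory E]
  [HasCoproduct (fun _ : ℕ => 𝟙_ E)] [HasColimitsOfShape ℕ E] [HasLimitsOfShape ℕᵒᵖ E]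
  {L : PointedStrongMonad E}
  (P : PlotModel (WithV.admissible A) L)

/-- The point of `⋆ ⟶ V` given by an element of `ℕ∞`. -/
def vPt (x : ℕ∞) : (WithV.site S).star ⟶ WithV.V := WithV.ofPt (⟨x⟩ : WithV.Pt S WithV.V)

/-- The element of `ℕ∞` given by a point of `V`. -/
def vVal (p : (WithV.site S).star ⟶ WithV.V) : ℕ∞ := (p.1 (WithV.pt₀ S)).down

lemma vVal_vPt (x : ℕ∞) : vVal (vPt x : (WithV.site S).star ⟶ WithV.V) = x := rfl

lemma vPt_vVal (p : (WithV.site S).star ⟶ WithV.V) : vPt (vVal p) = p := WithV.ofPt_val p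

variable (S) in
/-- The successor map on `V`. -/
def vSucc : (WithV.V : WithV S) ⟶ WithV.V := ⟨fun x => ⟨x.down + 1⟩, ωcont_add 1⟩

lemma vVal_comp_vSucc (p : (WithV.site S).star ⟶ WithV.V) : vVal (p ≫ vSucc S) = vVal p + 1 := rfl

/-- The successor of `V` is an admissible mono that misses only the point `0`. So a path on `V` in
`Lⁿ 1`, delayed by one step and started at `⊥`, is a path in `Lⁿ⁺¹ 1`. -/
lemma iterPt_mem : ∀ n, (fun p => L.iterPt n (vVal p)) ∈ P.plots (L.iter n) WithV.V
  | 0 => P.const_mem _ _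
  | n + 1 => by
    refine (P.lift_mem_iff (X := L.iter n) _).2 ⟨WithV.V, vSucc S, ⟨1, fun _ => rfl⟩,
      fun p hp => ?_, _, iterPt_mem n, fun q => iterPt_add_one n (vVal q)⟩
    have h0 : vVal p = 0 := by
      by_contra h
      refine hp ⟨vPt (vVal p - 1), ?_⟩
      rw [← vPt_vVal (_ ≫ _), vVal_comp_vSucc, vVal_vPt,
        tsub_add_cancel_of_le (Order.one_le_iff_ne_zero.2 h), vPt_vVal]
    rw [h0]
    exact iterPt_zero n

/-- The path through all the points of `ω̄`, ending at `∞`: composing with it reduces questions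
about maps on `ω̄` to the subobjects of `V`. -/
lemma barPt_mem : (fun p => L.barPt (vVal p)) ∈ P.plots L.omegaBar WithV.V :=
  P.omegaBar_mem _ fun n => by
    simp only [barPt_π]
    exact P.iterPt_mem n

/-- The plots over `V` of the lifting of an object with only constant plots over `V`. -/
lemma lift_V {Z : E} (hZ : ∀ r ∈ P.plots Z WithV.V, ∃ z, ∀ p, r p = z)
    {g : ((WithV.site S).star ⟶ WithV.V) → (𝟙_ E ⟶ L.obj Z)}
    (hg : g ∈ P.plots (L.obj Z) WithV.V) :
    (∀ x, g (vPt x) = L.bot Z) ∨ ∃ (k : ℕ) (z : 𝟙_ E ⟶ Z),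
      ∀ x, ((k : ℕ∞) ≤ x → g (vPt x) = z ≫ L.ret Z) ∧ (¬ (k : ℕ∞) ≤ x → g (vPt x) = L.bot Z) := by
  obtain ⟨d, m, hm, h, r, hr, hgr⟩ := (P.lift_mem_iff g).1 hg
  match d, m, hm with
  | .base c, m, hm =>
    -- An admissible mono from an object of `C` to `V` has no points in its domain, so the partial
    -- map is nowhere defined.
    refine Or.inl fun x => h _ fun hx => ?_
    obtain ⟨p, -⟩ := (WithV.factorsVia_pt m (vPt x)).1 hx
    exact IsEmpty.false (self := hm) p
  | .V, m, ⟨k, hk⟩ =>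
    -- The mono is `x ↦ x + k`, whose image consists of the points from the finite stage `k` on;
    -- there the value is constant.
    obtain ⟨z, hz⟩ := hZ r hr
    have key : ∀ x, FactorsVia (vPt x) m ↔ (k : ℕ∞) ≤ x := fun x => by
      refine (WithV.factorsVia_pt m (vPt x)).trans ?_
      rw [WithV.im_shift m k hk]
      rfl
    refine Or.inr ⟨k, z, fun x => ⟨fun hx => ?_, fun hx => h _ fun hx' => hx ((key x).1 hx')⟩⟩
    obtain ⟨q, hq⟩ := (key x).2 hx
    rw [← hq, hgr, hz]

section Discrete

variable {Z : E} {g : ((WithV.site S).star ⟶ WithV.V) → (𝟙_ E ⟶ L.obj Z)}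

lemma lift_V_mono (hZ : ∀ r ∈ P.plots Z WithV.V, ∃ z, ∀ p, r p = z)
    (hg : g ∈ P.plots (L.obj Z) WithV.V) {x y : ℕ∞} (hxy : x ≤ y)
    {z : 𝟙_ E ⟶ Z} (hz : g (vPt x) = z ≫ L.ret Z) : g (vPt y) = z ≫ L.ret Z := by
  rcases P.lift_V hZ hg with h | ⟨k, z', h⟩
  · rw [h] at hz
    exact (P.ret_ne_bot z hz.symm).elim
  · by_cases hk : (k : ℕ∞) ≤ x
    · rw [(h y).1 (hk.trans hxy), ← (h x).1 hk, hz]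
    · rw [(h x).2 hk] at hz
      exact (P.ret_ne_bot z hz.symm).elim

/-- The threshold of the domain is a finite number, so `∞` is never isolated: the value there is
already attained at finite stages. Both the uniqueness of extensions and adequacy depend on this. -/
lemma lift_V_top (hZ : ∀ r ∈ P.plots Z WithV.V, ∃ z, ∀ p, r p = z)
    (hg : g ∈ P.plots (L.obj Z) WithV.V) : ∃ N : ℕ, ∀ n : ℕ, N ≤ n →
      g (vPt n) = g (vPt ⊤) := by
  rcases P.lift_V hZ hg with h | ⟨k, z, h⟩
  · exact ⟨0, fun n _ => by rw [h, h]⟩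
  · exact ⟨k, fun n hn => by rw [(h n).1 (by exact_mod_cast hn), (h ⊤).1 le_top]⟩

/-- The lifting of a concrete object with only constant plots over `V` is complete. -/
theorem complete_lift (hc : P.Concrete Z) (hZ : ∀ r ∈ P.plots Z WithV.V, ∃ z, ∀ p, r p = z) :
    L.WellComplete Z := by
  classical
  intro B f
  have hcL := P.concrete_lift hc
  let F : (𝟙_ E ⟶ B) → ℕ → (𝟙_ E ⟶ L.obj Z) := fun a k => lift a (L.omegaPt k) ≫ f
  -- The path `x ↦ min x k'` from `V` to `ω` joins `k` to `k'`, and a partial map along it keeps its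
  -- value once defined.
  have F_mono : ∀ {a k k' z}, k ≤ k' → F a k = z ≫ L.ret Z → F a k' = z ≫ L.ret Z := by
    intro a k k' z hk hz
    have hg := P.comp_mem f _ (P.lift_mem _ (P.const_mem _ a) _
      (P.comp_mem (L.omegaι k') _ (P.iterPt_mem k')))
    have := P.lift_V_mono hZ hg (x := k) (y := k') (by exact_mod_cast hk) (z := z) (by
      simp only [vVal_vPt]
      rw [iterPt_omegaι hk]
      exact hz)
    simp only [vVal_vPt] at this
    rwa [iterPt_omegaι le_rfl] at this
  -- The `n`-th approximation of the extension, `(a, x) ↦ f (a, min x n)`.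
  let e : ℕ → (B ⊗ L.omegaBar ⟶ L.obj Z) := fun n => B ◁ (L.omegaBarπ n ≫ L.omegaι n) ≫ f
  have he : ∀ a (x : ℕ∞) (n : ℕ), ∃ k : ℕ,
      (k : ℕ∞) = min x n ∧ lift a (L.barPt x) ≫ e n = F a k := by
    intro a x n
    obtain ⟨k, hk, h⟩ := barPt_π_omegaι (L := L) x n
    refine ⟨k, hk, ?_⟩
    dsimp only [e, F]
    rw [← Category.assoc, lift_whiskerLeft, h]
  have e_mono : ∀ {b : 𝟙_ E ⟶ B ⊗ L.omegaBar} {n n' z}, n ≤ n' →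
      b ≫ e n = z ≫ L.ret Z → b ≫ e n' = z ≫ L.ret Z := by
    intro b n n' z hn hz
    obtain ⟨a, y, rfl⟩ := exists_lift b
    obtain ⟨x, rfl⟩ := P.exists_barPt y
    obtain ⟨k, hk, h⟩ := he a x n
    obtain ⟨k', hk', h'⟩ := he a x n'
    rw [h']
    refine F_mono (k := k) ?_ (h ▸ hz)
    have : (k : ℕ∞) ≤ k' := by
      rw [hk, hk']
      exact min_le_min le_rfl (by exact_mod_cast hn)
    exact_mod_cast this
  -- The union of the partial maps `e n`. By `e_mono` the chosen value does not depend on the stage.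
  let ext : (𝟙_ E ⟶ B ⊗ L.omegaBar) → (𝟙_ E ⟶ L.obj Z) := fun b =>
    if h : ∃ z n, b ≫ e n = z ≫ L.ret Z then h.choose ≫ L.ret Z else L.bot Z
  have ext_some : ∀ {b n z}, b ≫ e n = z ≫ L.ret Z → ext b = z ≫ L.ret Z := by
    intro b n z hz
    have h : ∃ z n, b ≫ e n = z ≫ L.ret Z := ⟨z, n, hz⟩
    refine (dif_pos h).trans ?_
    obtain ⟨n', hn'⟩ := h.choose_spec
    rw [← e_mono (le_max_left n n') hz, ← e_mono (le_max_right n n') hn']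
  have ext_none : ∀ {b : 𝟙_ E ⟶ B ⊗ L.omegaBar}, (∀ n, b ≫ e n = L.bot Z) → ext b = L.bot Z := by
    intro b h
    refine dif_neg ?_
    rintro ⟨z, n, hz⟩
    rw [h] at hz
    exact P.ret_ne_bot z hz.symm
  have ext_mem : ∀ c, ∀ g ∈ P.plots (B ⊗ L.omegaBar) c,
      (fun p => ext (g p)) ∈ P.plots (L.obj Z) c := by
    intro c g hg
    choose d m hm hbot r hr hgr using fun n => (P.lift_mem_iff _).1 (P.comp_mem (e n) g hg)
    have hfac : ∀ n p, FactorsVia p (m n) ↔ ∃ z, g p ≫ e n = z ≫ L.ret Z := by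
      intro n p
      constructor
      · rintro ⟨q, rfl⟩
        exact ⟨_, hgr n q⟩
      · rintro ⟨z, hz⟩
        by_contra h
        rw [hbot n p h] at hz
        exact P.ret_ne_bot z hz.symm
    have hm' : ∀ n, FactorsVia (m n) (m (n + 1)) := fun n =>
      (WithV.admissible A).reflect _ _ (hm n) (hm (n + 1)) fun p hp => by
        rw [hfac] at hp ⊢
        obtain ⟨z, hz⟩ := hp
        exact ⟨z, e_mono (Nat.le_succ n) hz⟩
    -- The domain of `ext` along the plot is the increasing union of the domains of the stages,
    -- hence again admissible.
    obtain ⟨d', m', hm₁, hsup⟩ := (WithV.admissible A).sup d m hm hm'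
    obtain ⟨R, hR, hcov⟩ := (WithV.admissible A).chain_cover d m hm hm' m' hm₁ hsup
    have hval : ∀ q : (WithV.site S).star ⟶ d', ∃ z, ext (g (q ≫ m')) = z ≫ L.ret Z := by
      intro q
      obtain ⟨n, hn⟩ := (hsup _).1 ⟨q, rfl⟩
      obtain ⟨z, hz⟩ := (hfac n _).1 hn
      exact ⟨z, ext_some hz⟩
    choose r' hr' using hval
    refine (P.lift_mem_iff _).2 ⟨d', m', hm₁, fun p hp => ext_none fun n => ?_, r', ?_, hr'⟩
    · exact hbot n p fun h => hp ((hsup p).2 ⟨n, h⟩)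
    -- On each member of the covering family of the union the points lie in the domain of a single
    -- stage `e n`, so the values form a plot there; concreteness of `Z` glues them.
    · refine P.glue hc r' R hR fun a j hj => ?_
      obtain ⟨n, l, hl⟩ := hcov j hj
      have h₁ : (fun p => r' (p ≫ j)) = fun p => r n (p ≫ l) := by
        funext p
        apply P.ret_injective
        rw [← hr', ← hgr n (p ≫ l)]
        have h₂ : (p ≫ j) ≫ m' = (p ≫ l) ≫ m n := by
          rw [Category.assoc, ← hl, Category.assoc]
        rw [h₂]
        exact (ext_some (hgr n (p ≫ l))).trans (hgr n (p ≫ l)).symm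
      rw [h₁]
      exact P.pre_mem l _ (hr n)
  obtain ⟨k, hk⟩ := P.exists_hom hcL ext ext_mem
  have hfin : ∀ a (j : ℕ), lift a (L.barPt j) ≫ k = F a j := by
    intro a j
    rw [hk]
    rcases P.pt_lift (F a j) with h | ⟨z, h⟩
    · rw [h]
      refine ext_none fun n => ?_
      obtain ⟨i, hi, h'⟩ := he a j n
      rw [h']
      rcases P.pt_lift (F a i) with h'' | ⟨z, h''⟩
      · exact h''
      · have hij : (i : ℕ∞) ≤ j := hi ▸ min_le_left _ _
        rw [F_mono (by exact_mod_cast hij) h''] at h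
        exact (P.ret_ne_bot z h).elim
    · rw [h]
      refine ext_some (n := j) ?_
      obtain ⟨i, hi, h'⟩ := he a j j
      rw [min_self] at hi
      rw [h', ← h]
      congr 1
      exact_mod_cast hi
  refine ⟨k, P.hom_ext hcL fun b => ?_, fun k' hk' => P.hom_ext hcL fun b => ?_⟩
  · obtain ⟨a, y, rfl⟩ := exists_lift b
    obtain ⟨j, rfl⟩ := P.exists_omegaPt y
    rw [← Category.assoc, lift_whiskerLeft, omegaPt_comparison, hfin]
  · obtain ⟨a, y, rfl⟩ := exists_lift b
    obtain ⟨x, rfl⟩ := P.exists_barPt y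
    have hfin' : ∀ j : ℕ, lift a (L.barPt j) ≫ k' = lift a (L.barPt j) ≫ k := fun j => by
      rw [hfin, ← omegaPt_comparison, ← lift_whiskerLeft, Category.assoc]
      exact congrArg _ hk'
    have hmem : ∀ l : B ⊗ L.omegaBar ⟶ L.obj Z,
        (fun p => lift a (L.barPt (vVal p)) ≫ l) ∈ P.plots (L.obj Z) WithV.V := fun l =>
      P.comp_mem l _ (P.lift_mem _ (P.const_mem _ a) _ P.barPt_mem)
    -- Finite points come from `ω`, where both maps are `f`. At `∞` each map takes the value it has
    -- at all large finite stages, so it suffices to compare at one stage beyond both thresholds.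
    by_cases hx : x = ⊤
    · subst hx
      obtain ⟨N, hN⟩ := P.lift_V_top hZ (hmem k)
      obtain ⟨N', hN'⟩ := P.lift_V_top hZ (hmem k')
      have h₁ := hN (max N N') (le_max_left _ _)
      have h₂ := hN' (max N N') (le_max_right _ _)
      simp only [vVal_vPt] at h₁ h₂
      rw [← h₁, ← h₂, hfin']
    · lift x to ℕ using hx
      exact hfin' x

end Discrete

end Vertical

end PlotModel

end Plots

end SheafPCF

namespace SheafPCF

-- The logical relation and computational adequacy.

noncomputable section Adequacy

namespace PointedStrongMonad

variable {E : Type u₁} [Category.{v₁} E] [CartesianMonoidalCategory E]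
  {L : PointedStrongMonad E} [HasColimitsOfShape ℕ E] [HasLimitsOfShape ℕᵒᵖ E]

lemma bot_bind {Γ X Y : E} (hL : L.bot (L.obj Y) ≫ L.join Y = L.bot Y) (p : Γ ⟶ 𝟙_ E)
    (k : X ⊗ Γ ⟶ L.obj Y) : L.bind (p ≫ L.bot X) k = p ≫ L.bot Y := by
  rw [bind, ← Category.assoc]
  have h := L.lift_bot_str (X := Γ) (Y := X) (𝟙 _) p
  rw [h, Category.assoc, ← Category.assoc (L.bot _), L.bot_natural, hL]

/-- The algebra structure of `A ⇒ L B` is pointwise, so its bottom diverges at every argument. -/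
lemma evalAt_bot_algebra [MonoidalClosed E] {A B : E}
    (hL : L.bot (L.obj B) ≫ L.join B = L.bot B) (a : 𝟙_ E ⟶ A) :
    evalAt a (L.bot _ ≫ L.algebra A B) = L.bot B := by
  rw [algebra_def, evalAt_curry]
  have h := L.lift_bot_str (Y := (ihom A).obj (L.obj B)) a (𝟙 (𝟙_ E))
  rw [Category.id_comp, Category.id_comp] at h
  rw [← Category.assoc, h, ← Category.assoc, L.bot_natural]
  exact hL

variable (L) in
/-- Addition of `n` on `ω̄`. -/
def omegaBarAdd : ℕ → (L.omegaBar ⟶ L.omegaBar)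
  | 0 => 𝟙 _
  | n + 1 => omegaBarAdd n ≫ L.omegaBarSucc

lemma barPt_add (x : ℕ∞) : ∀ n, L.barPt x ≫ L.omegaBarAdd n = L.barPt (x + n)
  | 0 => by rw [Nat.cast_zero, add_zero]; exact Category.comp_id _
  | n + 1 => by
    rw [omegaBarAdd, ← Category.assoc, barPt_add x n, barPt_succ, add_assoc, Nat.cast_add,
      Nat.cast_one]

lemma lift_comp_whiskerLeft {Γ A B : E} (x : 𝟙_ E ⟶ A) (m : 𝟙_ E ⟶ Γ) (k : A ⊗ Γ ⟶ B) :
    lift x (𝟙 _) ≫ A ◁ m ≫ k = lift x m ≫ k := by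
  rw [← Category.assoc, lift_whiskerLeft, Category.id_comp]

/-- The iterates of a parametrized endomorphism of `A ⇒ L B`, as a map on `ω̄`. -/
lemma exists_iterates [MonoidalClosed E] {Γ A B : E}
    (hc : L.Complete ((ihom A).obj (L.obj B))) (m : 𝟙_ E ⟶ Γ)
    (b : Γ ⊗ (ihom A).obj (L.obj B) ⟶ (ihom A).obj (L.obj B)) :
    ∃ h : L.omegaBar ⟶ (ihom A).obj (L.obj B),
      L.barPt (0 : ℕ) ≫ h = L.bot _ ≫ L.algebra A B ∧
      (∀ n : ℕ, L.barPt (n + 1 : ℕ) ≫ h = lift m (L.barPt n ≫ h) ≫ b) ∧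
      L.infty ≫ h = m ≫ L.fix b := by
  -- Restricting the parameters to the point `m` makes the context terminal, so the extension
  -- becomes a map on `ω̄` alone; naturality of `fix` compares the values at `∞`.
  let g : 𝟙_ E ⊗ (ihom A).obj (L.obj B) ⟶ (ihom A).obj (L.obj B) := m ▷ _ ≫ b
  have h_lift : ∀ x : 𝟙_ E ⟶ L.omegaBar, x ≫ lift (toUnit _) (𝟙 _) = lift (𝟙 _) x := fun x => by
    rw [comp_lift, Category.comp_id, toUnit_unique (x ≫ toUnit _) (𝟙 _)]
  refine ⟨lift (toUnit _) (𝟙 _) ≫ L.fixExt hc g, ?_, fun n => ?_, ?_⟩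
  · have h₁ : L.barPt (0 : ℕ) = L.omegaι 0 ≫ L.comparison := by
      rw [← omegaPt_comparison, omegaPt, Category.assoc]
      exact Category.id_comp _
    rw [← Category.assoc, h_lift, h₁]
    have h₂ : lift (𝟙 (𝟙_ E)) (L.omegaι 0 ≫ L.comparison) =
        lift (𝟙 _) (𝟙 (𝟙_ E)) ≫ 𝟙_ E ◁ (L.omegaι 0 ≫ L.comparison) := by
      rw [lift_whiskerLeft]
      exact congrArg _ (Category.id_comp _).symm
    refine (congrArg (· ≫ L.fixExt hc g) h₂).trans ((Category.assoc _ _ _).trans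
      ((congrArg _ (L.omegaι_fixExt hc g 0)).trans ?_))
    change lift (𝟙 _) (𝟙 (𝟙_ E)) ≫ toUnit _ ≫ L.bot _ ≫ L.algebra A B = _
    rw [← toUnit_comp_eq, toUnit_unit_comp]
  · rw [← Category.assoc, ← Category.assoc, h_lift, h_lift, Nat.cast_add, Nat.cast_one,
      ← barPt_succ]
    have h₂ : lift (𝟙 (𝟙_ E)) (L.barPt n ≫ L.omegaBarSucc) =
        lift (𝟙 _) (L.barPt n) ≫ 𝟙_ E ◁ L.omegaBarSucc := (lift_whiskerLeft _ _ _).symm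
    rw [h₂, Category.assoc, L.succ_fixExt hc g]
    dsimp only [g]
    rw [← Category.assoc, ← Category.assoc, comp_lift, lift_whiskerRight, lift_fst,
      Category.id_comp]
  · rw [L.fix_natural hc, L.fix_eq_fixExt hc, ← Category.assoc, h_lift, toUnit_unit_comp]

end PointedStrongMonad

open PointedStrongMonad

namespace PlotModel

variable {C : Type u} [SmallCategory C] {S : ConcreteSite C} {A : AdmissibleMonos S}
  {E : Type u₁} [Category.{v₁} E] [CartesianMonoidalCategory E] [MonoidalClosed E]
  [HasCoproduct (fun _ : ℕ => 𝟙_ E)] [HasColimitsOfShape ℕ E] [HasLimitsOfShape ℕᵒᵖ E]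
  {L : PointedStrongMonad E} {Sg : Signature.{u, v, w}} {I : SigInterp L Sg}

lemma wellComplete_unit (P : PlotModel (WithV.admissible A) L) : L.WellComplete (𝟙_ E) :=
  P.complete_lift P.concrete_unit fun _ _ => ⟨𝟙 _, fun _ => toUnit_unique _ _⟩

/-- Plots of `1 + 1 + ⋯` are locally constant, and `V` has no covering family except its identity,
so over `V` they are constant. -/
lemma wellComplete_nat (P : PlotModel (WithV.admissible A) L) : L.WellComplete (natObj E) := by
  refine P.complete_lift P.concrete_nat fun r hr => ?_
  obtain ⟨R, hR, h⟩ := P.nat_local r hr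
  obtain rfl : R = Presieve.singleton (𝟙 (WithV.V : WithV S)) := hR
  obtain ⟨n, hn⟩ := h _ (Presieve.singleton_self _)
  exact ⟨_, fun p => (congrArg r (Category.comp_id p).symm).trans (hn p)⟩

/-- The two properties support each other: completeness of `σ → τ` uses well-completeness of `τ`,
and well-completeness of `σ → τ` comes from its completeness and from the algebra structure. At
ground types completeness is derived from well-completeness. -/
lemma complete_ty (P : PlotModel (WithV.admissible A) L)
    (hw : ∀ α, L.WellComplete (I.obj α)) :
    ∀ τ : Ty Sg.TyConst, L.Complete (I.ty τ) ∧ L.WellComplete (I.ty τ)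
  | .base .nat =>
    ⟨WellComplete.complete P.wellComplete_unit P.wellComplete_nat (P.mono_ret _) P.total,
      P.wellComplete_nat⟩
  | .base (.const α) =>
    ⟨WellComplete.complete P.wellComplete_unit (hw α) (P.mono_ret _) P.total, hw α⟩
  | .arr σ τ => by
    have h : L.Complete ((ihom (I.ty σ)).obj (L.obj (I.ty τ))) :=
      Complete.ihom (complete_ty P hw τ).2 _
    exact ⟨h, Complete.wellComplete_of_algebra P.wellComplete_unit h (L.algebra _ _)
      (P.restrict _ (L.ret_algebra _ _))⟩

variable (I) in
/-- The logical relation between the points of the interpretation of a type and the closed values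
of that type. -/
def Rel : ∀ τ : Ty Sg.TyConst, (𝟙_ E ⟶ I.ty τ) → Value Sg [] τ → Prop
  | .base _, p, a => p = I.value a
  -- Only convergent applications are constrained, so the bottom function is related to every value.
  | .arr σ τ, p, f => ∀ a b, Rel σ a b → ∀ y,
      evalAt (A := I.ty σ) (B := L.obj (I.ty τ)) a p = y ≫ L.ret (I.ty τ) →
        ∃ c, Eval (.app f b) c ∧ Rel τ y c

lemma rel_ofGround (g : Ground Sg.TyConst) (p : 𝟙_ E ⟶ I.ty (.base g)) (x : g.Val Sg.Val) :
    Rel I (.base g) p (.ofGround g x) ↔ p = groundPt I.pt g x := by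
  refine Iff.trans (b := p = I.value (.ofGround g x)) Iff.rfl ?_
  rw [SigInterp.groundPt_eq_value]

variable (I) in
/-- The extension of the logical relation to computations. -/
def RelComp {τ : Ty Sg.TyConst} (p : 𝟙_ E ⟶ L.obj (I.ty τ)) (t : Computation Sg [] τ) : Prop :=
  ∀ y, p = y ≫ L.ret (I.ty τ) → ∃ c, Eval t c ∧ Rel I τ y c

variable (I) in
/-- The extension of the logical relation to contexts. -/
def RelSub {Γ : Ctx Sg.TyConst} (m : 𝟙_ E ⟶ I.ctx Γ) (s : ∀ τ, Var Γ τ → Value Sg [] τ) : Prop :=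
  ∀ τ x, Rel I τ (m ≫ I.var x) (s τ x)

lemma RelSub.cons {Γ : Ctx Sg.TyConst} {m : 𝟙_ E ⟶ I.ctx Γ} {s : ∀ τ, Var Γ τ → Value Sg [] τ}
    (h : RelSub I m s) {σ : Ty Sg.TyConst} {a : 𝟙_ E ⟶ I.ty σ} {b : Value Sg [] σ}
    (hab : Rel I σ a b) : RelSub I (Γ := σ :: Γ) (lift a m) (consSub b s)
  | _, .zero => by
    have h' : lift a m ≫ fst (I.ty σ) (I.ctx Γ) = a := lift_fst _ _
    exact (congrArg (fun z => Rel I σ z b) h').mpr hab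
  | _, .succ x => by
    have h' : lift a m ≫ snd (I.ty σ) (I.ctx Γ) ≫ I.var x = m ≫ I.var x := lift_snd_assoc _ _ _
    exact (congrArg (fun z => Rel I _ z (s _ x)) h').mpr (h _ x)

lemma concrete_ground (P : PlotModel (WithV.admissible A) L)
    (hI : ∀ α, P.Concrete (I.obj α)) : ∀ g, P.Concrete (I.ty (.base g))
  | .nat => P.concrete_nat
  | .const α => hI α

/-- The map `h` and the constant map at `b` agree on the points of `ω`, hence on `ω` as `X` is
concrete, hence on `ω̄` by uniqueness of extensions. -/
lemma infty_comp_eq (P : PlotModel (WithV.admissible A) L) {X : E} (hX : P.Concrete X)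
    (hc : L.Complete X) {h : L.omegaBar ⟶ X} {b : 𝟙_ E ⟶ X}
    (hb : ∀ n : ℕ, L.barPt n ≫ h = b) : L.infty ≫ h = b := by
  have key : snd (𝟙_ E) L.omegaBar ≫ h = toUnit _ ≫ b := by
    refine (hc (𝟙_ E) (snd _ _ ≫ L.comparison ≫ h)).unique (whiskerLeft_snd_assoc _ _ _) ?_
    refine P.hom_ext hX fun p => ?_
    obtain ⟨a, y, rfl⟩ := exists_lift p
    obtain ⟨n, rfl⟩ := P.exists_omegaPt y
    rw [lift_snd_assoc, ← Category.assoc (L.omegaPt n), omegaPt_comparison, hb,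
      ← toUnit_comp_eq, ← toUnit_comp_eq, toUnit_unit_comp]
  have h₂ := congrArg (lift (𝟙 (𝟙_ E)) L.infty ≫ ·) key
  rwa [lift_snd_assoc, ← toUnit_comp_eq, toUnit_unit_comp] at h₂

/-- A map `ω̄ ⟶ L X` which is defined at infinity is defined from some finite stage on. -/
lemma exists_total_shift (P : PlotModel (WithV.admissible A) L) {X : E} (k : L.omegaBar ⟶ L.obj X)
    {y : 𝟙_ E ⟶ X} (hy : L.infty ≫ k = y ≫ L.ret X) :
    ∃ (N : ℕ) (k' : L.omegaBar ⟶ X),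
      (∀ x : ℕ∞, (L.barPt x ≫ k') ≫ L.ret X = L.barPt (x + N) ≫ k) ∧ y = L.infty ≫ k' := by
  -- Composing with `L !` keeps only the domain of `k`. In `L 1` the behaviour along `V` is known,
  -- whatever `X` is.
  obtain ⟨N, hN⟩ := P.lift_V_top (Z := 𝟙_ E) (fun _ _ => ⟨𝟙 _, fun _ => toUnit_unique _ _⟩)
    (P.comp_mem (k ≫ L.map (toUnit _)) _ P.barPt_mem)
  have hN' : ∀ x : ℕ∞, L.barPt (x + N) ≫ k ≫ L.map (toUnit _) = L.ret (𝟙_ E) := by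
    have htop : L.barPt ⊤ ≫ k ≫ L.map (toUnit _) = L.ret (𝟙_ E) := by
      rw [barPt_top, ← Category.assoc, hy, Category.assoc, L.ret_map, ← Category.assoc,
        toUnit_unique (y ≫ toUnit _) (𝟙 _), Category.id_comp]
    intro x
    by_cases hx : x = ⊤
    · subst hx
      rw [top_add, htop]
    · lift x to ℕ using hx
      have := hN (x + N) (by omega)
      simp only [vVal_vPt, Nat.cast_add] at this
      rw [this, htop]
  -- Shifted by `N`, the map is defined at every point of `ω̄`; as `L 1` is concrete, it is total as
  -- a map and so factors through `X`.
  obtain ⟨k', hk'⟩ := P.total (L.omegaBarAdd N ≫ k)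
    (P.hom_ext (P.concrete_lift P.concrete_unit) fun p => by
      obtain ⟨x, rfl⟩ := P.exists_barPt p
      rw [← toUnit_comp_eq, toUnit_unit_comp, Category.assoc, ← Category.assoc (L.barPt x),
        barPt_add, hN'])
  have hk'' : ∀ x : ℕ∞, (L.barPt x ≫ k') ≫ L.ret X = L.barPt (x + N) ≫ k := fun x => by
    rw [Category.assoc, hk', ← Category.assoc, barPt_add]
  refine ⟨N, k', hk'', P.ret_injective ?_⟩
  rw [← barPt_top, hk'', top_add, barPt_top, hy]

/-- The relation is closed under limits of sequences indexed by `ω̄`. At a function type,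
convergence of the limit at an argument forces convergence of all late approximations there, to one
syntactic value, and the claim descends to the result type. -/
lemma rel_infty (P : PlotModel (WithV.admissible A) L) (hI : ∀ α, P.Concrete (I.obj α))
    (hw : ∀ α, L.WellComplete (I.obj α)) : ∀ (τ : Ty Sg.TyConst) (b : Value Sg [] τ)
    (h : L.omegaBar ⟶ I.ty τ), (∀ n : ℕ, Rel I τ (L.barPt n ≫ h) b) → Rel I τ (L.infty ≫ h) b
  | .base g, _, _, hr =>
    P.infty_comp_eq (P.concrete_ground hI g) (P.complete_ty hw (.base g)).1 hr
  | .arr σ τ, f, h, hr => by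
    intro a b hab y hy
    let k : L.omegaBar ⟶ L.obj (I.ty τ) :=
      evalAt (A := I.ty σ) (B := L.obj (I.ty τ)) (toUnit _ ≫ a) h
    have hk : ∀ x, x ≫ k = evalAt (A := I.ty σ) (B := L.obj (I.ty τ)) a (x ≫ h) := by
      intro x
      refine (comp_evalAt _ _ _).trans ?_
      rw [← toUnit_comp_eq, toUnit_unit_comp]
    obtain ⟨N, k', hk', rfl⟩ := P.exists_total_shift k ((hk _).trans hy)
    -- The indices start at `N`, from where on the application is defined. The values `c n` might a
    -- priori vary with `n`; determinism makes them all equal to `c 0`.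
    choose c hc hrel using fun n : ℕ =>
      hr (n + N) a b hab (L.barPt n ≫ k') ((hk _).symm.trans (by rw [hk', Nat.cast_add]))
    exact ⟨c 0, hc 0, rel_infty P hI hw τ (c 0) k' fun n => (hc n).det (hc 0) ▸ hrel n⟩

/-- Every finite iterate is related to the same closed function: the zeroth because it diverges
everywhere, the next by one unfolding matched with one evaluation step. Then `rel_infty` reaches the
fixed point. -/
lemma rel_fn (P : PlotModel (WithV.admissible A) L) (hI : ∀ α, P.Concrete (I.obj α))
    (hw : ∀ α, L.WellComplete (I.obj α)) {Γ : Ctx Sg.TyConst} {σ τ : Ty Sg.TyConst}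
    (t : Computation Sg (σ :: .arr σ τ :: Γ) τ) {m : 𝟙_ E ⟶ I.ctx Γ}
    {s : ∀ τ, Var Γ τ → Value Sg [] τ} (hm : RelSub I m s)
    (ht : ∀ (m' : 𝟙_ E ⟶ I.ctx (σ :: .arr σ τ :: Γ)) (s' : ∀ ρ, Var _ ρ → Value Sg [] ρ),
      RelSub I m' s' → RelComp I (m' ≫ I.comp t) (t.subst s')) :
    Rel I (.arr σ τ) (m ≫ I.value (.fn t)) ((Value.fn t).subst s) := by
  obtain ⟨h, h_zero, h_succ, h_top⟩ := exists_iterates (A := I.ty σ) (B := I.ty τ)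
    (P.complete_ty (I := I) hw (.arr σ τ)).1 m (I.body t)
  rw [I.value_fn]
  refine (congrArg (fun z => Rel I (.arr σ τ) z _) h_top).mp ?_
  refine rel_infty P hI hw (.arr σ τ) _ h fun n => ?_
  induction n with
  | zero =>
    intro a b _ y hy
    refine (P.ret_ne_bot y (hy.symm.trans ?_)).elim
    exact (congrArg (evalAt a) h_zero).trans (evalAt_bot_algebra (P.bot_join _) a)
  | succ n ih =>
    intro a b hab y hy
    obtain ⟨c, hc, hyc⟩ := ht _ _ ((hm.cons ih).cons hab) y
      (((congrArg (evalAt a) (h_succ n)).trans (I.evalAt_body t a m _)).symm.trans hy)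
    rw [Value.subst] at hc ⊢
    exact ⟨c, .app _ _ _ (by rwa [Computation.inst₂_subst]), hyc⟩

-- The fundamental lemma of the logical relation, by induction on terms. All the content of
-- recursion is in `rel_fn`; the other cases match a denotation that is not `⊥` with an evaluation
-- rule.
mutual
lemma rel_value (P : PlotModel (WithV.admissible A) L) (hI : ∀ α, P.Concrete (I.obj α))
    (hw : ∀ α, L.WellComplete (I.obj α)) : ∀ {Γ : Ctx Sg.TyConst} {τ : Ty Sg.TyConst}
    (a : Value Sg Γ τ) (m : 𝟙_ E ⟶ I.ctx Γ) (s : ∀ τ, Var Γ τ → Value Sg [] τ),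
    RelSub I m s → Rel I τ (m ≫ I.value a) (a.subst s)
  | _, _, .var x, m, s, h => by
    rw [I.value_var, Value.subst]
    exact h _ x
  | _, _, .zero, m, s, _ => by
    rw [I.value_zero, Value.subst, Rel, I.value_zero]
    exact (toUnit_comp_eq _ _).symm
  | _, _, .succ n, m, s, h => by
    have ih := rel_value P hI hw n m s h
    rw [Rel] at ih
    rw [I.value_succ, Value.subst, Rel, I.value_succ, ← ih]
    exact (Category.assoc _ _ _).symm
  | _, _, .fn t, m, s, h => rel_fn P hI hw t h fun m' s' h' => rel_comp P hI hw t m' s' h'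
  | _, _, .const c, m, s, _ => by
    rw [I.value_const, Value.subst, Rel, I.value_const]
    exact (toUnit_comp_eq _ _).symm
  | _, _, .op f, m, s, _ => by
    intro a b hab y hy
    obtain ⟨x, rfl⟩ := b.exists_ofGround
    rw [Rel, SigInterp.groundPt_eq_value] at hab
    have hy' : groundPt I.pt _ x ≫ I.op f = y ≫ L.ret _ := by
      rw [← hab, ← hy]
      exact (I.evalAt_op f m a).symm
    rw [Value.subst]
    cases hx : Sg.run f x with
    | none =>
      rw [I.op_none f x hx] at hy'
      exact (P.ret_ne_bot y hy'.symm).elim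
    | some z =>
      refine ⟨_, .op f x z hx, ?_⟩
      rw [I.op_some f x z hx] at hy'
      rw [Rel, SigInterp.groundPt_eq_value]
      exact (P.ret_injective hy').symm
lemma rel_comp (P : PlotModel (WithV.admissible A) L) (hI : ∀ α, P.Concrete (I.obj α))
    (hw : ∀ α, L.WellComplete (I.obj α)) : ∀ {Γ : Ctx Sg.TyConst} {τ : Ty Sg.TyConst}
    (t : Computation Sg Γ τ) (m : 𝟙_ E ⟶ I.ctx Γ) (s : ∀ τ, Var Γ τ → Value Sg [] τ),
    RelSub I m s → RelComp I (m ≫ I.comp t) (t.subst s)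
  | _, _, .app f a, m, s, h => by
    intro y hy
    rw [I.comp_app] at hy
    rw [Computation.subst]
    exact rel_value P hI hw f m s h _ _ (rel_value P hI hw a m s h) y
      ((comp_evalAt _ _ _).symm.trans hy)
  | _, _, .ret a, m, s, h => by
    intro y hy
    rw [I.comp_ret, ← Category.assoc] at hy
    rw [Computation.subst, ← P.ret_injective hy]
    exact ⟨_, .ret _, rel_value P hI hw a m s h⟩
  | _, _, .bind (σ := σ) t t', m, s, h => by
    intro y hy
    have hy' : L.bind (m ≫ I.comp t) (I.ty σ ◁ m ≫ I.comp t') = y ≫ L.ret _ := by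
      rw [← hy, I.comp_bind]
      exact (L.bind_natural _ _ _).symm
    -- A point of a lifting is `⊥` or total. If the first computation denoted `⊥`, so would the
    -- sequence, contrary to its convergence.
    rcases P.pt_lift (m ≫ I.comp t) with h₁ | ⟨x, h₁⟩
    · rw [h₁, ← Category.id_comp (L.bot _), bot_bind (P.bot_join _), Category.id_comp] at hy'
      exact (P.ret_ne_bot y hy'.symm).elim
    · rw [h₁, L.bind_ret] at hy'
      obtain ⟨b, hb, hxb⟩ := rel_comp P hI hw t m s h x h₁
      obtain ⟨c, hc, hyc⟩ := rel_comp P hI hw t' _ _ (h.cons hxb) y (by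
        refine Eq.trans ?_ hy'
        exact (lift_comp_whiskerLeft x m _).symm)
      rw [Computation.subst]
      exact ⟨c, .bind _ _ _ _ hb (by rwa [Computation.inst_subst]), hyc⟩
  | _, _, .case n t t', m, s, h => by
    intro y hy
    have ih := rel_value P hI hw n m s h
    rw [Rel] at ih
    have hy' : lift (𝟙 _) (I.value (n.subst s)) ≫
        SigInterp.natCase (m ≫ I.comp t) (natObj E ◁ m ≫ I.comp t') = y ≫ L.ret _ := by
      rw [← hy, I.comp_case, ← ih]
      exact (SigInterp.lift_natCase _ _ _ _).symm
    rw [Computation.subst]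
    obtain ⟨x, hx⟩ := (n.subst s).exists_ofGround
    rw [hx, SigInterp.groundPt_eq_value] at hy'
    rw [hx]
    obtain ⟨k⟩ := x
    rcases k with _ | k
    · obtain ⟨c, hc, hyc⟩ := rel_comp P hI hw t m s h y (by
        refine Eq.trans ?_ hy'
        have := SigInterp.lift_zero_natCase (m ≫ I.comp t) (natObj E ◁ m ≫ I.comp t')
        rw [toUnit_unit_comp] at this
        exact this.symm)
      exact ⟨c, .case_zero _ _ _ hc, hyc⟩
    · have hk : Rel I (.base .nat) (natPt E k) (.ofGround .nat ⟨k⟩) := by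
        exact (rel_ofGround .nat (natPt E k) ⟨k⟩).2 rfl
      obtain ⟨c, hc, hyc⟩ := rel_comp P hI hw t' _ _ (h.cons hk) y (by
        refine Eq.trans ?_ hy'
        have := SigInterp.lift_succ_natCase (m ≫ I.comp t) (natObj E ◁ m ≫ I.comp t') k
        rw [toUnit_unit_comp, toUnit_unit_comp] at this
        exact ((this.trans (lift_comp_whiskerLeft _ m _))).symm)
      exact ⟨c, .case_succ _ _ _ _ (by rwa [Computation.inst_subst]), hyc⟩
end

lemma groundPt_injective (P : PlotModel (WithV.admissible A) L) (I : SigInterp L Sg) :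
    ∀ g, Function.Injective (groundPt I.pt g)
  | .nat => fun _ _ h => ULift.ext _ _ (P.natPt_injective h)
  | .const α => (I.pt α).injective

theorem soundAdequate (P : PlotModel (WithV.admissible A) L) (I : SigInterp L Sg)
    (hI : ∀ α, P.Concrete (I.obj α)) (hw : ∀ α, L.WellComplete (I.obj α)) :
    I.SoundAdequate where
  complete := P.complete_ty hw
  sound _ _ _ h := SigInterp.sound (fun τ => (P.complete_ty hw τ).1) h
  adequate g t a h := by
    -- The fundamental lemma for the empty context: `t` evaluates to some `b` with the same
    -- denotation as `a`. At ground types denotations of closed values are injective, so `b` is `a`.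
    obtain ⟨b, hb, hab⟩ := rel_comp P hI hw t (𝟙 _) (fun _ => .var) (fun _ x => nomatch x)
      (I.value a) (by rw [h, I.comp_ret]; exact Category.id_comp _)
    rw [Computation.subst_var t fun _ _ => rfl] at hb
    obtain ⟨x, rfl⟩ := a.exists_ofGround
    obtain ⟨y, rfl⟩ := b.exists_ofGround
    have hxy := (rel_ofGround g _ y).1 hab
    rw [SigInterp.groundPt_eq_value] at hxy
    rwa [groundPt_injective P I g hxy]

end PlotModel

end Adequacy

end SheafPCF

namespace SheafPCF

namespace Conc

-- Concrete sheaves as a plot model.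

noncomputable section Plots

variable {C : Type u} [SmallCategory C] {S : ConcreteSite C}

section Limits

variable {J : Type} [SmallCategory J] (F : J ⥤ Conc S)

/-- The chosen colimit is isomorphic to the explicit one, whose carrier is a quotient of the sum;
representatives, and below local representatives of plots, are transported along this isomorphism.
-/
lemma colimit_exists_rep (x : (colimit F).carrier) :
    ∃ (j : J) (y : (F.obj j).carrier), (colimit.ι F j).1 y = x := by
  let e := (colimit.isColimit F).coconePointUniqueUpToIso (isColimit F)
  obtain ⟨⟨j, y⟩, hy⟩ := Quot.exists_rep (e.hom.1 x)
  refine ⟨j, y, ?_⟩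
  have h₁ : (colimCocone F).ι.app j ≫ e.inv = colimit.ι F j :=
    (colimit.isColimit F).comp_coconePointUniqueUpToIso_inv (isColimit F) j
  have h₂ : e.inv.1 (e.hom.1 x) = x := congrFun (congrArg Subtype.val e.hom_inv_id) x
  rw [← h₁, ← h₂, ← hy]
  rfl

lemma colimit_local {c : C} {g : (S.star ⟶ c) → (colimit F).carrier}
    (hg : g ∈ (colimit F).plots c) : ∃ R ∈ S.cov c, ∀ ⦃d : C⦄ (f : d ⟶ c), R f →
      ∃ (j : J), ∃ k ∈ (F.obj j).plots d, ∀ p, g (p ≫ f) = (colimit.ι F j).1 (k p) := by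
  let e := (colimit.isColimit F).coconePointUniqueUpToIso (isColimit F)
  obtain ⟨R, hR, h⟩ := e.hom.2 c g hg
  refine ⟨R, hR, fun d f hf => ?_⟩
  obtain ⟨j, k, hk, hgk⟩ := h f hf
  refine ⟨j, k, hk, fun p => ?_⟩
  have h₁ : (colimCocone F).ι.app j ≫ e.inv = colimit.ι F j :=
    (colimit.isColimit F).comp_coconePointUniqueUpToIso_inv (isColimit F) j
  have h₂ : e.inv.1 (e.hom.1 (g (p ≫ f))) = g (p ≫ f) :=
    congrFun (congrArg Subtype.val e.hom_inv_id) _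
  rw [← h₁, ← h₂]
  exact congrArg e.inv.1 (hgk p)

lemma limit_mem_plots {c : C} {g : (S.star ⟶ c) → (limit F).carrier}
    (hg : ∀ j, (fun p => (limit.π F j).1 (g p)) ∈ (F.obj j).plots c) : g ∈ (limit F).plots c := by
  let e := (limit.isLimit F).conePointUniqueUpToIso (isLimit F)
  have h₁ : (fun p => e.hom.1 (g p)) ∈ (lim F).plots c := fun j => hg j
  have h₂ := e.inv.2 c _ h₁
  have h₃ : ∀ x, e.inv.1 (e.hom.1 x) = x := congrFun (congrArg Subtype.val e.hom_inv_id)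
  have h₄ : (fun p => e.inv.1 (e.hom.1 (g p))) = g := funext fun p => h₃ _
  exact h₄ ▸ h₂

end Limits

/-- The point given by an element of the carrier. -/
def pt {X : Conc S} (x : X.carrier) : 𝟙_ (Conc S) ⟶ X :=
  ⟨fun _ => x, fun c _ _ => X.const_mem c x⟩

/-- The element of the carrier given by a point. -/
def ptVal {X : Conc S} (p : 𝟙_ (Conc S) ⟶ X) : X.carrier := p.1 PUnit.unit

lemma pt_ext {X : Conc S} {p q : 𝟙_ (Conc S) ⟶ X} (h : ptVal p = ptVal q) : p = q :=
  hom_ext fun _ => h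

variable (A : AdmissibleMonos S)

/-- Concrete sheaves in terms of points and plots. -/
def plotModel : PlotModel A (concLifting A) where
  plots X c := { g | (fun p => ptVal (g p)) ∈ X.plots c }
  const_mem {X} c x := X.const_mem c _
  pre_mem {X} _ _ h g hg := X.comp_mem h _ hg
  comp_mem f _ g hg := f.2 _ _ hg
  lift_mem g hg k hk := ⟨hg, hk⟩
  omegaBar_mem g hg := limit_mem_plots _ fun n => hg n.unop
  lift_mem_iff {X c} g := by
    constructor
    · rintro ⟨d, m, hm, h, r, hr, hgr⟩
      refine ⟨d, m, hm, fun p hp => pt_ext ?_, fun q => pt (r q), hr, fun q => pt_ext (hgr q)⟩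
      by_contra h'
      exact hp ((h p).1 (Option.isSome_iff_ne_none.2 h'))
    · rintro ⟨d, m, hm, h, r, hr, hgr⟩
      have hgr' : ∀ q, ptVal (g (q ≫ m)) = some (ptVal (r q)) := fun q => congrArg ptVal (hgr q)
      refine ⟨d, m, hm, fun p => ⟨fun hp => ?_, ?_⟩, _, hr, hgr'⟩
      · by_contra h'
        exact Option.isSome_iff_ne_none.1 hp (congrArg ptVal (h p h'))
      · rintro ⟨q, rfl⟩
        exact Option.isSome_iff_exists.2 ⟨_, hgr' q⟩
  pt_lift {X} p := by
    cases h : ptVal p with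
    | none => exact Or.inl (pt_ext h)
    | some x => exact Or.inr ⟨pt x, pt_ext h⟩
  ret_ne_bot x h := nomatch (congrArg ptVal h : some (ptVal x) = none)
  mono_ret X := ⟨fun f g h => hom_ext fun x =>
    Option.some_injective _ (congrFun (congrArg Subtype.val h) x)⟩
  bot_join X := rfl
  total {X B} k hk := by
    have h : ∀ b, ∃ x, k.1 b = some x := fun b => by
      have h₁ : Option.map _ (k.1 b) = some _ := congrFun (congrArg Subtype.val hk) b
      obtain ⟨x, hx, -⟩ := Option.map_eq_some_iff.1 h₁
      exact ⟨x, hx⟩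
    choose φ hφ using h
    refine ⟨⟨φ, fun c g hg => ?_⟩, hom_ext fun b => (hφ b).symm⟩
    obtain ⟨d, m, hm, h, r, hr, hgr⟩ := k.2 c g hg
    -- All points lie in the domain of the plot, so its mono is split by order reflection, and the
    -- values on the domain restrict along the section to a plot on `c`.
    obtain ⟨l, hl⟩ := A.reflect (𝟙 c) m (A.iso _ inferInstance) hm fun p _ =>
      (h p).1 (Option.isSome_iff_exists.2 ⟨_, hφ (g p)⟩)
    have hφr : (fun p => φ (g p)) = fun p => r (p ≫ l) := by
      funext p
      have h₁ := hgr (p ≫ l)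
      rw [Category.assoc, hl, Category.comp_id] at h₁
      exact Option.some_injective _ ((hφ (g p)).symm.trans h₁)
    rw [hφr]
    exact X.comp_mem l r hr
  restrict α hα := hom_ext fun x => by
    cases x with
    | none => rfl
    | some x => exact congrArg some (congrFun (congrArg Subtype.val hα) x)
  omega_pt p := by
    obtain ⟨n, y, hy⟩ := colimit_exists_rep _ (ptVal p)
    exact ⟨n, pt y, pt_ext hy.symm⟩
  -- Here morphisms are by definition the functions that preserve plots, so every object qualifies.
  Concrete _ := True
  concrete_unit := trivial
  concrete_nat := trivial
  nat_local {c} g hg := by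
    obtain ⟨R, hR, h⟩ := colimit_local _ hg
    refine ⟨R, hR, fun d f hf => ?_⟩
    obtain ⟨⟨n⟩, k, -, hk⟩ := h f hf
    exact ⟨n, fun p => pt_ext (hk p)⟩
  concrete_lift _ := trivial
  hom_ext {_ _} _ {_ _} h' := hom_ext fun x => congrArg ptVal (h' (pt x))
  exists_hom _ φ h := ⟨⟨fun x => ptVal (φ (pt x)), fun c g hg => h c (fun p => pt (g p)) hg⟩,
    fun _ => rfl⟩
  glue {X} _ _ g R hR h := X.glue _ R hR h

end Plots

end Conc

end SheafPCF

namespace SheafPCF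

-- Elements, subsheaves, limits and colimits of sheaves.

noncomputable section SheafPlots

variable {C : Type u} [SmallCategory C] {S : ConcreteSite C}

namespace Sh

lemma hom_ext' {X Y : Sh S} {f g : X ⟶ Y}
    (h : ∀ (c : C) (x : X.obj.obj (op c)), f.hom.app (op c) x = g.hom.app (op c) x) : f = g := by
  apply ObjectProperty.hom_ext
  ext c x
  exact h c.unop x

lemma map_comp_apply (X : Sh S) {a b d : C} (f : a ⟶ b) (g : b ⟶ d) (v : X.obj.obj (op d)) :
    X.obj.map (f ≫ g).op v = X.obj.map f.op (X.obj.map g.op v) := by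
  rw [op_comp, X.obj.map_comp]
  rfl

lemma map_id_apply (X : Sh S) {c : C} (v : X.obj.obj (op c)) : X.obj.map (𝟙 c).op v = v := by
  rw [op_id, X.obj.map_id]
  rfl

lemma map_star (X : Sh S) (p : S.star ⟶ S.star) (v : X.obj.obj (op S.star)) :
    X.obj.map p.op v = v := by
  rw [S.isTerminal.hom_ext p (𝟙 _), map_id_apply]

/-- The element over the terminal object given by a point. -/
def elt {X : Sh S} (p : 𝟙_ (Sh S) ⟶ X) : X.obj.obj (op S.star) :=
  p.hom.app (op S.star) PUnit.unit

/-- The point given by an element over the terminal object. -/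
def pt {X : Sh S} (x : X.obj.obj (op S.star)) : 𝟙_ (Sh S) ⟶ X :=
  ⟨{ app := fun c => ↾fun _ => X.obj.map (S.isTerminal.from c.unop).op x
     naturality := fun c d f => by
      ext
      refine Eq.trans ?_ (map_comp_apply X f.unop (S.isTerminal.from c.unop) x)
      exact congrArg (fun k => X.obj.map (Quiver.Hom.op k) x) (S.isTerminal.hom_ext _ _) }⟩

lemma elt_pt {X : Sh S} (x : X.obj.obj (op S.star)) : elt (pt x) = x := map_star X _ x

lemma pt_ext {X : Sh S} {p q : 𝟙_ (Sh S) ⟶ X} (h : elt p = elt q) : p = q :=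
  hom_ext' fun c y => by
    have key : ∀ r : 𝟙_ (Sh S) ⟶ X, r.hom.app (op c) y =
        X.obj.map (S.isTerminal.from c).op (elt r) := fun r =>
      NatTrans.naturality_apply r.hom (S.isTerminal.from c).op PUnit.unit
    rw [key, key, h]

lemma map_elt_comp {X Y : Sh S} (f : X ⟶ Y) {c : C} (x : X.obj.obj (op c)) (p : S.star ⟶ c) :
    elt (pt (X.obj.map p.op x) ≫ f) = Y.obj.map p.op (f.hom.app (op c) x) :=
  (congrArg (f.hom.app (op S.star)) (elt_pt _)).trans (NatTrans.naturality_apply f.hom p.op x)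

/-- The subsheaf of a sheaf given by a local property of its elements. -/
def sub (X : Sh S) (P : ∀ c : C, X.obj.obj (op c) → Prop)
    (h_res : ∀ {c d : C} (f : d ⟶ c) (x), P c x → P d (X.obj.map f.op x))
    (h_loc : ∀ {c : C} (R : Presieve c), R ∈ S.cov c → ∀ x,
      (∀ ⦃d : C⦄ (f : d ⟶ c), R f → P d (X.obj.map f.op x)) → P c x) : Sh S :=
  ⟨{ obj := fun c => { x : X.obj.obj c // P c.unop x }
     map := fun f => ↾fun x => ⟨X.obj.map f x.1, h_res f.unop x.1 x.2⟩
     map_id := fun c => by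
      ext x
      exact map_id_apply X x.1
     map_comp := fun f g => by
      ext x
      exact map_comp_apply X g.unop f.unop x.1 },
    (isSheaf_iff_isSheaf_of_type _ _).2 ((Presieve.isSheaf_coverage _ _).2 fun {c} R hR x hx => by
      obtain ⟨y, hy, hy'⟩ := sh_isSheafFor X R hR (fun d f hf => (x f hf).1)
        fun d d' a g g' f f' hf hf' hgf => congrArg Subtype.val (hx g g' hf hf' hgf)
      refine ⟨⟨y, h_loc R hR y fun d f hf => ?_⟩, fun d f hf => Subtype.ext (hy f hf),
        fun z hz => Subtype.ext (hy' z.1 fun d f hf => congrArg Subtype.val (hz f hf))⟩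
      have h := hy f hf
      rw [h]
      exact (x f hf).2)⟩

section Limits

variable {J : Type} [SmallCategory J] (F : J ⥤ Sh S)

/-- The property cuts out a subsheaf through which the colimit cocone factors. The induced map from
the colimit is a section of the inclusion, so the subsheaf contains every element. -/
lemma colimit_induction [HasColimit F] (P : ∀ c : C, (colimit F).obj.obj (op c) → Prop)
    (h_res : ∀ {c d : C} (f : d ⟶ c) (x), P c x → P d ((colimit F).obj.map f.op x))
    (h_loc : ∀ {c : C} (R : Presieve c), R ∈ S.cov c → ∀ x,
      (∀ ⦃d : C⦄ (f : d ⟶ c), R f → P d ((colimit F).obj.map f.op x)) → P c x)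
    (h_ι : ∀ (j : J) {c : C} (y : (F.obj j).obj.obj (op c)),
      P c ((colimit.ι F j).hom.app (op c) y)) {c : C} (x : (colimit F).obj.obj (op c)) :
    P c x := by
  let Z := sub (colimit F) P h_res h_loc
  let i : Z ⟶ colimit F := ⟨{ app := fun c => ↾fun x => x.1, naturality := fun _ _ _ => rfl }⟩
  let s : Cocone F :=
    { pt := Z
      ι :=
        { app := fun j =>
            ⟨{ app := fun c => ↾fun y => ⟨(colimit.ι F j).hom.app c y, h_ι j y⟩
               naturality := fun c d f => by
                ext y
                refine Subtype.ext ?_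
                exact NatTrans.naturality_apply (colimit.ι F j).hom f y }⟩
          naturality := fun j k f => hom_ext' fun c y => Subtype.ext
            (congrArg (fun g : F.obj j ⟶ colimit F => g.hom.app (op c) y) (colimit.w F f)) } }
  have h : colimit.desc F s ≫ i = 𝟙 _ := colimit.hom_ext fun j => by
    rw [← Category.assoc, colimit.ι_desc, Category.comp_id]
    rfl
  have hx : ((colimit.desc F s).hom.app (op c) x).1 = x :=
    congrArg (fun g : colimit F ⟶ colimit F => g.hom.app (op c) x) h
  exact hx ▸ ((colimit.desc F s).hom.app (op c) x).2

/-- Being locally in the image of a stage is stable under restriction and, as covering families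
compose, is a local property; so the induction principle applies without any construction of the
colimit. -/
lemma colimit_local [HasColimit F] {c : C} (x : (colimit F).obj.obj (op c)) :
    ∃ R ∈ S.cov c, ∀ ⦃d : C⦄ (f : d ⟶ c), R f → ∃ (j : J) (y : (F.obj j).obj.obj (op d)),
      (colimit F).obj.map f.op x = (colimit.ι F j).hom.app (op d) y := by
  refine colimit_induction F (fun c x => ∃ R ∈ S.cov c, ∀ ⦃d : C⦄ (f : d ⟶ c), R f →
    ∃ (j : J) (y : (F.obj j).obj.obj (op d)),
      (colimit F).obj.map f.op x = (colimit.ι F j).hom.app (op d) y) ?_ ?_ ?_ x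
  · rintro c d f x ⟨R, hR, h⟩
    obtain ⟨R', hR', h'⟩ := S.cov.pullback f R hR
    refine ⟨R', hR', fun a g hg => ?_⟩
    obtain ⟨e, l, i, hi, hl⟩ := h' hg
    obtain ⟨j, y, hy⟩ := h i hi
    refine ⟨j, (F.obj j).obj.map l.op y, ?_⟩
    rw [← map_comp_apply, ← hl, map_comp_apply, hy]
    exact (NatTrans.naturality_apply (colimit.ι F j).hom l.op y).symm
  · intro c R hR x h
    choose T hT h' using h
    refine ⟨_, S.cov_bind R hR (fun _ f hf => T f hf) (fun _ f hf => hT f hf), ?_⟩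
    rintro d _ ⟨e, a, f, hf, ha, rfl⟩
    obtain ⟨j, y, hy⟩ := h' f hf a ha
    exact ⟨j, y, (map_comp_apply _ _ _ _).trans hy⟩
  · intro j c y
    refine ⟨_, S.cov_id c, fun d f _ => ⟨j, (F.obj j).obj.map f.op y, ?_⟩⟩
    exact (NatTrans.naturality_apply (colimit.ι F j).hom f.op y).symm

lemma limit_exists [HasLimitsOfShape J (Sh S)] [HasLimitsOfShape J (Type u)] {c : C}
    (x : ∀ j, (F.obj j).obj.obj (op c))
    (hx : ∀ ⦃i j : J⦄ (k : i ⟶ j), (F.map k).hom.app (op c) (x i) = x j) :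
    ∃ y : (limit F).obj.obj (op c), ∀ j, (limit.π F j).hom.app (op c) y = x j := by
  let G : Sh S ⥤ Type u := sheafToPresheaf _ _ ⋙ (evaluation _ _).obj (op c)
  have t : IsLimit (G.mapCone (limit.cone F)) := isLimitOfPreserves G (limit.isLimit F)
  exact ⟨(Types.isLimitEquivSections t).symm ⟨x, fun k => hx k⟩, fun j =>
    Types.isLimitEquivSections_symm_apply t _ j⟩

end Limits

end Sh

end SheafPlots

end SheafPCF

namespace SheafPCF

-- Sheaves as a plot model.

noncomputable section SheafPlots

variable {C : Type u} [SmallCategory C] {S : ConcreteSite C} (A : AdmissibleMonos S)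

namespace AdmissibleMonos

/-- For an object without points the identity factors through the admissible mono `0 ⟶ e`, vacuously
on points. Hence the domain of `⊥` is detected by points. -/
lemma nonempty_toZero_iff (A : AdmissibleMonos S) (e : C) :
    Nonempty (e ⟶ S.zero) ↔ IsEmpty (S.star ⟶ e) := by
  constructor
  · rintro ⟨g⟩
    exact ⟨fun p => by
      obtain ⟨_, _, h, _⟩ := S.cov_points _ S.cov_zero (p ≫ g)
      exact h.elim⟩
  · intro h
    obtain ⟨g, -⟩ := A.factors (S.isInitial.to e) (A.zero e) (𝟙 e) fun p => h.elim p
    exact ⟨g⟩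

end AdmissibleMonos

namespace PartialElem

variable {A} {X : Sh S} {c : C}

lemma val_comp_mono (s : PartialElem A.toStableMonos X.obj c) {d : C} {m : d ⟶ c}
    {x : X.obj.obj (op d)} (hx : s.val m = some x) {e : C} (q : e ⟶ d) :
    s.restrict (q ≫ m) = PartialElem.unit (X.obj.map q.op x) := by
  refine PartialElem.ext (funext fun a => funext fun k => ?_)
  change s.val (k ≫ q ≫ m) = some (X.obj.map k.op (X.obj.map q.op x))
  rw [← Category.assoc, s.val_comp m (k ≫ q) x hx, Sh.map_comp_apply]

/-- If the restriction were defined on an object with a point, restricting once more to that point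
would make `s` defined at `p` itself. -/
lemma restrict_eq_bot (s : PartialElem A.toStableMonos X.obj c) {p : S.star ⟶ c}
    (hp : s.val p = none) : s.restrict p = PartialElem.bot A X S.star := by
  obtain ⟨d, m, hm, h⟩ := s.dom
  refine PartialElem.eq_bot A fun e k => ?_
  rw [A.nonempty_toZero_iff]
  refine (h (k ≫ p)).trans ⟨fun hk => ⟨fun q => ?_⟩, fun he => A.factors m hm _ he.elim⟩
  have hp' : (s.val p).isSome := (h p).2 (by
    obtain ⟨l, hl⟩ := hk
    refine ⟨q ≫ l, ?_⟩
    rw [Category.assoc, hl, ← Category.assoc, S.isTerminal.hom_ext (q ≫ k) (𝟙 _),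
      Category.id_comp])
  rw [hp] at hp'
  exact nomatch hp'

lemma isSome_of_toZero (s : PartialElem A.toStableMonos X.obj c) {e : C} (f : e ⟶ c)
    (he : Nonempty (e ⟶ S.zero)) : (s.val f).isSome := by
  obtain ⟨d, m, hm, h⟩ := s.dom
  exact (h f).2 (A.factors m hm f ((A.nonempty_toZero_iff e).1 he).elim)

open Classical in
variable (A) in
/-- The partial element given by an element over an admissible subobject. -/
def ofMono {d : C} (m : d ⟶ c) (hm : A.mem m) (x : X.obj.obj (op d)) :
    PartialElem A.toStableMonos X.obj c where
  val _ f := if h : FactorsVia f m then some (X.obj.map h.choose.op x) else none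
  val_comp a b f g y hy := by
    have := A.mono m hm
    by_cases h : FactorsVia f m
    · have h' : FactorsVia (g ≫ f) m := ⟨g ≫ h.choose, by rw [Category.assoc, h.choose_spec]⟩
      rw [dif_pos h] at hy
      rw [dif_pos h', ← Option.some.inj hy, ← Sh.map_comp_apply]
      have : h'.choose = g ≫ h.choose := by
        rw [← cancel_mono m, h'.choose_spec, Category.assoc, h.choose_spec]
      rw [this]
    · rw [dif_neg h] at hy
      exact nomatch hy
  dom := ⟨d, m, hm, fun e f => by
    by_cases h : FactorsVia f m
    · rw [dif_pos h]
      exact ⟨fun _ => h, fun _ => rfl⟩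
    · rw [dif_neg h]
      exact ⟨fun h => (nomatch h), fun h' => (h h').elim⟩⟩

lemma ofMono_val_self {d : C} (m : d ⟶ c) (hm : A.mem m) (x : X.obj.obj (op d)) :
    (ofMono A m hm x).val m = some x := by
  have := A.mono m hm
  have h : FactorsVia m m := ⟨𝟙 d, Category.id_comp m⟩
  refine (dif_pos h).trans (congrArg some ?_)
  have h' : h.choose = 𝟙 d := by rw [← cancel_mono m, h.choose_spec, Category.id_comp]
  rw [h', Sh.map_id_apply]

lemma restrict_id (s : PartialElem A.toStableMonos X.obj c) : s.restrict (𝟙 c) = s :=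
  Sh.map_id_apply (shLift A X) s

lemma unit_injective {x y : X.obj.obj (op c)}
    (h : (PartialElem.unit x : PartialElem A.toStableMonos X.obj c) = PartialElem.unit y) :
    x = y := by
  have h' : some (X.obj.map (𝟙 c).op x) = some (X.obj.map (𝟙 c).op y) :=
    congrArg (fun s : PartialElem A.toStableMonos X.obj c => s.val (𝟙 c)) h
  rw [Sh.map_id_apply, Sh.map_id_apply] at h'
  exact Option.some.inj h'

end PartialElem

namespace Sh

variable {A}

lemma ret_ne_bot {X : Sh S} (x : 𝟙_ (Sh S) ⟶ X) :
    x ≫ (shLifting A).ret X ≠ (shLifting A).bot X := fun h => by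
  have h' : PartialElem.unit (elt x) = PartialElem.bot A X S.star := congrArg elt h
  have h₁ := (PartialElem.bot_isSome A X S.star (𝟙 S.star)).1 (h' ▸ rfl)
  exact ((A.nonempty_toZero_iff S.star).1 h₁).false (𝟙 _)

/-- The domains agree because admissible subobjects are determined by their points, and the values
agree because `X` is concrete. -/
lemma isConcrete_lift {X : Sh S} (hX : IsConcrete X) : IsConcrete (shLift A X) := by
  intro c s t hst
  have hres : ∀ p : S.star ⟶ c, PartialElem.val s p = PartialElem.val t p := fun p => by
    have h : PartialElem.val s (𝟙 _ ≫ p) = PartialElem.val t (𝟙 _ ≫ p) :=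
      congrArg (fun r : PartialElem A.toStableMonos X.obj S.star => r.val (𝟙 _)) (congrFun hst p)
    rwa [Category.id_comp] at h
  have key : ∀ s t : PartialElem A.toStableMonos X.obj c, (∀ p : S.star ⟶ c, s.val p = t.val p) →
      ∀ ⦃d : C⦄ (f : d ⟶ c) x, s.val f = some x → t.val f = some x := by
    intro s t hst d f x hx
    obtain ⟨e, m, hm, h⟩ := s.dom
    obtain ⟨e', m', hm', h'⟩ := t.dom
    obtain ⟨l, hl⟩ := A.reflect m m' hm hm' fun p hp => by
      rw [← h', ← hst, h]
      exact hp
    obtain ⟨g, hg⟩ := (h f).1 (hx ▸ rfl)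
    obtain ⟨y, hy⟩ := Option.isSome_iff_exists.1 ((h' f).2 ⟨g ≫ l, by rw [Category.assoc, hl, hg]⟩)
    rw [hy]
    refine congrArg some (hX d (funext fun p => ?_))
    have h₁ := hst (p ≫ f)
    rw [s.val_comp f p x hx, t.val_comp f p y hy] at h₁
    exact (Option.some.inj h₁).symm
  exact PartialElem.ext_some fun d f x =>
    ⟨key s t hres f x, key t s (fun p => (hres p).symm) f x⟩

lemma isConcrete_unit : IsConcrete (𝟙_ (Sh S)) := fun _ _ _ _ => rfl

lemma isConcrete_iter : ∀ n, IsConcrete ((shLifting A).iter n)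
  | 0 => isConcrete_unit
  | n + 1 => isConcrete_lift (A := A) (isConcrete_iter n)

lemma nat_local {c : C} (x : (natObj (Sh S)).obj.obj (op c)) :
    ∃ R ∈ S.cov c, ∀ ⦃d : C⦄ (f : d ⟶ c), R f → ∃ n,
      (natObj (Sh S)).obj.map f.op x = (natPt (Sh S) n).hom.app (op d) PUnit.unit := by
  obtain ⟨R, hR, h⟩ := colimit_local _ x
  refine ⟨R, hR, fun d f hf => ?_⟩
  obtain ⟨⟨n⟩, y, hy⟩ := h f hf
  exact ⟨n, hy⟩

lemma map_natPt {c d : C} (f : d ⟶ c) (n : ℕ) :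
    (natObj (Sh S)).obj.map f.op ((natPt (Sh S) n).hom.app (op c) PUnit.unit) =
      (natPt (Sh S) n).hom.app (op d) PUnit.unit :=
  (NatTrans.naturality_apply (natPt (Sh S) n).hom f.op PUnit.unit).symm

/-- On a common refinement both elements are numerals. A piece with a point distinguishes different
numerals, and over a piece without points a sheaf has at most one element. -/
lemma isConcrete_nat (A : AdmissibleMonos S) : IsConcrete (natObj (Sh S)) := by
  intro c x y hxy
  obtain ⟨R, hR, hx⟩ := nat_local x
  obtain ⟨T, hT, hy⟩ := nat_local y
  refine (sh_isSheafFor _ R hR).isSeparatedFor.ext fun d f hf => ?_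
  obtain ⟨T', hT', h'⟩ := S.cov.pullback f T hT
  refine (sh_isSheafFor _ T' hT').isSeparatedFor.ext fun e g hg => ?_
  obtain ⟨a, l, i, hi, hl⟩ := h' hg
  obtain ⟨n, hn⟩ := hx f hf
  obtain ⟨k, hk⟩ := hy i hi
  by_cases he : IsEmpty (S.star ⟶ e)
  · exact eq_of_toZero _ ((A.nonempty_toZero_iff e).2 he).some _ _
  · obtain ⟨p⟩ := not_isEmpty_iff.1 he
    have hn' : (natObj (Sh S)).obj.map g.op ((natObj (Sh S)).obj.map f.op x) =
        (natPt (Sh S) n).hom.app (op e) PUnit.unit := (congrArg _ hn).trans (map_natPt g n)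
    have hk' : (natObj (Sh S)).obj.map g.op ((natObj (Sh S)).obj.map f.op y) =
        (natPt (Sh S) k).hom.app (op e) PUnit.unit := by
      rw [← map_comp_apply, ← hl, map_comp_apply]
      exact (congrArg _ hk).trans (map_natPt l k)
    rw [hn', hk']
    have h₁ : elt (natPt (Sh S) n) = elt (natPt (Sh S) k) := by
      rw [elt, elt, ← map_natPt p n, ← map_natPt p k, ← hn', ← hk', ← map_comp_apply,
        ← map_comp_apply, ← map_comp_apply, ← map_comp_apply]
      have := congrFun hxy ((p ≫ g) ≫ f)
      exact this
    have h₂ : n = k := natPt_injective_of_ne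
      (fun h => ret_ne_bot (A := A) (𝟙 _) ((Category.id_comp _).trans h)) (pt_ext h₁)
    rw [h₂]

/-- Sheaves in terms of points and plots. -/
def plotModel (A : AdmissibleMonos S) : PlotModel A (shLifting A) where
  plots X c := { g | ∃ x : X.obj.obj (op c), ∀ p, elt (g p) = X.obj.map p.op x }
  const_mem {X} c x := ⟨X.obj.map (S.isTerminal.from c).op (elt x), fun p => by
    rw [← map_comp_apply, map_star]⟩
  pre_mem {X} _ _ h g := fun ⟨x, hx⟩ => ⟨X.obj.map h.op x, fun p => by
    rw [hx, map_comp_apply]⟩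
  comp_mem {X Y} f c g := fun ⟨x, hx⟩ => ⟨f.hom.app (op c) x, fun p =>
    (congrArg (f.hom.app (op S.star)) (hx p)).trans (NatTrans.naturality_apply f.hom p.op x)⟩
  lift_mem {X Y} c g hg k hk := by
    obtain ⟨x, hx⟩ := hg
    obtain ⟨y, hy⟩ := hk
    exact ⟨(show (X ⊗ Y).obj.obj (op c) from (x, y)), fun p => Prod.ext (hx p) (hy p)⟩
  omegaBar_mem {c} g hg := by
    choose x hx using hg
    -- The elements inducing the components were chosen independently; they are compatible because
    -- each `Lⁿ 1` is concrete and the components agree on points.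
    obtain ⟨y, hy⟩ := limit_exists (Functor.ofOpSequence (shLifting A).proj) (c := c)
      (fun n => x n.unop) fun i j k => isConcrete_iter (A := A) j.unop c (funext fun p => by
        refine (NatTrans.naturality_apply
          ((Functor.ofOpSequence (shLifting A).proj).map k).hom p.op _).symm.trans ?_
        refine (congrArg _ (hx i.unop p).symm).trans (Eq.trans ?_ (hx j.unop p))
        exact congrArg (fun l => elt (g p ≫ l))
          (limit.w (Functor.ofOpSequence (shLifting A).proj) k))
    refine ⟨y, fun p => ?_⟩
    have h : g p = pt ((shLifting A).omegaBar.obj.map p.op y) :=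
      (shLifting A).omegaBar_hom_ext fun n => pt_ext ((hx n p).trans
        ((congrArg _ (hy (op n)).symm).trans (map_elt_comp ((shLifting A).omegaBarπ n) y p).symm))
    rw [h, elt_pt]
  lift_mem_iff {X c} g := by
    constructor
    · rintro ⟨s, hs⟩
      obtain ⟨d, m, hm, h⟩ := PartialElem.dom s
      obtain ⟨x, hx⟩ := Option.isSome_iff_exists.1 ((h m).2 ⟨𝟙 d, Category.id_comp m⟩)
      refine ⟨d, m, hm, fun p hp => pt_ext ((hs p).trans (PartialElem.restrict_eq_bot s ?_)),
        fun q => pt (X.obj.map q.op x), ⟨x, fun q => elt_pt _⟩, fun q => pt_ext ?_⟩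
      · rw [← Option.not_isSome_iff_eq_none]
        exact fun h' => hp ((h p).1 h')
      · refine (hs _).trans ((PartialElem.val_comp_mono s hx q).trans ?_)
        exact congrArg PartialElem.unit (elt_pt _).symm
    · rintro ⟨d, m, hm, h, r, ⟨x, hx⟩, hgr⟩
      refine ⟨PartialElem.ofMono A m hm x, fun p => ?_⟩
      by_cases hp : FactorsVia p m
      · obtain ⟨q, rfl⟩ := hp
        refine (congrArg elt (hgr q)).trans ?_
        refine Eq.trans ?_ (PartialElem.val_comp_mono _ (PartialElem.ofMono_val_self m hm x) q).symm
        exact congrArg PartialElem.unit (hx q)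
      · refine (congrArg elt (h p hp)).trans ?_
        exact (PartialElem.restrict_eq_bot (PartialElem.ofMono A m hm x) (dif_neg hp)).symm
  pt_lift {X} p := by
    have hs := PartialElem.restrict_id (A := A) (X := X) (elt p)
    cases h : PartialElem.val (elt p) (𝟙 S.star) with
    | none => exact Or.inl (pt_ext (hs.symm.trans (PartialElem.restrict_eq_bot _ h)))
    | some x =>
      have h₁ := PartialElem.val_comp_mono _ h (𝟙 _)
      rw [Category.comp_id, hs] at h₁
      refine Or.inr ⟨pt x, pt_ext (h₁.trans (congrArg PartialElem.unit ?_))⟩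
      exact (map_id_apply X x).trans (elt_pt x).symm
  ret_ne_bot := ret_ne_bot
  mono_ret X := ⟨fun f g h => hom_ext' fun c x => PartialElem.unit_injective (A := A)
    (congrArg (fun k => k.hom.app (op c) x) h)⟩
  -- Over an object with points `⊥` is undefined; over one without points every partial element is
  -- defined. So the join is defined exactly where `⊥` is.
  bot_join X := pt_ext (PartialElem.eq_bot A fun e k => by
    change ((PartialElem.val (PartialElem.bot A (shLift A X) S.star) k).bind fun t =>
      PartialElem.val t (𝟙 e)).isSome ↔ _
    have h := PartialElem.bot_isSome A (shLift A X) S.star k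
    cases hv : PartialElem.val (PartialElem.bot A (shLift A X) S.star) k with
    | none =>
      rw [hv] at h
      exact h
    | some t =>
      rw [hv] at h
      exact ⟨fun _ => h.1 rfl, fun he => PartialElem.isSome_of_toZero t _ he⟩)
  total {X B} k hk := by
    have hk' : ∀ (c : C) (b : B.obj.obj (op c)),
        ∃ x, PartialElem.val (k.hom.app (op c) b) (𝟙 c) = some x := fun c b => by
      have h := congrArg (fun l => PartialElem.val (l.hom.app (op c) b) (𝟙 c)) hk
      obtain ⟨x, hx, -⟩ := Option.map_eq_some_iff.1 h
      exact ⟨x, hx⟩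
    choose φ hφ using hk'
    have hφ' : ∀ {c d : C} (f : d ⟶ c) (b : B.obj.obj (op c)),
        PartialElem.val (k.hom.app (op c) b) f = some (φ d (B.obj.map f.op b)) := fun f b => by
      rw [← hφ, NatTrans.naturality_apply k.hom f.op b]
      exact congrArg (fun l => PartialElem.val (k.hom.app (op _) b) l) (Category.id_comp f).symm
    have hnat : ∀ {c d : C} (f : d ⟶ c) (b : B.obj.obj (op c)),
        φ d (B.obj.map f.op b) = X.obj.map f.op (φ c b) := fun f b => by
      refine Option.some_injective _ ((hφ' f b).symm.trans ?_)
      have h := PartialElem.val_comp (k.hom.app (op _) b) (𝟙 _) f _ (hφ _ b)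
      rwa [Category.comp_id] at h
    refine ⟨⟨{ app := fun c => ↾(φ c.unop), naturality := fun c d f => ?_ }⟩,
      hom_ext' fun c b => ?_⟩
    · ext b
      exact hnat f.unop b
    · exact PartialElem.ext (funext fun d => funext fun f =>
        (congrArg some (hnat f b)).symm.trans (hφ' f b).symm)
  restrict {X} α hα := hom_ext' fun c s => by
    refine PartialElem.ext (funext fun d => funext fun f => ?_)
    change Option.map _ (Option.map _ (Option.map _ (PartialElem.val s f))) = PartialElem.val s f
    cases hx : PartialElem.val s f with
    | none => rfl
    | some x =>
      refine congrArg some ?_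
      have h₁ := PartialElem.val_comp_mono s hx (𝟙 d)
      rw [Category.id_comp, map_id_apply] at h₁
      refine (NatTrans.naturality_apply α.hom f.op s).symm.trans ((congrArg _ h₁).trans ?_)
      exact congrArg (fun l : X ⟶ X => l.hom.app (op d) x) hα
  omega_pt p := by
    obtain ⟨R, hR, h⟩ := colimit_local _ (elt p)
    -- The identity of `⋆` lifts to a member of the cover, so an element that comes from a stage
    -- only locally does so globally over `⋆`.
    obtain ⟨d, f, hf, q, hq⟩ := S.cov_points R hR (𝟙 _)
    obtain ⟨n, y, hy⟩ := h f hf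
    refine ⟨n, pt (((shLifting A).iter n).obj.map q.op y), pt_ext ?_⟩
    refine Eq.trans ?_ (map_elt_comp ((shLifting A).omegaι n) y q).symm
    refine Eq.trans ?_ (congrArg _ hy)
    have h₁ := map_comp_apply (shLifting A).omega q f (elt p)
    rw [hq, map_id_apply] at h₁
    exact h₁
  Concrete := IsConcrete
  concrete_unit := isConcrete_unit
  concrete_nat := isConcrete_nat A
  nat_local {c} g hg := by
    obtain ⟨x, hx⟩ := hg
    obtain ⟨R, hR, h⟩ := nat_local x
    refine ⟨R, hR, fun d f hf => ?_⟩
    obtain ⟨n, hn⟩ := h f hf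
    refine ⟨n, fun p => pt_ext ?_⟩
    rw [hx, map_comp_apply, hn]
    exact map_natPt p n
  concrete_lift := isConcrete_lift
  hom_ext {X B} hX {f g} h := hom_ext' fun c x => hX c (funext fun p => by
    have h₁ := congrArg elt (h (pt (B.obj.map p.op x)))
    rwa [map_elt_comp, map_elt_comp] at h₁)
  exists_hom {X B} hX φ h := by
    have h' : ∀ (c : C) (b : B.obj.obj (op c)), ∃ x : X.obj.obj (op c),
        ∀ p : S.star ⟶ c, elt (φ (pt (B.obj.map p.op b))) = X.obj.map p.op x := fun c b =>
      h c _ ⟨b, fun p => elt_pt _⟩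
    -- Elements inducing the image plots are chosen arbitrarily; concreteness of `X` makes them
    -- unique, hence natural.
    choose ψ hψ using h'
    refine ⟨⟨{ app := fun c => ↾(ψ c.unop), naturality := fun c d f => ?_ }⟩, fun b => pt_ext ?_⟩
    · ext b
      refine hX _ (funext fun p => ?_)
      refine (hψ _ _ p).symm.trans (Eq.trans ?_ (map_comp_apply X p f.unop _))
      refine Eq.trans ?_ (hψ _ b (p ≫ f.unop))
      exact congrArg (fun z => elt (φ (pt z))) (map_comp_apply B p f.unop b).symm
    · have h₁ := hψ _ (elt b) (𝟙 _)
      rw [map_id_apply, map_id_apply, pt_ext (elt_pt (elt b))] at h₁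
      exact h₁.symm
  glue {X} hX {c} g R hR h := by
    choose x hx using h
    -- The local elements form a matching family because they have the same points and `X` is
    -- concrete.
    obtain ⟨y, hy, -⟩ := sh_isSheafFor X R hR x fun d d' a k k' f f' hf hf' hkf =>
      hX _ (funext fun p => by
        dsimp only
        rw [← map_comp_apply, ← map_comp_apply, ← hx, ← hx]
        dsimp only
        rw [Category.assoc, Category.assoc, hkf])
    refine ⟨y, fun p => ?_⟩
    obtain ⟨d, f, hf, q, rfl⟩ := S.cov_points R hR p
    rw [hx f hf q, map_comp_apply, hy f hf]

end Sh

end SheafPlots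

end SheafPCF

theorem theorem7 {C : Type u} [SmallCategory C] (S : ConcreteSite C) (A : AdmissibleMonos S)
    (Sg : Signature.{u, v, w}) :
    (∀ I : SigInterp (shLifting (WithV.admissible A)) Sg,
      (∀ α, IsConcrete (I.obj α)) →
      (∀ α, (shLifting (WithV.admissible A)).WellComplete (I.obj α)) →
      I.SoundAdequate) ∧
    (∀ I : SigInterp (Conc.concLifting (WithV.admissible A)) Sg,
      (∀ α, (Conc.concLifting (WithV.admissible A)).WellComplete (I.obj α)) →
      I.SoundAdequate) :=
  ⟨fun I hI hw => (Sh.plotModel (WithV.admissible A)).soundAdequate I hI hw,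
    fun I hw => (Conc.plotModel (WithV.admissible A)).soundAdequate I (fun _ => trivial) hw⟩
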